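/- Let $\Gamma$ be an abelian group and let $A$ and $B$ be $\Gamma$-graded rings (associative with identity). Modules are unitary right modules. $\operatorname{Mod-}A$ is the category of right $A$-modules. $\operatorname{Gr-}A$ is the category of $\Gamma$-graded right $A$-modules $M=\bigoplus_{\gamma\in\Gamma}M_\gamma$ (so $M_\gamma A_\alpha\subseteq M_{\gamma+\alpha}$), with the $A$-linear maps $f$ satisfying $f(M_\gamma)\subseteq N_\gamma$ for all $\gamma$ as morphisms. $U$ denotes the forgetful functors $\operatorname{Gr-}A\to\operatorname{Mod-}A$ and $\operatorname{Gr-}B\to\operatorname{Mod-}B$, and $\mathcal T_\alpha$ the shift functor $M\mapsto M(\alpha)$, where $M(\alpha)_\gamma=M_{\gamma+\alpha}$. All functors are additive. We use the following notions. * A functor $\phi:\operatorname{Gr-}A\to\operatorname{Gr-}B$ is *graded* if $\phi\mathcal T_\alpha=\mathcal T_\alpha\phi$ (equality of functors) for all $\alpha\in\Gamma$. It is a *graded equivalence* if it is graded and there is a graded functor $\psi:\operatorname{Gr-}B\to\operatorname{Gr-}A$ with $\psi\phi\cong 1$ and $\phi\psi\cong 1$ (these natural isomorphisms need not be compatible with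 the shifts). * A graded functor $\phi:\operatorname{Gr-}A\to\operatorname{Gr-}B$ is an *associated graded functor* of $\phi':\operatorname{Mod-}A\to\operatorname{Mod-}B$ if $U\phi=\phi'U$ (equality of functors). A functor $\phi':\operatorname{Mod-}A\to\operatorname{Mod-}B$ is a *graded equivalence* if it is an equivalence of categories that has an associated graded functor. * A *graded progenerator* is a finitely generated graded right $A$-module $P$ that is a projective object of $\operatorname{Gr-}A$ and a graded generator: for every nonzero morphism $f:M\to N$ in $\operatorname{Gr-}A$ there are $\alpha\in\Gamma$ and a morphism $g:P(\alpha)\to M$ in $\operatorname{Gr-}A$ with $fg\neq0$. Its endomorphism ring $\operatorname{End}_A(P)$ is graded by $\operatorname{End}_A(P)_\gamma=\{f : f(P_\beta)\subseteq P_{\beta+\gamma}\text{ for all }\beta\in\Gamma\}$. * For $n\ge 1$ and $\overline\delta=(\delta_1,\dots,\delta_n)\in\Gamma^n$, $\mathbb M_n(A)(\overline\delta)$ is the ring of $n\times n$ matrices over $A$, in which a matrix is homogeneous of degree $\gamma$ when its $(i,j)$ entry lies in $A_{\gamma+\delta_j-\delta_i}$ for all $i,j$. An idempotent $e$ of a ring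 $R$ is *full* if $ReR=R$. For a homogeneous idempotent $e$ of a graded ring $R$, the ring $eRe$ (with identity $e$) carries the grading $(eRe)_\gamma=eRe\cap R_\gamma$. * $\cong_{\mathrm{gr}}$ denotes a ring isomorphism that preserves the homogeneous components. A *graded $A$-$B$-bimodule* is an $A$-$B$-bimodule $Q=\bigoplus_\gamma Q_\gamma$ with $A_\alpha Q_\gamma B_\beta\subseteq Q_{\alpha+\gamma+\beta}$; for $M$ in $\operatorname{Gr-}A$ the $B$-module $M\otimes_AQ$ is graded, its component of degree $\gamma$ being generated by the $m\otimes q$ with $m\in M_i$, $q\in Q_j$, $i+j=\gamma$. **Theorem.** (a) The following are equivalent: 1. there is a graded equivalence $\operatorname{Mod-}A\to\operatorname{Mod-}B$; 2. there is a graded equivalence $\operatorname{Gr-}A\to\operatorname{Gr-}B$; 3. $B\cong_{\mathrm{gr}}\operatorname{End}_A(P)$ for a graded progenerator $P$ in $\operatorname{Gr-}A$; 4. $B\cong_{\mathrm{gr}}e\,\mathbb M_n(A)(\overline\delta)\,e$ for some $n\ge1$, some $\overline\delta\in\Gamma^n$ and some full homogeneous idempotent $e\in\mathbb M_n(A)(\overline\delta)$.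 (b) Let $\phi:\operatorname{Gr-}A\to\operatorname{Gr-}B$ be a graded equivalence. Then there is a graded equivalence $\phi':\operatorname{Mod-}A\to\operatorname{Mod-}B$ with an associated graded functor isomorphic to $\phi$. More precisely, there is a graded $A$-$B$-bimodule $Q$ such that $\phi\cong-\otimes_AQ$ as functors $\operatorname{Gr-}A\to\operatorname{Gr-}B$, the functor $-\otimes_AQ:\operatorname{Mod-}A\to\operatorname{Mod-}B$ is a graded equivalence, and the graded functor $-\otimes_AQ:\operatorname{Gr-}A\to\operatorname{Gr-}B$ is an associated graded functor of it; that is, $U\circ(-\otimes_AQ)=(-\otimes_AQ)\circ U$. -/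

import Mathlib

open CategoryTheory MulOpposite
open scoped TensorProduct

universe u w

namespace GradedMorita

/-! ### Internal direct sums of subgroups -/

section Internal

variable {Γ : Type*} [DecidableEq Γ] {T : Type*} [AddCommGroup T]

theorem isInternal_iff (G : Γ → AddSubgroup T) :
    DirectSum.IsInternal G ↔ iSupIndep G ∧ ∀ x, x ∈ ⨆ γ, G γ := by
  have hr : (DirectSum.coeAddMonoidHom G).range = ⨆ γ, G γ := by
    refine le_antisymm ?_ (iSup_le fun γ x hx => ⟨DirectSum.of (fun i => G i) γ ⟨x, hx⟩, by simp⟩)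
    rintro _ ⟨y, rfl⟩
    induction y using DirectSum.induction_on with
    | zero => simp
    | of i y => simpa using AddSubgroup.mem_iSup_of_mem i y.2
    | add y z hy hz => rw [map_add]; exact add_mem hy hz
  constructor
  · intro h
    refine ⟨h.addSubgroup_iSupIndep, fun x => ?_⟩
    rw [← hr]
    exact h.2 x
  · rintro ⟨h, h'⟩
    refine ⟨h.dfinsuppSumAddHom_injective, fun x => ?_⟩
    have := h' x
    rwa [← hr] at this

/-- Translating the indices preserves direct sum decompositions. -/
theorem isInternal_shift [AddGroup Γ] {G : Γ → AddSubgroup T}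
    (h : DirectSum.IsInternal G) (α : Γ) : DirectSum.IsInternal fun γ => G (γ + α) := by
  rw [isInternal_iff] at h ⊢
  refine ⟨h.1.comp (add_left_injective α), fun x => ?_⟩
  have := h.2 x
  rwa [← (Equiv.addRight α).iSup_comp] at this

/-- A family of subgroups that generates `T` is a direct sum decomposition if its components can
be separated by an additive map. -/
theorem isInternal_of_separated {G : Γ → AddSubgroup T} (D : T →+ (Γ →₀ T))
    (hD : ∀ γ, ∀ x ∈ G γ, D x = Finsupp.single γ x) (hG : ∀ x, x ∈ ⨆ γ, G γ) :
    DirectSum.IsInternal G := by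
  rw [isInternal_iff]
  refine ⟨iSupIndep_of_dfinsuppSumAddHom_injective' _ ?_, hG⟩
  have key : ∀ (y : DirectSum Γ fun i => G i) (γ : Γ),
      D (DirectSum.coeAddMonoidHom G y) γ = (y γ : T) := by
    intro y γ
    induction y using DirectSum.induction_on with
    | zero => simp
    | of i y =>
      rw [DirectSum.coeAddMonoidHom_of, hD i y y.2, DirectSum.coe_of_apply, Finsupp.single_apply]
      split_ifs <;> rfl
    | add y z hy hz => simp [hy, hz]
  intro y z hyz
  refine DFinsupp.ext fun γ => Subtype.ext ?_
  rw [← key y γ, ← key z γ]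
  exact DFunLike.congr_fun (congrArg D hyz) γ

/-- Elements of a direct sum decomposition can be tested on homogeneous elements. -/
theorem isInternal_induction {G : Γ → AddSubgroup T} (hG : DirectSum.IsInternal G)
    {p : T → Prop} (zero : p 0) (hom : ∀ γ, ∀ x ∈ G γ, p x)
    (add : ∀ x y, p x → p y → p (x + y)) (x : T) : p x := by
  exact AddSubgroup.iSup_induction G (C := p) (((isInternal_iff G).1 hG).2 x) hom zero add

end Internal

/-! ### Graded modules

Rings are graded by an abelian group `Γ`; a right `A`-module is a module over `Aᵐᵒᵖ`,
with `m a` written `op a • m`. -/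

section GradedModules

variable {Γ : Type w} [AddCommGroup Γ] [DecidableEq Γ] {A : Type u} [Ring A]

/-- A `Γ`-graded right module over the `Γ`-graded ring `(A, 𝒜)`. -/
structure GrMod (𝒜 : Γ → AddSubgroup A) where
  carrier : Type u
  [addCommGroup : AddCommGroup carrier]
  [module : Module Aᵐᵒᵖ carrier]
  /-- the homogeneous components -/
  deg : Γ → AddSubgroup carrier
  isInternal : DirectSum.IsInternal deg
  smul_mem : ∀ {α γ : Γ} {a : A} {m : carrier}, a ∈ 𝒜 α → m ∈ deg γ → op a • m ∈ deg (γ + α)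

attribute [instance] GrMod.addCommGroup GrMod.module

variable {𝒜 : Γ → AddSubgroup A}

instance : CoeSort (GrMod 𝒜) (Type u) := ⟨GrMod.carrier⟩

/-- `Hom_A(M, N)_δ`: the `A`-linear maps `f` with `f(M_γ) ⊆ N_{γ+δ}` for all `γ`. -/
def homDeg (M N : GrMod 𝒜) (δ : Γ) : AddSubgroup (M →ₗ[Aᵐᵒᵖ] N) where
  carrier := {f | ∀ γ : Γ, ∀ m ∈ M.deg γ, f m ∈ N.deg (γ + δ)}
  zero_mem' := fun _ _ _ => zero_mem _
  add_mem' := fun hf hg γ m hm => add_mem (hf γ m hm) (hg γ m hm)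
  neg_mem' := fun hf γ m hm => neg_mem (hf γ m hm)

/-- The category `Gr-A`: its morphisms are the graded homomorphisms (of degree `0`). -/
instance : Category (GrMod 𝒜) where
  Hom M N := homDeg M N 0
  id M := ⟨LinearMap.id, fun γ m hm => by simpa using hm⟩
  comp f g := ⟨g.1.comp f.1, fun γ m hm => by
    simpa using g.2 _ _ (f.2 γ m hm)⟩

/-- The linear map underlying a morphism of `Gr-A`. -/
def GrMod.toLin {M N : GrMod 𝒜} (f : M ⟶ N) : M →ₗ[Aᵐᵒᵖ] N := Subtype.val f

theorem GrMod.toLin_mem {M N : GrMod 𝒜} (f : M ⟶ N) {γ : Γ} {m : M} (hm : m ∈ M.deg γ) :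
    GrMod.toLin f m ∈ N.deg γ := by
  have := Subtype.property f γ m hm
  rwa [add_zero] at this

/-- A degree-preserving linear map as a morphism of `Gr-A`. -/
def GrMod.ofLin {M N : GrMod 𝒜} (f : M →ₗ[Aᵐᵒᵖ] N) (hf : ∀ γ, ∀ m ∈ M.deg γ, f m ∈ N.deg γ) :
    M ⟶ N :=
  ⟨f, fun γ m hm => by rw [add_zero]; exact hf γ m hm⟩

@[ext]
theorem GrMod.hom_ext {M N : GrMod 𝒜} {f g : M ⟶ N} (h : toLin f = toLin g) : f = g :=
  Subtype.ext h

@[simp] theorem GrMod.toLin_ofLin {M N : GrMod 𝒜} (f : M →ₗ[Aᵐᵒᵖ] N)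
    (hf : ∀ γ, ∀ m ∈ M.deg γ, f m ∈ N.deg γ) : toLin (ofLin f hf) = f := rfl

@[simp] theorem GrMod.toLin_id (M : GrMod 𝒜) : toLin (𝟙 M) = LinearMap.id := rfl

@[simp] theorem GrMod.toLin_comp {M N P : GrMod 𝒜} (f : M ⟶ N) (g : N ⟶ P) :
    toLin (f ≫ g) = (toLin g).comp (toLin f) := rfl

/-- Morphisms of `Gr-A` are added pointwise. -/
instance : Preadditive (GrMod 𝒜) where
  homGroup M N := inferInstanceAs (AddCommGroup (homDeg M N 0))
  add_comp := fun _ _ _ f f' g => Subtype.ext (LinearMap.comp_add (Subtype.val f)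
    (Subtype.val f') (Subtype.val g))
  comp_add := fun _ _ _ f g g' => Subtype.ext (LinearMap.add_comp (Subtype.val f)
    (Subtype.val g') (Subtype.val g))

/-- The shift `M(α)`, with `M(α)_γ = M_{γ+α}`. -/
def GrMod.shift (α : Γ) (M : GrMod 𝒜) : GrMod 𝒜 where
  carrier := M
  deg γ := M.deg (γ + α)
  isInternal := isInternal_shift M.isInternal α
  smul_mem := fun {β γ _ _} ha hm => by
    rw [add_right_comm γ β α]
    exact M.smul_mem ha hm

/-- The suspension functor `𝒯_α : Gr-A ⥤ Gr-A`, `M ↦ M(α)`. -/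
def suspension (𝒜 : Γ → AddSubgroup A) (α : Γ) : GrMod 𝒜 ⥤ GrMod 𝒜 where
  obj M := M.shift α
  map {M N} f := GrMod.ofLin (M := M.shift α) (N := N.shift α) (GrMod.toLin (M := M) (N := N) f)
    fun _ _ hm => GrMod.toLin_mem (M := M) (N := N) f hm

/-- The forgetful functor `U : Gr-A ⥤ Mod-A`. -/
def forgetGrading (𝒜 : Γ → AddSubgroup A) : GrMod 𝒜 ⥤ ModuleCat.{u} Aᵐᵒᵖ where
  obj M := ModuleCat.of Aᵐᵒᵖ M
  map f := ModuleCat.ofHom (GrMod.toLin f)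

/-- `P` is a graded generator: for every nonzero `f : M ⟶ N` in `Gr-A` there are `α` and
`g : P(α) ⟶ M` such that the composite `P(α) ⟶ M ⟶ N` is nonzero. -/
def IsGradedGenerator (P : GrMod 𝒜) : Prop :=
  ∀ ⦃M N : GrMod 𝒜⦄ (f : M ⟶ N), f ≠ 0 → ∃ (α : Γ) (g : P.shift α ⟶ M), g ≫ f ≠ 0

/-- A graded progenerator: a graded generator that is finitely generated and a projective
object of `Gr-A`. -/
def IsGradedProgenerator (P : GrMod 𝒜) : Prop :=
  Module.Finite Aᵐᵒᵖ P ∧ Projective P ∧ IsGradedGenerator P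

end GradedModules

section GradedRings

variable {Γ : Type w} [AddCommGroup Γ]

/-- `A ≅_gr B`: a ring isomorphism that identifies the homogeneous components. -/
def GradedIso {A B : Type*} [Ring A] [Ring B] (𝒜 : Γ → AddSubgroup A) (ℬ : Γ → AddSubgroup B) :
    Prop :=
  ∃ f : A ≃+* B, ∀ (γ : Γ) (a : A), a ∈ 𝒜 γ ↔ f a ∈ ℬ γ

/-- The components `End_A(P)_γ` of `End_A(P)`, whose product is composition of maps. -/
def endGrading [DecidableEq Γ] {A : Type u} [Ring A] {𝒜 : Γ → AddSubgroup A} (P : GrMod 𝒜) :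
    Γ → AddSubgroup (Module.End Aᵐᵒᵖ P) :=
  fun γ => homDeg P P γ

/-- The components of `M_n(A)(δ₁, …, δ_n)`: the `(i, j)` entry of a matrix of degree `γ` lies in
`A_{γ + δ_j - δ_i}`. -/
def matrixGrading {A : Type*} [Ring A] (𝒜 : Γ → AddSubgroup A) {n : ℕ} (δ : Fin n → Γ) (γ : Γ) :
    AddSubgroup (Matrix (Fin n) (Fin n) A) where
  carrier := {X | ∀ i j, X i j ∈ 𝒜 (γ + δ j - δ i)}
  zero_mem' := fun _ _ => zero_mem _
  add_mem' := fun hX hY i j => add_mem (hX i j) (hY i j)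
  neg_mem' := fun hX i j => neg_mem (hX i j)

/-- An idempotent `e` of `R` is full if `R e R = R`. -/
def IsFull {R : Type*} [Ring R] (e : R) : Prop :=
  AddSubgroup.closure {z : R | ∃ x y : R, z = x * e * y} = ⊤

/-- The components of the corner ring `e R e`, whose identity is `e`. -/
def cornerGrading {R : Type*} [Ring R] (ℛ : Γ → AddSubgroup R) {e : R} (he : IsIdempotentElem e)
    (γ : Γ) : AddSubgroup he.Corner where
  carrier := {x | x.1 ∈ ℛ γ}
  zero_mem' := zero_mem (ℛ γ)
  add_mem' := fun hx hy => add_mem (S := AddSubgroup R) hx hy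
  neg_mem' := fun hx => neg_mem (S := AddSubgroup R) hx

end GradedRings

section GradedFunctors

variable {Γ : Type w} [AddCommGroup Γ] [DecidableEq Γ] {A B : Type u} [Ring A] [Ring B]
  {𝒜 : Γ → AddSubgroup A} {ℬ : Γ → AddSubgroup B}

/-- A graded functor `φ : Gr-A ⥤ Gr-B`: an additive functor with `φ 𝒯_α = 𝒯_α φ` for all `α`. -/
def IsGradedFunctor (φ : GrMod 𝒜 ⥤ GrMod ℬ) : Prop :=
  φ.Additive ∧ ∀ α : Γ, suspension 𝒜 α ⋙ φ = φ ⋙ suspension ℬ α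

/-- A graded equivalence `Gr-A ⥤ Gr-B`: a graded functor with a graded quasi-inverse. The natural
isomorphisms need not be compatible with the suspensions. -/
def IsGradedEquivalence (φ : GrMod 𝒜 ⥤ GrMod ℬ) : Prop :=
  IsGradedFunctor φ ∧ ∃ ψ : GrMod ℬ ⥤ GrMod 𝒜, IsGradedFunctor ψ ∧
    Nonempty (φ ⋙ ψ ≅ 𝟭 (GrMod 𝒜)) ∧ Nonempty (ψ ⋙ φ ≅ 𝟭 (GrMod ℬ))

/-- `φ` is an associated graded functor of `φ' : Mod-A ⥤ Mod-B`: it is graded and `U φ = φ' U`. -/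
def IsAssociated (φ : GrMod 𝒜 ⥤ GrMod ℬ) (φ' : ModuleCat.{u} Aᵐᵒᵖ ⥤ ModuleCat.{u} Bᵐᵒᵖ) : Prop :=
  IsGradedFunctor φ ∧ φ ⋙ forgetGrading ℬ = forgetGrading 𝒜 ⋙ φ'

variable (𝒜 ℬ) in
/-- A graded equivalence `Mod-A ⥤ Mod-B`: an (additive) equivalence that has an associated graded
functor. -/
def IsGradedModEquivalence (φ' : ModuleCat.{u} Aᵐᵒᵖ ⥤ ModuleCat.{u} Bᵐᵒᵖ) : Prop :=
  φ'.Additive ∧ φ'.IsEquivalence ∧ ∃ φ : GrMod 𝒜 ⥤ GrMod ℬ, IsAssociated φ φ'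

end GradedFunctors

/-! ### Tensor products over a noncommutative ring -/

section Tensor

variable (A B : Type*) [Ring A] [Ring B] (M : Type*) [AddCommGroup M] [Module Aᵐᵒᵖ M]
  (Q : Type*) [AddCommGroup Q] [Module A Q] [Module Bᵐᵒᵖ Q]

/-- The relations `m a ⊗ q = m ⊗ a q`. The two factors of the tensor product over `ℤ` are written
in the opposite order, so that the right action of `B` on `Q` is an action on the first factor. -/
def balanced : Submodule Bᵐᵒᵖ (Q ⊗[ℤ] M) :=
  Submodule.span Bᵐᵒᵖ {x | ∃ (m : M) (a : A) (q : Q), x = q ⊗ₜ[ℤ] (op a • m) - (a • q) ⊗ₜ[ℤ] m}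

/-- The right `B`-module `M ⊗_A Q`, for a right `A`-module `M` and an `A`-`B`-bimodule `Q`. -/
abbrev Tens : Type _ := (Q ⊗[ℤ] M) ⧸ balanced A B M Q

variable {M Q} in
/-- The pure tensor `m ⊗ q` in `M ⊗_A Q`. -/
def Tens.tmul (m : M) (q : Q) : Tens A B M Q := (balanced A B M Q).mkQ (q ⊗ₜ[ℤ] m)

variable {A M} in
/-- `f ⊗_A Q : M ⊗_A Q → N ⊗_A Q`. -/
def Tens.map {N : Type*} [AddCommGroup N] [Module Aᵐᵒᵖ N] (f : M →ₗ[Aᵐᵒᵖ] N) :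
    Tens A B M Q →ₗ[Bᵐᵒᵖ] Tens A B N Q :=
  (balanced A B M Q).mapQ (balanced A B N Q)
    (TensorProduct.AlgebraTensorModule.lTensor Bᵐᵒᵖ Q f.toAddMonoidHom.toIntLinearMap) (by
      rw [balanced, Submodule.span_le]
      rintro _ ⟨m, a, q, rfl⟩
      refine Submodule.subset_span ⟨f m, a, q, ?_⟩
      simp)

theorem Tens.tmul_add (m : M) (q q' : Q) :
    Tens.tmul A B m (q + q') = Tens.tmul A B m q + Tens.tmul A B m q' := by
  simp [Tens.tmul, TensorProduct.add_tmul]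

theorem Tens.add_tmul (m m' : M) (q : Q) :
    Tens.tmul A B (m + m') q = Tens.tmul A B m q + Tens.tmul A B m' q := by
  simp [Tens.tmul, TensorProduct.tmul_add]

theorem Tens.smul_tmul (m : M) (a : A) (q : Q) :
    Tens.tmul A B (op a • m) q = Tens.tmul A B m (a • q) :=
  (Submodule.Quotient.eq _).2 (Submodule.subset_span ⟨m, a, q, rfl⟩)

theorem Tens.op_smul_tmul (m : M) (q : Q) (b : B) :
    op b • Tens.tmul A B m q = Tens.tmul A B m (op b • q) := rfl

@[simp] theorem Tens.map_tmul {N : Type*} [AddCommGroup N] [Module Aᵐᵒᵖ N] (f : M →ₗ[Aᵐᵒᵖ] N)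
    (m : M) (q : Q) : Tens.map B Q f (Tens.tmul A B m q) = Tens.tmul A B (f m) q := rfl

variable {A B M Q} in
theorem Tens.induction {p : Tens A B M Q → Prop} (zero : p 0)
    (tmul : ∀ m q, p (Tens.tmul A B m q)) (add : ∀ x y, p x → p y → p (x + y)) (x) : p x := by
  obtain ⟨x, rfl⟩ := Submodule.mkQ_surjective _ x
  induction x using TensorProduct.induction_on with
  | zero => exact zero
  | tmul q m => exact tmul m q
  | add x y hx hy => rw [map_add]; exact add _ _ hx hy

variable {A M} in
theorem Tens.map_id (x : Tens A B M Q) : Tens.map B Q (LinearMap.id (R := Aᵐᵒᵖ) (M := M)) x = x :=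
  Tens.induction (p := fun x => Tens.map B Q LinearMap.id x = x) (map_zero _)
    (fun _ _ => rfl) (fun x y hx hy => by rw [map_add, hx, hy]) x

variable {A M} in
theorem Tens.map_comp {N P : Type*} [AddCommGroup N] [Module Aᵐᵒᵖ N] [AddCommGroup P]
    [Module Aᵐᵒᵖ P] (f : M →ₗ[Aᵐᵒᵖ] N) (g : N →ₗ[Aᵐᵒᵖ] P) (x : Tens A B M Q) :
    Tens.map B Q (g.comp f) x = Tens.map B Q g (Tens.map B Q f x) :=
  Tens.induction (p := fun x => Tens.map B Q (g.comp f) x = Tens.map B Q g (Tens.map B Q f x))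
    (by simp only [map_zero]) (fun _ _ => rfl)
    (fun x y hx hy => by rw [map_add, map_add, map_add, hx, hy]) x

variable {A M Q} in
/-- The additive map out of `M ⊗_A Q` induced by a balanced biadditive map. -/
theorem Tens.exists_lift [SMulCommClass A Bᵐᵒᵖ Q] {T : Type*} [AddCommGroup T] (f : M →+ Q →+ T)
    (hf : ∀ (m : M) (a : A) (q : Q), f (op a • m) q = f m (a • q)) :
    ∃ g : Tens A B M Q →+ T, ∀ m q, g (Tens.tmul A B m q) = f m q := by
  let F : Q ⊗[ℤ] M →+ T := TensorProduct.liftAddHom f.flip (by intros; simp)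
  have hF : (balanced A B M Q).toAddSubgroup ≤ F.ker := by
    intro x hx
    have hx' : x ∈ balanced A B M Q := hx
    have hs : ∀ (b : Bᵐᵒᵖ) (m : M) (a : A) (q : Q),
        b • (q ⊗ₜ[ℤ] (op a • m) - (a • q) ⊗ₜ[ℤ] m) ∈ F.ker := by
      intro b m a q
      simp only [AddMonoidHom.mem_ker, smul_sub, map_sub, TensorProduct.smul_tmul']
      simp [F, hf, smul_comm a b q]
    refine Submodule.closure_induction (p := fun x _ => x ∈ F.ker) (zero_mem _)
      (fun x y _ _ => add_mem) ?_ hx'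
    rintro b _ ⟨m, a, q, rfl⟩
    exact hs b m a q
  exact ⟨QuotientAddGroup.lift _ F hF, fun m q => rfl⟩

end Tensor

section GradedTensor

variable {Γ : Type w} [AddCommGroup Γ] {A B : Type u} [Ring A] [Ring B]

/-- The components of `M ⊗_A Q`: the component of degree `γ` consists of the sums of the elements
`m ⊗ q` with `m` and `q` homogeneous and `deg m + deg q = γ`. -/
def tensGrading {M Q : Type*} [AddCommGroup M] [Module Aᵐᵒᵖ M] [AddCommGroup Q] [Module A Q]
    [Module Bᵐᵒᵖ Q] (ℳ : Γ → AddSubgroup M) (𝒬 : Γ → AddSubgroup Q)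
    (γ : Γ) : AddSubgroup (Tens A B M Q) :=
  AddSubgroup.closure {x | ∃ i j : Γ, i + j = γ ∧ ∃ m ∈ ℳ i, ∃ q ∈ 𝒬 j, x = Tens.tmul A B m q}

theorem tensGrading_smul_mem {M Q : Type*} [AddCommGroup M] [Module Aᵐᵒᵖ M] [AddCommGroup Q]
    [Module A Q] [Module Bᵐᵒᵖ Q] {ℬ : Γ → AddSubgroup B} {ℳ : Γ → AddSubgroup M}
    {𝒬 : Γ → AddSubgroup Q}
    (hQ : ∀ {β γ : Γ} {b : B} {q : Q}, b ∈ ℬ β → q ∈ 𝒬 γ → op b • q ∈ 𝒬 (γ + β))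
    {β γ : Γ} {b : B} {x : Tens A B M Q} (hb : b ∈ ℬ β) (hx : x ∈ tensGrading ℳ 𝒬 γ) :
    op b • x ∈ tensGrading (A := A) ℳ 𝒬 (γ + β) := by
  rw [tensGrading] at hx
  induction hx using AddSubgroup.closure_induction with
  | mem x hx =>
    obtain ⟨i, j, rfl, m, hm, q, hq, rfl⟩ := hx
    exact AddSubgroup.subset_closure ⟨i, j + β, (add_assoc i j β).symm, m, hm, op b • q,
      hQ hb hq, rfl⟩
  | zero => rw [smul_zero]; exact zero_mem _
  | add x y _ _ hx hy => rw [smul_add]; exact add_mem hx hy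
  | neg x _ hx => rw [smul_neg]; exact neg_mem hx

theorem tensGrading_map_mem {M N Q : Type*} [AddCommGroup M] [Module Aᵐᵒᵖ M] [AddCommGroup N]
    [Module Aᵐᵒᵖ N] [AddCommGroup Q] [Module A Q] [Module Bᵐᵒᵖ Q] {ℳ : Γ → AddSubgroup M}
    {𝒩 : Γ → AddSubgroup N} {𝒬 : Γ → AddSubgroup Q} (f : M →ₗ[Aᵐᵒᵖ] N)
    (hf : ∀ γ, ∀ m ∈ ℳ γ, f m ∈ 𝒩 γ) {γ : Γ} {x : Tens A B M Q} (hx : x ∈ tensGrading ℳ 𝒬 γ) :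
    Tens.map B Q f x ∈ tensGrading 𝒩 𝒬 γ := by
  rw [tensGrading] at hx
  induction hx using AddSubgroup.closure_induction with
  | mem x hx =>
    obtain ⟨i, j, rfl, m, hm, q, hq, rfl⟩ := hx
    exact AddSubgroup.subset_closure ⟨i, j, rfl, f m, hf i m hm, q, hq, rfl⟩
  | zero => rw [map_zero]; exact zero_mem _
  | add x y _ _ hx hy => rw [map_add]; exact add_mem hx hy
  | neg x _ hx => rw [map_neg]; exact neg_mem hx

variable [DecidableEq Γ]

/-- `M ⊗_A Q` is the direct sum of its homogeneous components. -/
theorem tensGrading_isInternal {M Q : Type*} [AddCommGroup M] [Module Aᵐᵒᵖ M] [AddCommGroup Q]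
    [Module A Q] [Module Bᵐᵒᵖ Q] [SMulCommClass A Bᵐᵒᵖ Q] {𝒜 : Γ → AddSubgroup A}
    {ℳ : Γ → AddSubgroup M} {𝒬 : Γ → AddSubgroup Q} (h𝒜 : DirectSum.IsInternal 𝒜)
    (hℳ : DirectSum.IsInternal ℳ) (h𝒬 : DirectSum.IsInternal 𝒬)
    (hM : ∀ {α γ : Γ} {a : A} {m : M}, a ∈ 𝒜 α → m ∈ ℳ γ → op a • m ∈ ℳ (γ + α))
    (hQ : ∀ {α γ : Γ} {a : A} {q : Q}, a ∈ 𝒜 α → q ∈ 𝒬 γ → a • q ∈ 𝒬 (α + γ)) :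
    DirectSum.IsInternal (tensGrading (A := A) (B := B) ℳ 𝒬) := by
  let tm : M →+ Q →+ Tens A B M Q := AddMonoidHom.mk'
    (fun m => AddMonoidHom.mk' (fun q => Tens.tmul A B m q) (Tens.tmul_add A B M Q m))
    (fun m m' => AddMonoidHom.ext fun q => Tens.add_tmul A B M Q m m' q)
  let _ := hℳ.chooseDecomposition
  let _ := h𝒬.chooseDecomposition
  let X := Γ →₀ Tens A B M Q
  let f₂ : ∀ i : Γ, Q →+ ℳ i →+ X := fun i =>
    (DirectSum.toAddMonoid fun j => (AddMonoidHom.flip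
      (((AddMonoidHom.compHom (Finsupp.singleAddHom (i + j))).comp
        ((AddMonoidHom.compHom.flip (𝒬 j).subtype).comp (tm.comp (ℳ i).subtype)))))).comp
      (DirectSum.decomposeAddEquiv 𝒬).toAddMonoidHom
  let f : M →+ Q →+ X := (DirectSum.toAddMonoid fun i => (f₂ i).flip).comp
    (DirectSum.decomposeAddEquiv ℳ).toAddMonoidHom
  have hf : ∀ i j m q, m ∈ ℳ i → q ∈ 𝒬 j →
      f m q = Finsupp.single (i + j) (Tens.tmul A B m q) := by
    intro i j m q hm hq
    simp [f, f₂, DirectSum.decompose_of_mem _ hm, DirectSum.decompose_of_mem _ hq, tm]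
  obtain ⟨D, hD⟩ := Tens.exists_lift B f (by
    intro m a q
    refine isInternal_induction h𝒜 (p := fun a => f (op a • m) q = f m (a • q)) (by simp) ?_
      (fun x y hx hy => by simp [add_smul, hx, hy]) a
    intro k a ha
    refine isInternal_induction hℳ (p := fun m => f (op a • m) q = f m (a • q)) (by simp) ?_
      (fun x y hx hy => by simp [smul_add, hx, hy]) m
    intro i m hm
    refine isInternal_induction h𝒬 (p := fun q => f (op a • m) q = f m (a • q)) (by simp) ?_
      (fun x y hx hy => by simp [smul_add, hx, hy]) q
    intro j q hq
    rw [hf _ _ _ _ (hM ha hm) hq, hf _ _ _ _ hm (hQ ha hq), add_assoc, Tens.smul_tmul])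
  refine isInternal_of_separated D ?_ ?_
  · intro γ x hx
    rw [tensGrading] at hx
    induction hx using AddSubgroup.closure_induction with
    | mem x hx =>
      obtain ⟨i, j, rfl, m, hm, q, hq, rfl⟩ := hx
      rw [hD, hf _ _ _ _ hm hq]
    | zero => simp
    | add x y _ _ hx hy => rw [map_add, hx, hy, Finsupp.single_add]
    | neg x _ hx => rw [map_neg, hx, Finsupp.single_neg]
  · refine fun x => Tens.induction (zero_mem _) (fun m q => ?_) (fun x y => add_mem) x
    refine isInternal_induction hℳ (p := fun m => Tens.tmul A B m q ∈ _) ?_ ?_ ?_ m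
    · rw [show Tens.tmul A B (0 : M) q = 0 from map_zero (tm.flip q)]; exact zero_mem _
    · intro i m hm
      refine isInternal_induction h𝒬 (p := fun q => Tens.tmul A B m q ∈ _) ?_ ?_ ?_ q
      · rw [show Tens.tmul A B m (0 : Q) = 0 from map_zero (tm m)]; exact zero_mem _
      · exact fun j q hq => AddSubgroup.mem_iSup_of_mem (i + j)
          (AddSubgroup.subset_closure ⟨i, j, rfl, m, hm, q, hq, rfl⟩)
      · exact fun x y hx hy => (Tens.tmul_add A B M Q m x y) ▸ add_mem hx hy
    · exact fun x y hx hy => (Tens.add_tmul A B M Q x y q) ▸ add_mem hx hy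

/-- A `Γ`-graded `A`-`B`-bimodule. -/
structure GrBimod (𝒜 : Γ → AddSubgroup A) (ℬ : Γ → AddSubgroup B) where
  carrier : Type u
  [addCommGroup : AddCommGroup carrier]
  [leftModule : Module A carrier]
  [rightModule : Module Bᵐᵒᵖ carrier]
  [smulCommClass : SMulCommClass A Bᵐᵒᵖ carrier]
  /-- the homogeneous components -/
  deg : Γ → AddSubgroup carrier
  isInternal : DirectSum.IsInternal deg
  left_smul_mem : ∀ {α γ : Γ} {a : A} {q : carrier}, a ∈ 𝒜 α → q ∈ deg γ → a • q ∈ deg (α + γ)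
  right_smul_mem : ∀ {β γ : Γ} {b : B} {q : carrier}, b ∈ ℬ β → q ∈ deg γ →
    op b • q ∈ deg (γ + β)

attribute [instance] GrBimod.addCommGroup GrBimod.leftModule GrBimod.rightModule
  GrBimod.smulCommClass

variable {𝒜 : Γ → AddSubgroup A} {ℬ : Γ → AddSubgroup B}

instance : CoeSort (GrBimod 𝒜 ℬ) (Type u) := ⟨GrBimod.carrier⟩

/-- The functor `- ⊗_A Q : Mod-A ⥤ Mod-B`. -/
noncomputable def GrBimod.tensor (Q : GrBimod 𝒜 ℬ) :
    ModuleCat.{u} Aᵐᵒᵖ ⥤ ModuleCat.{u} Bᵐᵒᵖ where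
  obj M := ModuleCat.of Bᵐᵒᵖ (Tens A B M Q)
  map f := ModuleCat.ofHom (Tens.map B Q f.hom)
  map_id _ := ModuleCat.hom_ext <| LinearMap.ext <| Tens.map_id B Q
  map_comp f g := ModuleCat.hom_ext <| LinearMap.ext <| Tens.map_comp B Q f.hom g.hom

/-- The graded right `B`-module `M ⊗_A Q`. -/
noncomputable def GrBimod.tensorObj [GradedRing 𝒜] (Q : GrBimod 𝒜 ℬ) (M : GrMod 𝒜) : GrMod ℬ where
  carrier := Tens A B M Q
  deg := tensGrading M.deg Q.deg
  isInternal := tensGrading_isInternal (DirectSum.Decomposition.isInternal 𝒜) M.isInternal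
    Q.isInternal M.smul_mem Q.left_smul_mem
  smul_mem := fun hb hx => tensGrading_smul_mem Q.right_smul_mem hb hx

/-- The functor `- ⊗_A Q : Gr-A ⥤ Gr-B`. -/
noncomputable def GrBimod.grTensor [GradedRing 𝒜] (Q : GrBimod 𝒜 ℬ) : GrMod 𝒜 ⥤ GrMod ℬ where
  obj M := Q.tensorObj M
  map {M N} f := GrMod.ofLin (M := Q.tensorObj M) (N := Q.tensorObj N)
    (Tens.map B Q (GrMod.toLin f)) fun _ _ hx =>
      tensGrading_map_mem (GrMod.toLin f) (fun _ _ hm => GrMod.toLin_mem f hm) hx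
  map_id _ := GrMod.hom_ext <| LinearMap.ext <| Tens.map_id B Q
  map_comp f g := GrMod.hom_ext <| LinearMap.ext <|
    Tens.map_comp B Q (GrMod.toLin f) (GrMod.toLin g)

end GradedTensor

end GradedMorita

/-! All the conditions are linked through one object: a graded Morita context (`MoritaContext`),
that is, graded bimodules `Q` over `A`-`B` and `Q'` over `B`-`A` with associative graded pairings to
`A` and `B` whose values generate both rings. Each condition produces a context, and a context gives
back the conditions.

From a context, write 1 as `∑ (x_i, y_i)` in `A`. This makes evaluation `(M ⊗ Q) ⊗ Q' → M`
invertible (`eval_bijective`), both with and without gradings, so `- ⊗ Q` is a graded equivalence of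
`Gr` and of `Mod` at once, and the forgetful square commutes on the nose. Writing 1 as `∑ (y_i,
x_i)` in `B` with homogeneous `y_i`, `x_i` gives a dual basis of `Q'`; hence `Q'` is a graded
progenerator with endomorphism ring `B`, and `b ↦ ((x_i, b y_j))` identifies `B` with the corner of
a matrix ring at the full idempotent `((x_i, y_j))` (`exists_matrix`). Conversely, a full idempotent
matrix `e` yields the context of rows fixed by `e` and columns fixed by `e` (`CornerIso.context`).

The remaining contexts come from `exists_context`: a bimodule `Q` with `A = End_B(Q)`, a dual basis
and trace `B` is paired with `Hom_B(Q, B)`. For a progenerator this applies directly, with the two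
rings exchanged. For a graded functor `φ`, take `Q = φ(A)`. Since `φ` commutes strictly with shifts,
it acts on maps of every degree, and an element `m` of `M`, seen as the map `a ↦ m a`, becomes a
`B`-linear map `φ(A) → φ(M)` (`eltMap`). If `φ` is an equivalence, then `eltMap` is bijective:
compare degree by degree, where `φ(A)` finitely generated makes `Hom_B(φ(A), φ(M))` graded. If `φ`
is only associated to an equivalence `φ'` of module categories, then `eltMap` is the action of `φ'`
on morphisms, and is bijective because `φ'` is fully faithful.

For the bimodule description of `φ`, the comparison map `M ⊗ φ(A) → φ(M)` turns into `eltMap` after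
applying `Hom_B(φ(A), -)` and identifying `M` with `Hom_B(φ(A), M ⊗ φ(A))`. It is thus bijective
after `Hom_B(φ(A), -)`, and since `φ(A)` has full trace it is bijective itself
(`HasFullTrace.bijective`). No compatibility of the natural isomorphisms with shifts enters
anywhere. -/

namespace GradedMorita

/-! ### Projections onto homogeneous components -/

section Projections

variable {Γ : Type*} [DecidableEq Γ] {T : Type*} [AddCommGroup T] {G : Γ → AddSubgroup T}

/-- The decomposition of `T` as a direct sum, as an additive equivalence. -/
noncomputable def internalEquiv (h : DirectSum.IsInternal G) :
    DirectSum Γ (fun γ => G γ) ≃+ T :=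
  AddEquiv.ofBijective (DirectSum.coeAddMonoidHom G) h

theorem internalEquiv_of (h : DirectSum.IsInternal G) {γ : Γ} (x : G γ) :
    internalEquiv h (DirectSum.of (fun γ => G γ) γ x) = x :=
  DirectSum.coeAddMonoidHom_of G γ x

theorem internalEquiv_symm_of_mem (h : DirectSum.IsInternal G) {γ : Γ} {x : T} (hx : x ∈ G γ) :
    (internalEquiv h).symm x = DirectSum.of (fun γ => G γ) γ ⟨x, hx⟩ := by
  rw [AddEquiv.symm_apply_eq, internalEquiv_of]

/-- The projection onto a homogeneous component. -/
noncomputable def proj (h : DirectSum.IsInternal G) (γ : Γ) : T →+ T :=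
  (G γ).subtype.comp ((DFinsupp.evalAddMonoidHom γ).comp (internalEquiv h).symm.toAddMonoidHom)

/-- Additive maps on the components assemble to an additive map. -/
noncomputable def internalLift (h : DirectSum.IsInternal G) {X : Type*} [AddCommGroup X]
    (f : ∀ γ, G γ →+ X) : T →+ X :=
  (DirectSum.toAddMonoid f).comp (internalEquiv h).symm.toAddMonoidHom

theorem internalLift_of_mem (h : DirectSum.IsInternal G) {X : Type*} [AddCommGroup X]
    (f : ∀ γ, G γ →+ X) {γ : Γ} {x : T} (hx : x ∈ G γ) : internalLift h f x = f γ ⟨x, hx⟩ := by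
  simp [internalLift, internalEquiv_symm_of_mem h hx]

theorem proj_apply (h : DirectSum.IsInternal G) (γ : Γ) (x : T) :
    proj h γ x = (internalEquiv h).symm x γ := rfl

theorem proj_mem (h : DirectSum.IsInternal G) (γ : Γ) (x : T) : proj h γ x ∈ G γ :=
  ((internalEquiv h).symm x γ).2

theorem proj_same (h : DirectSum.IsInternal G) {γ : Γ} {x : T} (hx : x ∈ G γ) :
    proj h γ x = x := by
  rw [proj_apply, internalEquiv_symm_of_mem h hx, DirectSum.of_eq_same]

theorem proj_ne (h : DirectSum.IsInternal G) {γ δ : Γ} {x : T} (hx : x ∈ G δ) (hne : δ ≠ γ) :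
    proj h γ x = 0 := by
  rw [proj_apply, internalEquiv_symm_of_mem h hx, DirectSum.of_eq_of_ne _ _ _ hne.symm]; rfl

theorem exists_proj_support (h : DirectSum.IsInternal G) (x : T) :
    ∃ s : Finset Γ, (∀ γ, γ ∉ s → proj h γ x = 0) := by
  classical
  refine ⟨((internalEquiv h).symm x).support, fun γ hγ => ?_⟩
  rw [proj_apply, DFinsupp.notMem_support_iff.1 hγ]; rfl

theorem sum_proj (h : DirectSum.IsInternal G) {x : T} {s : Finset Γ}
    (hs : ∀ γ, γ ∉ s → proj h γ x = 0) : ∑ γ ∈ s, proj h γ x = x := by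
  classical
  have : ∀ x : T, ∑ γ ∈ ((internalEquiv h).symm x).support, proj h γ x = x := by
    intro x
    conv_rhs => rw [← (internalEquiv h).apply_symm_apply x,
      ← DirectSum.sum_support_of ((internalEquiv h).symm x)]
    rw [map_sum]
    exact Finset.sum_congr rfl fun γ _ => (internalEquiv_of h _).symm
  conv_rhs => rw [← this x]
  refine (Finset.sum_subset (fun γ hγ => ?_) fun γ _ hγ => ?_).symm
  · by_contra hn
    exact (DFinsupp.mem_support_iff.1 hγ) (Subtype.ext (hs γ hn))
  · rw [proj_apply, DFinsupp.notMem_support_iff.1 hγ]; rfl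

theorem eq_zero_of_proj (h : DirectSum.IsInternal G) {x : T} (hx : ∀ γ, proj h γ x = 0) :
    x = 0 := by
  rw [← sum_proj h (s := ∅) fun γ _ => hx γ, Finset.sum_empty]

/-- Cancellation in `Γ` is what makes this work: distinct source degrees stay distinct after adding
`δ`, so no foreign component of `x` can reach degree `γ + δ`. -/
theorem map_proj [AddGroup Γ] (h : DirectSum.IsInternal G) {X : Type*} [AddCommGroup X]
    {H : Γ → AddSubgroup X} (hH : DirectSum.IsInternal H) (δ : Γ) (f : T →+ X)
    (hf : ∀ γ, ∀ x ∈ G γ, f x ∈ H (γ + δ)) (γ : Γ) (x : T) :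
    f (proj h γ x) = proj hH (γ + δ) (f x) := by
  refine isInternal_induction h (p := fun x => f (proj h γ x) = proj hH (γ + δ) (f x))
    (by simp) ?_ (fun x y hx hy => by simp [hx, hy]) x
  intro β x hx
  by_cases hβ : β = γ
  · subst hβ
    rw [proj_same h hx, proj_same hH (hf _ _ hx)]
  · rw [proj_ne h hx hβ, proj_ne hH (hf _ _ hx) (fun h => hβ (add_right_cancel h)), map_zero]

/-- An additive map that is bijective on homogeneous components is bijective. -/
theorem bijective_of_components (h : DirectSum.IsInternal G) {X : Type*} [AddCommGroup X]
    {H : Γ → AddSubgroup X} (hH : DirectSum.IsInternal H) (f : T →+ X)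
    (hf : ∀ γ, ∀ x ∈ G γ, f x ∈ H γ) (hinj : ∀ γ, ∀ x ∈ G γ, f x = 0 → x = 0)
    (hsurj : ∀ γ, ∀ y ∈ H γ, ∃ x, f x = y) : Function.Bijective f := by
  constructor
  · rw [injective_iff_map_eq_zero]
    intro x hx
    refine eq_zero_of_proj h fun γ => hinj γ _ (proj_mem h γ x) ?_
    have hp : f (proj h γ x) = proj hH γ (f x) := by
      refine isInternal_induction h (p := fun x => f (proj h γ x) = proj hH γ (f x))
        (by simp) ?_ (fun x y hx hy => by simp [hx, hy]) x
      intro β x hx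
      by_cases hβ : β = γ
      · subst hβ
        rw [proj_same h hx, proj_same hH (hf _ _ hx)]
      · rw [proj_ne h hx hβ, proj_ne hH (hf _ _ hx) hβ, map_zero]
    rw [hp, hx, map_zero]
  · intro y
    refine isInternal_induction hH (p := fun y => ∃ x, f x = y) ⟨0, map_zero f⟩ hsurj ?_ y
    rintro _ _ ⟨x, rfl⟩ ⟨x', rfl⟩
    exact ⟨x + x', map_add f x x'⟩

/-- A family of subgroups with projections is a direct sum decomposition. -/
theorem isInternal_of_proj (π : Γ → T →+ T) (mem : ∀ γ x, π γ x ∈ G γ)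
    (same : ∀ γ, ∀ x ∈ G γ, π γ x = x) (ne : ∀ γ δ, γ ≠ δ → ∀ x ∈ G γ, π δ x = 0)
    (fin : ∀ x, ∃ s : Finset Γ, ∑ γ ∈ s, π γ x = x) : DirectSum.IsInternal G := by
  have key : ∀ (y : DirectSum Γ fun i => G i) (γ : Γ),
      π γ (DirectSum.coeAddMonoidHom G y) = (y γ : T) := by
    intro y γ
    induction y using DirectSum.induction_on with
    | zero => simp
    | of i y =>
      rw [DirectSum.coeAddMonoidHom_of, DirectSum.coe_of_apply]
      split_ifs with hi
      · subst hi; exact same _ _ y.2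
      · exact ne _ _ hi _ y.2
    | add y z hy hz => simp [hy, hz]
  constructor
  · intro y z hyz
    refine DFinsupp.ext fun γ => Subtype.ext ?_
    rw [← key y γ, ← key z γ, hyz]
  · intro x
    obtain ⟨s, hs⟩ := fin x
    refine ⟨∑ γ ∈ s, DirectSum.of (fun i => G i) γ ⟨π γ x, mem γ x⟩, ?_⟩
    rw [map_sum]
    conv_rhs => rw [← hs]
    exact Finset.sum_congr rfl fun γ _ => DirectSum.coeAddMonoidHom_of G γ _

/-- Direct sum decompositions pass to retracts. -/
theorem isInternal_of_retract (h : DirectSum.IsInternal G) {X : Type*} [AddCommGroup X]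
    {H : Γ → AddSubgroup X} (s : X →+ T) (r : T →+ X) (hrs : ∀ x, r (s x) = x)
    (hs : ∀ γ, ∀ x ∈ H γ, s x ∈ G γ) (hr : ∀ γ, ∀ x ∈ G γ, r x ∈ H γ) :
    DirectSum.IsInternal H := by
  refine isInternal_of_proj (fun γ => r.comp ((proj h γ).comp s))
    (fun γ x => hr γ _ (proj_mem h γ _)) (fun γ x hx => ?_) (fun γ δ hne x hx => ?_) fun x => ?_
  · simp [proj_same h (hs γ x hx), hrs]
  · simp [proj_ne h (hs γ x hx) hne]
  · obtain ⟨t, ht⟩ := exists_proj_support h (s x)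
    exact ⟨t, by simp [← map_sum, sum_proj h ht, hrs]⟩

/-- The product of finitely many graded groups with shifted gradings. -/
theorem isInternal_pi [AddCommGroup Γ] (h : DirectSum.IsInternal G) {n : ℕ} (d : Fin n → Γ) :
    DirectSum.IsInternal fun γ => (AddSubgroup.pi Set.univ fun i => G (γ - d i) :
      AddSubgroup (Fin n → T)) := by
  classical
  refine isInternal_of_proj
    (fun γ => AddMonoidHom.pi fun i => (proj h (γ - d i)).comp (Pi.evalAddMonoidHom _ i))
    (fun γ x i _ => proj_mem h _ _) (fun γ x hx => funext fun i => proj_same h (hx i trivial))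
    (fun γ δ hne x hx => funext fun i => proj_ne h (hx i trivial) fun h => hne ?_) fun x => ?_
  · simpa using h
  · choose s hs using fun i => exists_proj_support h (x i)
    -- Coordinate `i` carries the shift `d i`, so the degrees that occur in it are the support of `x
    -- i` translated by `d i`.
    refine ⟨Finset.univ.biUnion fun i => (s i).image (· + d i), funext fun i => ?_⟩
    rw [Finset.sum_apply]
    change ∑ c ∈ _, proj h (c - d i) (x i) = x i
    rw [← Finset.sum_image (g := fun γ => γ - d i) (f := fun γ => proj h γ (x i))
      fun a _ b _ hab => by simpa using hab]
    refine sum_proj h fun γ hγ => hs i γ fun hγ' => hγ ?_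
    exact Finset.mem_image.2 ⟨γ + d i, Finset.mem_biUnion.2
      ⟨i, Finset.mem_univ _, Finset.mem_image_of_mem _ hγ'⟩, by simp⟩

end Projections

/-! ### Homogeneous parts of sums of products -/

section Closure

variable {T : Type*} [AddCommGroup T]

/-- Closure of `S` under negation removes all signs. The element 0 of `S` serves as a term for the
empty sum, so the length is positive even in the zero ring; this is the source of `n ≥ 1` for the
matrices. -/
theorem exists_sum_of_mem_closure {S : Set T} (h0 : (0 : T) ∈ S) (hneg : ∀ x ∈ S, -x ∈ S) {z : T}
    (hz : z ∈ AddSubgroup.closure S) :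
    ∃ n : ℕ, 0 < n ∧ ∃ x : Fin n → T, (∀ i, x i ∈ S) ∧ ∑ i, x i = z := by
  induction hz using AddSubgroup.closure_induction with
  | mem z hz => exact ⟨1, one_pos, fun _ => z, fun _ => hz, by simp⟩
  | zero => exact ⟨1, one_pos, fun _ => 0, fun _ => h0, by simp⟩
  | add y z _ _ hy hz =>
    obtain ⟨m, hm, x, hx, rfl⟩ := hy
    obtain ⟨n, -, x', hx', rfl⟩ := hz
    refine ⟨m + n, by omega, Fin.append x x', fun i => ?_, by simp [Fin.sum_univ_add]⟩
    refine Fin.addCases (fun i => ?_) (fun i => ?_) i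
    · simpa using hx i
    · simpa using hx' i
  | neg z _ hz =>
    obtain ⟨m, hm, x, hx, rfl⟩ := hz
    exact ⟨m, hm, fun i => -x i, fun i => hneg _ (hx i), by simp⟩

variable {Γ : Type*} [AddCommGroup Γ] [DecidableEq Γ] {X Y : Type*} [AddCommGroup X]
  [AddCommGroup Y] {G : Γ → AddSubgroup X} {H : Γ → AddSubgroup Y} {K : Γ → AddSubgroup T}

/-- A homogeneous component of a sum of values of a graded biadditive map is a sum of values at
homogeneous arguments. -/
theorem proj_mem_closure (hG : DirectSum.IsInternal G) (hH : DirectSum.IsInternal H)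
    (hK : DirectSum.IsInternal K) (p : X →+ Y →+ T)
    (hp : ∀ i j, ∀ x ∈ G i, ∀ y ∈ H j, p x y ∈ K (i + j)) (γ : Γ) {z : T}
    (hz : z ∈ AddSubgroup.closure {z | ∃ x y, z = p x y}) :
    proj hK γ z ∈ AddSubgroup.closure
      {z | ∃ i j, i + j = γ ∧ ∃ x ∈ G i, ∃ y ∈ H j, z = p x y} := by
  induction hz using AddSubgroup.closure_induction with
  | zero => simp
  | add y z _ _ hy hz => rw [map_add]; exact add_mem hy hz
  | neg z _ hz => rw [map_neg]; exact neg_mem hz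
  | mem z hz =>
    obtain ⟨x, y, rfl⟩ := hz
    refine isInternal_induction hG (p := fun x => proj hK γ (p x y) ∈ _) (by simp) ?_
      (fun x x' hx hx' => by simpa using add_mem hx hx') x
    intro i x hx
    refine isInternal_induction hH (p := fun y => proj hK γ (p x y) ∈ _) (by simp) ?_
      (fun x x' hx hx' => by simpa using add_mem hx hx') y
    intro j y hy
    by_cases hij : i + j = γ
    · rw [proj_same hK (hij ▸ hp i j x hx y hy)]
      exact AddSubgroup.subset_closure ⟨i, j, hij, x, hx, y, hy, rfl⟩
    · rw [proj_ne hK (hp i j x hx y hy) hij]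
      exact zero_mem _

/-- Applied to `z = 1` in degree 0, this replaces an arbitrary expression of 1 through a pairing by
one whose terms are homogeneous of opposite degrees. -/
theorem exists_sum_of_proj (hG : DirectSum.IsInternal G) (hH : DirectSum.IsInternal H)
    (hK : DirectSum.IsInternal K) (p : X →+ Y →+ T)
    (hp : ∀ i j, ∀ x ∈ G i, ∀ y ∈ H j, p x y ∈ K (i + j)) {γ : Γ} {z : T} (hzγ : z ∈ K γ)
    (hz : z ∈ AddSubgroup.closure {z | ∃ x y, z = p x y}) :
    ∃ n : ℕ, 0 < n ∧ ∃ (d : Fin n → Γ) (x : Fin n → X) (y : Fin n → Y),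
      (∀ i, x i ∈ G (d i)) ∧ (∀ i, y i ∈ H (γ - d i)) ∧ ∑ i, p (x i) (y i) = z := by
  have := proj_mem_closure hG hH hK p hp γ hz
  rw [proj_same hK hzγ] at this
  obtain ⟨n, hn, t, ht, hsum⟩ := exists_sum_of_mem_closure
    (S := {z | ∃ i j, i + j = γ ∧ ∃ x ∈ G i, ∃ y ∈ H j, z = p x y})
    ⟨0, γ, zero_add γ, 0, zero_mem _, 0, zero_mem _, by simp⟩
    (by
      rintro _ ⟨i, j, hij, x, hx, y, hy, rfl⟩
      exact ⟨i, j, hij, -x, neg_mem hx, y, hy, by simp⟩) this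
  choose i j hij x hx y hy hxy using ht
  refine ⟨n, hn, i, x, y, hx, fun k => ?_, ?_⟩
  · rw [← hij k, add_sub_cancel_left]; exact hy k
  · rw [← hsum]; exact Finset.sum_congr rfl fun k _ => (hxy k).symm

end Closure

/-! ### Basic constructions in `Gr-A` -/

section GradedModules

variable {Γ : Type w} [AddCommGroup Γ] [DecidableEq Γ] {A : Type u} [Ring A]
  {𝒜 : Γ → AddSubgroup A}

/-- The additive map underlying `m ↦ m a`. -/
def rightMul {M : Type*} [AddCommGroup M] [Module Aᵐᵒᵖ M] (a : A) : M →+ M :=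
  DistribSMul.toAddMonoidHom M (op a)

theorem GrMod.proj_smul (M : GrMod 𝒜) {α : Γ} {a : A} (ha : a ∈ 𝒜 α) (γ : Γ) (m : M) :
    proj M.isInternal (γ + α) (op a • m) = op a • proj M.isInternal γ m :=
  (map_proj M.isInternal M.isInternal α (rightMul a) (fun _ _ hx => M.smul_mem ha hx) γ m).symm

theorem GrMod.isInternal_homogeneous (M : GrMod 𝒜) {p : M → Prop} (zero : p 0)
    (hom : ∀ γ, ∀ x ∈ M.deg γ, p x) (add : ∀ x y, p x → p y → p (x + y)) (x : M) : p x :=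
  isInternal_induction M.isInternal zero hom add x

/-- A linear map of degree `γ` as a morphism to the shift. -/
def GrMod.ofDeg {M N : GrMod 𝒜} {γ : Γ} (f : M →ₗ[Aᵐᵒᵖ] N) (hf : f ∈ homDeg M N γ) :
    M ⟶ N.shift γ :=
  GrMod.ofLin (N := N.shift γ) f hf

/-- A bijective morphism of `Gr-A` is an isomorphism. -/
theorem GrMod.isIso_of_bijective {M N : GrMod 𝒜} (f : M ⟶ N)
    (hf : Function.Bijective (toLin f)) : IsIso f := by
  let e := LinearEquiv.ofBijective (toLin f) hf
  have he : ∀ γ, ∀ n ∈ N.deg γ, e.symm.toLinearMap n ∈ M.deg γ := by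
    intro γ n hn
    obtain ⟨m, rfl⟩ := e.surjective n
    -- Replacing `m` by its component of degree `γ` does not change its image, so by injectivity `m`
    -- was homogeneous already.
    have h1 : toLin f (proj M.isInternal γ m) = toLin f m := by
      have := map_proj M.isInternal N.isInternal 0 (toLin f).toAddMonoidHom
        (fun γ x hx => by rw [add_zero]; exact toLin_mem f hx) γ m
      simp only [LinearMap.toAddMonoidHom_coe, add_zero] at this
      rw [this]
      exact proj_same _ hn
    have h2 : proj M.isInternal γ m = m := hf.1 h1
    simp only [LinearEquiv.coe_coe, LinearEquiv.symm_apply_apply]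
    rw [← h2]
    exact proj_mem _ _ _
  refine ⟨GrMod.ofLin e.symm.toLinearMap he, ?_, ?_⟩
  · exact GrMod.hom_ext (LinearMap.ext fun x => e.symm_apply_apply x)
  · exact GrMod.hom_ext (LinearMap.ext fun x => e.apply_symm_apply x)

/-- The quotient of a graded module by a graded submodule. -/
def GrMod.quotient (M : GrMod 𝒜) (S : Submodule Aᵐᵒᵖ M)
    (hS : ∀ γ, ∀ x ∈ S, proj M.isInternal γ x ∈ S) : GrMod 𝒜 where
  carrier := M ⧸ S
  deg γ := (M.deg γ).map S.mkQ.toAddMonoidHom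
  isInternal := by
    refine isInternal_of_proj
      (fun γ => QuotientAddGroup.map S.toAddSubgroup S.toAddSubgroup (proj M.isInternal γ) (hS γ))
      (fun γ x => ?_) (fun γ x hx => ?_) (fun γ δ hne x hx => ?_) fun x => ?_
    · obtain ⟨x, rfl⟩ := S.mkQ_surjective x
      exact ⟨_, proj_mem M.isInternal γ x, rfl⟩
    · obtain ⟨x, hx, rfl⟩ := hx
      exact congrArg S.mkQ (proj_same M.isInternal hx)
    · obtain ⟨x, hx, rfl⟩ := hx
      exact (congrArg S.mkQ (proj_ne M.isInternal hx hne)).trans (map_zero _)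
    · obtain ⟨x, rfl⟩ := S.mkQ_surjective x
      obtain ⟨s, hs⟩ := exists_proj_support M.isInternal x
      refine ⟨s, ?_⟩
      conv_rhs => rw [← sum_proj M.isInternal hs, map_sum]
      rfl
  smul_mem := by
    rintro α γ a _ ha ⟨m, hm, rfl⟩
    exact ⟨op a • m, M.smul_mem ha hm, rfl⟩

/-- The sum of the images of a jointly epimorphic family is everything. -/
theorem GrMod.iSup_range_eq_top {M : GrMod 𝒜} {ι : Sort*} {Y : ι → GrMod 𝒜} (f : ∀ i, Y i ⟶ M)
    (hf : ∀ (N : GrMod 𝒜) (h : M ⟶ N), (∀ i, f i ≫ h = 0) → h = 0) :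
    ⨆ i, LinearMap.range (toLin (f i)) = ⊤ := by
  set S := ⨆ i, LinearMap.range (toLin (f i)) with hSdef
  -- A sum of images of graded maps is a graded submodule, so the quotient by it is an object of
  -- `Gr-A` on which the hypothesis can be tested.
  have hS : ∀ γ, ∀ x ∈ S, proj M.isInternal γ x ∈ S := by
    intro γ x hx
    refine Submodule.iSup_induction (fun i => LinearMap.range (toLin (f i)))
      (motive := fun x => proj M.isInternal γ x ∈ S) hx ?_ (by simp)
      (fun x y hx hy => by rw [map_add]; exact add_mem hx hy)
    rintro i _ ⟨y, rfl⟩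
    have := map_proj (Y i).isInternal M.isInternal 0 (toLin (f i)).toAddMonoidHom
      (fun γ x hx => by rw [add_zero]; exact toLin_mem (f i) hx) γ y
    simp only [LinearMap.toAddMonoidHom_coe, add_zero] at this
    rw [← this]
    exact Submodule.mem_iSup_of_mem i ⟨_, rfl⟩
  let q : M ⟶ M.quotient S hS := GrMod.ofLin (N := M.quotient S hS) S.mkQ
    fun γ m hm => ⟨m, hm, rfl⟩
  have hq : q = 0 := hf _ q fun i => GrMod.hom_ext <| LinearMap.ext fun y =>
    (Submodule.Quotient.mk_eq_zero S).2 (Submodule.mem_iSup_of_mem i ⟨y, rfl⟩)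
  rw [eq_top_iff]
  intro x _
  rw [← Submodule.Quotient.mk_eq_zero S]
  exact LinearMap.congr_fun (congrArg toLin hq) x

theorem GrMod.surjective_of_epi {M N : GrMod 𝒜} (f : M ⟶ N) [Epi f] :
    Function.Surjective (toLin f) := by
  have := GrMod.iSup_range_eq_top (ι := Unit) (fun _ => f) fun P h hh => by
    rw [← cancel_epi f, hh (), Limits.comp_zero]
  rw [← LinearMap.range_eq_top, ← this, iSup_const]

theorem GrMod.epi_of_surjective {M N : GrMod 𝒜} (f : M ⟶ N)
    (hf : Function.Surjective (toLin f)) : Epi f where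
  left_cancellation g h hgh := GrMod.hom_ext <| LinearMap.ext fun n => by
    obtain ⟨m, rfl⟩ := hf n
    exact LinearMap.congr_fun (congrArg toLin hgh) m

/-! ### The regular module -/

section Regular

variable [GradedRing 𝒜]

variable (𝒜) in
theorem ring_isInternal : DirectSum.IsInternal 𝒜 := DirectSum.Decomposition.isInternal 𝒜

variable (𝒜) in
/-- The graded right module `A_A`. -/
def regular : GrMod 𝒜 where
  carrier := A
  deg := 𝒜
  isInternal := ring_isInternal 𝒜
  smul_mem := fun ha hm => SetLike.mul_mem_graded hm ha

/-- The linear map `A → M`, `a ↦ m a`. -/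
def eltLin {M : Type*} [AddCommGroup M] [Module Aᵐᵒᵖ M] (m : M) : A →ₗ[Aᵐᵒᵖ] M where
  toFun a := op a • m
  map_add' a b := by rw [MulOpposite.op_add, add_smul]
  map_smul' a b := by
    obtain ⟨a, rfl⟩ := op_surjective a
    simp [mul_smul]

@[simp] theorem eltLin_apply {M : Type*} [AddCommGroup M] [Module Aᵐᵒᵖ M] (m : M) (a : A) :
    eltLin m a = op a • m := rfl

theorem eltLin_mem {M : GrMod 𝒜} {γ : Γ} {m : M} (hm : m ∈ M.deg γ) :
    eltLin m ∈ homDeg (regular 𝒜) M γ := by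
  intro α a ha
  rw [add_comm]
  exact M.smul_mem ha hm

theorem eltLin_eq {M : Type*} [AddCommGroup M] [Module Aᵐᵒᵖ M] (f : A →ₗ[Aᵐᵒᵖ] M) :
    eltLin (f 1) = f := LinearMap.ext fun a => by
  rw [eltLin_apply, ← map_smul]; simp

theorem one_mem_deg : (1 : A) ∈ 𝒜 0 := SetLike.one_mem_graded 𝒜

end Regular

/-! ### Gradings on Hom groups -/

section Hom

theorem linearMap_ext_homogeneous {M : GrMod 𝒜} {N : Type*} [AddCommGroup N] [Module Aᵐᵒᵖ N]
    {f g : M →ₗ[Aᵐᵒᵖ] N} (h : ∀ γ, ∀ m ∈ M.deg γ, f m = g m) : f = g :=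
  LinearMap.ext fun m => M.isInternal_homogeneous (p := fun m => f m = g m) (by simp) h
    (fun x y hx hy => by rw [map_add, map_add, hx, hy]) m

/-- A finitely generated graded module has finitely many homogeneous generators. -/
theorem GrMod.exists_homogeneous_generators (M : GrMod 𝒜) [Module.Finite Aᵐᵒᵖ M] :
    ∃ (n : ℕ) (d : Fin n → Γ) (x : Fin n → M), (∀ i, x i ∈ M.deg (d i)) ∧
      Submodule.span Aᵐᵒᵖ (Set.range x) = ⊤ := by
  classical
  obtain ⟨S, hS⟩ := Module.Finite.fg_top (R := Aᵐᵒᵖ) (M := M)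
  choose s hs using exists_proj_support M.isInternal
  let t : Finset (Σ _ : M, Γ) := S.sigma s
  let e := t.equivFin
  refine ⟨t.card, fun i => (e.symm i).1.2,
    fun i => proj M.isInternal (e.symm i).1.2 (e.symm i).1.1, fun i => proj_mem _ _ _, ?_⟩
  rw [eq_top_iff, ← hS, Submodule.span_le]
  intro m hm
  rw [SetLike.mem_coe, ← sum_proj M.isInternal (hs m)]
  refine sum_mem fun γ hγ => Submodule.subset_span ⟨e ⟨⟨m, γ⟩, Finset.mem_sigma.2 ⟨hm, hγ⟩⟩, ?_⟩
  simp

/-- The additive map `m ↦ ∑ γ, f(m_γ)_{γ+δ}`. -/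
noncomputable def homProjAux {M N : GrMod 𝒜} (δ : Γ) (f : M →ₗ[Aᵐᵒᵖ] N) : M →+ N :=
  internalLift M.isInternal fun γ => (proj N.isInternal (γ + δ)).comp
    (f.toAddMonoidHom.comp (M.deg γ).subtype)

theorem homProjAux_apply {M N : GrMod 𝒜} (δ : Γ) (f : M →ₗ[Aᵐᵒᵖ] N) {γ : Γ} {m : M}
    (hm : m ∈ M.deg γ) : homProjAux δ f m = proj N.isInternal (γ + δ) (f m) :=
  internalLift_of_mem M.isInternal _ hm

variable [GradedRing 𝒜]

/-- The homogeneous component of degree `δ` of a linear map between graded modules. -/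
noncomputable def homProj (M N : GrMod 𝒜) (δ : Γ) : (M →ₗ[Aᵐᵒᵖ] N) →+ (M →ₗ[Aᵐᵒᵖ] N) :=
  AddMonoidHom.mk' (fun f =>
    { homProjAux δ f with
      map_smul' := by
        intro a m
        obtain ⟨a, rfl⟩ := op_surjective a
        simp only [ZeroHom.toFun_eq_coe, AddMonoidHom.toZeroHom_coe, RingHom.id_apply]
        refine isInternal_induction (ring_isInternal 𝒜) (p := fun a =>
          homProjAux δ f (op a • m) = op a • homProjAux δ f m)
          (by simp) ?_ (fun x y hx hy => by simp [add_smul, hx, hy]) a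
        intro α a ha
        refine M.isInternal_homogeneous (p := fun m =>
          homProjAux δ f (op a • m) = op a • homProjAux δ f m)
          (by simp) ?_ (fun x y hx hy => by simp [smul_add, hx, hy]) m
        intro γ m hm
        rw [homProjAux_apply δ f hm, homProjAux_apply δ f (M.smul_mem ha hm), map_smul,
          add_right_comm, N.proj_smul ha] })
    fun f g => linearMap_ext_homogeneous fun γ m hm => by
      change homProjAux δ (f + g) m = homProjAux δ f m + homProjAux δ g m
      rw [homProjAux_apply δ f hm, homProjAux_apply δ g hm, homProjAux_apply δ (f + g) hm,
        LinearMap.add_apply, map_add]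

theorem homProj_apply {M N : GrMod 𝒜} (δ : Γ) (f : M →ₗ[Aᵐᵒᵖ] N) {γ : Γ} {m : M}
    (hm : m ∈ M.deg γ) : homProj M N δ f m = proj N.isInternal (γ + δ) (f m) :=
  homProjAux_apply δ f hm

/-- If `M` is finitely generated then `Hom_A(M, N)` is the direct sum of its homogeneous
components. -/
theorem homDeg_isInternal (M N : GrMod 𝒜) [Module.Finite Aᵐᵒᵖ M] :
    DirectSum.IsInternal (homDeg M N) := by
  refine isInternal_of_proj (homProj M N) (fun δ f γ m hm => ?_)
    (fun δ f hf => linearMap_ext_homogeneous fun γ m hm => ?_)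
    (fun δ δ' hne f hf => linearMap_ext_homogeneous fun γ m hm => ?_) fun f => ?_
  · rw [homProj_apply δ f hm]
    exact proj_mem _ _ _
  · rw [homProj_apply δ f hm, proj_same N.isInternal (hf γ m hm)]
  · rw [homProj_apply δ' f hm, proj_ne N.isInternal (hf γ m hm) fun h => hne (add_left_cancel h)]
    rfl
  · obtain ⟨n, d, x, hx, hspan⟩ := M.exists_homogeneous_generators
    choose s hs using fun i => exists_proj_support N.isInternal (f (x i))
    -- The component of degree `δ` sends `x i` to the part of `f (x i)` in degree `d i + δ`. Only
    -- finitely many `δ` contribute, because there are finitely many generators.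
    refine ⟨Finset.univ.biUnion fun i => (s i).image (· - d i),
      LinearMap.ext_on_range hspan fun i => ?_⟩
    simp only [LinearMap.sum_apply, homProj_apply _ f (hx i)]
    rw [← Finset.sum_image (g := fun γ => d i + γ) (f := fun γ => proj N.isInternal γ (f (x i)))
      fun a _ b _ hab => by simpa using hab]
    refine sum_proj _ fun γ hγ => hs i γ fun hγ' => hγ ?_
    exact Finset.mem_image.2 ⟨γ - d i, Finset.mem_biUnion.2
      ⟨i, Finset.mem_univ _, Finset.mem_image_of_mem _ hγ'⟩, by simp⟩

end Hom

end GradedModules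

/-! ### Shifts and tensor products -/

section Shifts

variable {Γ : Type w} [AddCommGroup Γ] [DecidableEq Γ] {A : Type u} [Ring A]
  {𝒜 : Γ → AddSubgroup A}

/-- Graded functors commute with shifts strictly, so objects with the same carrier and only
propositionally equal degree families have to be identified. With the family `G` a variable, the
equation can be substituted away. -/
theorem GrMod.mk_eq (M : GrMod 𝒜) {G : Γ → AddSubgroup M} (hG : G = M.deg)
    (h : DirectSum.IsInternal G)
    (h' : ∀ {α γ : Γ} {a : A} {m : M}, a ∈ 𝒜 α → m ∈ G γ → op a • m ∈ G (γ + α)) :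
    (⟨M, G, h, h'⟩ : GrMod 𝒜) = M := by
  subst hG; rfl

/-- The transports produced by equalities of objects are invisible on underlying modules, so they
never affect computations with elements. -/
theorem GrMod.toLin_eqToHom (M : GrMod 𝒜) {G : Γ → AddSubgroup M} (hG : G = M.deg)
    (h : DirectSum.IsInternal G)
    (h' : ∀ {α γ : Γ} {a : A} {m : M}, a ∈ 𝒜 α → m ∈ G γ → op a • m ∈ G (γ + α))
    (e : (⟨M, G, h, h'⟩ : GrMod 𝒜) = M) :
    toLin (eqToHom e) = (LinearMap.id : M →ₗ[Aᵐᵒᵖ] M) := by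
  subst hG; rfl

theorem GrMod.hom_eq (M N : GrMod 𝒜) {G : Γ → AddSubgroup M} (hG : G = M.deg)
    {H : Γ → AddSubgroup N} (hH : H = N.deg) {hM : DirectSum.IsInternal G}
    {hM' : ∀ {α γ : Γ} {a : A} {m : M}, a ∈ 𝒜 α → m ∈ G γ → op a • m ∈ G (γ + α)}
    {hN : DirectSum.IsInternal H}
    {hN' : ∀ {α γ : Γ} {a : A} {m : N}, a ∈ 𝒜 α → m ∈ H γ → op a • m ∈ H (γ + α)}
    (eM : (⟨M, G, hM, hM'⟩ : GrMod 𝒜) = M) (eN : (⟨N, H, hN, hN'⟩ : GrMod 𝒜) = N)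
    (f : (⟨M, G, hM, hM'⟩ : GrMod 𝒜) ⟶ ⟨N, H, hN, hN'⟩) (g : M ⟶ N)
    (h : (f.1 : M →ₗ[Aᵐᵒᵖ] N) = toLin g) :
    f = eqToHom eM ≫ g ≫ eqToHom eN.symm := by
  subst hG hH
  exact GrMod.hom_ext h

theorem GrMod.shift_zero (M : GrMod 𝒜) : M.shift 0 = M :=
  M.mk_eq (funext fun γ => congrArg M.deg (add_zero γ)) (M.shift 0).isInternal (M.shift 0).smul_mem

theorem GrMod.toLin_eqToHom_shift_zero (M : GrMod 𝒜) (e : M.shift 0 = M) :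
    toLin (eqToHom e) = (LinearMap.id : M →ₗ[Aᵐᵒᵖ] M) :=
  M.toLin_eqToHom (funext fun γ => congrArg M.deg (add_zero γ)) (M.shift 0).isInternal
    (M.shift 0).smul_mem e

theorem GrMod.shift_shift (M : GrMod 𝒜) (α β : Γ) : (M.shift α).shift β = M.shift (α + β) :=
  (M.shift (α + β)).mk_eq
    (funext fun γ => by change M.deg _ = M.deg _; rw [add_assoc, add_comm β α])
    ((M.shift α).shift β).isInternal ((M.shift α).shift β).smul_mem

theorem GrMod.toLin_eqToHom_shift_shift (M : GrMod 𝒜) (α β : Γ)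
    (e : (M.shift α).shift β = M.shift (α + β)) :
    toLin (eqToHom e) = (LinearMap.id : M →ₗ[Aᵐᵒᵖ] M) :=
  (M.shift (α + β)).toLin_eqToHom
    (funext fun γ => by change M.deg _ = M.deg _; rw [add_assoc, add_comm β α])
    ((M.shift α).shift β).isInternal ((M.shift α).shift β).smul_mem e

end Shifts

section Tensor

variable {A B : Type*} [Ring A] [Ring B] {M : Type*} [AddCommGroup M] [Module Aᵐᵒᵖ M]
  {Q : Type*} [AddCommGroup Q] [Module A Q] [Module Bᵐᵒᵖ Q]

theorem Tens.linearMap_ext {T : Type*} [AddCommGroup T] [Module Bᵐᵒᵖ T]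
    {f g : Tens A B M Q →ₗ[Bᵐᵒᵖ] T}
    (h : ∀ m q, f (Tens.tmul A B m q) = g (Tens.tmul A B m q)) : f = g :=
  LinearMap.ext fun x => Tens.induction (p := fun x => f x = g x) (by simp) h
    (fun x y hx hy => by rw [map_add, map_add, hx, hy]) x

variable (A B M Q) in
/-- The linear map `q ↦ m ⊗ q`, additive in `m`. -/
noncomputable def Tens.mk : M →+ Q →ₗ[Bᵐᵒᵖ] Tens A B M Q :=
  AddMonoidHom.mk' (fun m =>
    { toFun := fun q => Tens.tmul A B m q
      map_add' := Tens.tmul_add A B M Q m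
      map_smul' := fun _ _ => rfl })
    fun m m' => LinearMap.ext fun q => Tens.add_tmul A B M Q m m' q

@[simp] theorem Tens.mk_apply (m : M) (q : Q) : Tens.mk A B M Q m q = Tens.tmul A B m q := rfl

variable (A B) in
@[simp] theorem Tens.zero_tmul (q : Q) : Tens.tmul A B (0 : M) q = 0 :=
  LinearMap.congr_fun (map_zero (Tens.mk A B M Q)) q

variable (A B) in
theorem Tens.sum_tmul {n : ℕ} (m : Fin n → M) (q : Q) :
    Tens.tmul A B (∑ i, m i) q = ∑ i, Tens.tmul A B (m i) q := by
  simp only [← Tens.mk_apply, map_sum, LinearMap.sum_apply]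

variable (A B) in
theorem Tens.tmul_sum {n : ℕ} (m : M) (q : Fin n → Q) :
    Tens.tmul A B m (∑ i, q i) = ∑ i, Tens.tmul A B m (q i) :=
  map_sum (Tens.mk A B M Q m) q _

variable [SMulCommClass A Bᵐᵒᵖ Q]

/-- The additive map out of `M ⊗_A Q` induced by a balanced biadditive map. -/
noncomputable def Tens.lift {T : Type*} [AddCommGroup T] (f : M →+ Q →+ T)
    (hf : ∀ (m : M) (a : A) (q : Q), f (op a • m) q = f m (a • q)) : Tens A B M Q →+ T :=
  (Tens.exists_lift B f hf).choose

@[simp] theorem Tens.lift_tmul {T : Type*} [AddCommGroup T] (f : M →+ Q →+ T)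
    (hf : ∀ (m : M) (a : A) (q : Q), f (op a • m) q = f m (a • q)) (m : M) (q : Q) :
    Tens.lift (B := B) f hf (Tens.tmul A B m q) = f m q :=
  (Tens.exists_lift B f hf).choose_spec m q

/-- The biadditive map underlying a map that is linear in the second variable. -/
def toBiadd {T : Type*} [AddCommGroup T] [Module Bᵐᵒᵖ T] (f : M →+ Q →ₗ[Bᵐᵒᵖ] T) : M →+ Q →+ T :=
  AddMonoidHom.mk' (fun m => (f m).toAddMonoidHom) fun m m' => by rw [map_add]; rfl

/-- The linear map out of `M ⊗_A Q` induced by a balanced map that is linear in `Q`. -/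
noncomputable def Tens.liftLin {T : Type*} [AddCommGroup T] [Module Bᵐᵒᵖ T]
    (f : M →+ Q →ₗ[Bᵐᵒᵖ] T)
    (hf : ∀ (m : M) (a : A) (q : Q), toBiadd f (op a • m) q = toBiadd f m (a • q)) :
    Tens A B M Q →ₗ[Bᵐᵒᵖ] T :=
  { Tens.lift (B := B) (toBiadd f) hf with
    map_smul' := fun b x => by
      obtain ⟨b, rfl⟩ := op_surjective b
      simp only [ZeroHom.toFun_eq_coe, AddMonoidHom.toZeroHom_coe, RingHom.id_apply]
      refine Tens.induction (p := fun x => Tens.lift (B := B) _ hf (op b • x)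
        = op b • Tens.lift (B := B) _ hf x) (by simp) (fun m q => ?_) (fun x y hx hy => ?_) x
      · rw [Tens.op_smul_tmul, Tens.lift_tmul, Tens.lift_tmul]
        exact map_smul (f m) (op b) q
      · rw [smul_add, map_add, hx, hy, map_add, smul_add] }

@[simp] theorem Tens.liftLin_tmul {T : Type*} [AddCommGroup T] [Module Bᵐᵒᵖ T]
    (f : M →+ Q →ₗ[Bᵐᵒᵖ] T)
    (hf : ∀ (m : M) (a : A) (q : Q), toBiadd f (op a • m) q = toBiadd f m (a • q)) (m : M)
    (q : Q) : Tens.liftLin f hf (Tens.tmul A B m q) = f m q :=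
  Tens.lift_tmul (B := B) (toBiadd f) hf m q

end Tensor

section GradedTensor

variable {Γ : Type w} [AddCommGroup Γ] {A B : Type u} [Ring A] [Ring B]
  {𝒜 : Γ → AddSubgroup A} {ℬ : Γ → AddSubgroup B}

theorem tensGrading_shift {M Q : Type*} [AddCommGroup M] [Module Aᵐᵒᵖ M] [AddCommGroup Q]
    [Module A Q] [Module Bᵐᵒᵖ Q] (ℳ : Γ → AddSubgroup M) (𝒬 : Γ → AddSubgroup Q) (α : Γ) :
    tensGrading (A := A) (B := B) (fun γ => ℳ (γ + α)) 𝒬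
      = fun γ => tensGrading (A := A) (B := B) ℳ 𝒬 (γ + α) := by
  funext γ
  unfold tensGrading
  congr 1
  ext x
  constructor
  · rintro ⟨i, j, rfl, m, hm, q, hq, rfl⟩
    exact ⟨i + α, j, by abel, m, hm, q, hq, rfl⟩
  · rintro ⟨i, j, hij, m, hm, q, hq, rfl⟩
    exact ⟨i - α, j, by rw [sub_add_eq_add_sub, hij, add_sub_cancel_right], m,
      by simpa using hm, q, hq, rfl⟩

variable [DecidableEq Γ]

theorem GrBimod.tensor_additive (Q : GrBimod 𝒜 ℬ) : Q.tensor.Additive where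
  map_add {M N f g} := ModuleCat.hom_ext (Tens.linearMap_ext fun m q => by
    change Tens.tmul A B (f.hom m + g.hom m) q = _
    rw [Tens.add_tmul]
    rfl)

variable [GradedRing 𝒜]

theorem GrBimod.tensorObj_shift (Q : GrBimod 𝒜 ℬ) (M : GrMod 𝒜) (α : Γ) :
    Q.tensorObj (M.shift α) = (Q.tensorObj M).shift α :=
  ((Q.tensorObj M).shift α).mk_eq (tensGrading_shift M.deg Q.deg α)
    (Q.tensorObj (M.shift α)).isInternal (Q.tensorObj (M.shift α)).smul_mem

theorem GrBimod.isGradedFunctor (Q : GrBimod 𝒜 ℬ) : IsGradedFunctor Q.grTensor := by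
  refine ⟨⟨fun {M N f g} => GrMod.hom_ext (Tens.linearMap_ext fun m q => ?_)⟩, fun α => ?_⟩
  · change Tens.tmul A B ((GrMod.toLin f + GrMod.toLin g) m) q = _
    rw [LinearMap.add_apply, Tens.add_tmul]
    rfl
  · exact CategoryTheory.Functor.ext (fun M => Q.tensorObj_shift M α) fun M N f =>
      GrMod.hom_eq ((Q.tensorObj M).shift α) ((Q.tensorObj N).shift α)
        (tensGrading_shift M.deg Q.deg α) (tensGrading_shift N.deg Q.deg α)
        (hM' := (Q.tensorObj (M.shift α)).smul_mem) (hN' := (Q.tensorObj (N.shift α)).smul_mem)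
        (Q.tensorObj_shift M α) (Q.tensorObj_shift N α) _ _ rfl

/-- The graded and ungraded tensor products share carriers and maps definitionally, so the square of
functors commutes by `rfl`. -/
theorem GrBimod.isAssociated (Q : GrBimod 𝒜 ℬ) : IsAssociated Q.grTensor Q.tensor :=
  ⟨Q.isGradedFunctor, rfl⟩

end GradedTensor

/-! ### Graded Morita contexts -/

section Context

variable {Γ : Type w} [AddCommGroup Γ] [DecidableEq Γ] {A B : Type u} [Ring A] [Ring B]

/-- A surjective graded Morita context between the graded rings `(A, 𝒜)` and `(B, ℬ)`. -/
structure MoritaContext (𝒜 : Γ → AddSubgroup A) (ℬ : Γ → AddSubgroup B) where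
  Q : GrBimod 𝒜 ℬ
  Q' : GrBimod ℬ 𝒜
  pair : Q →+ Q' →+ A
  pair' : Q' →+ Q →+ B
  pair_mem : ∀ i j, ∀ q ∈ Q.deg i, ∀ q' ∈ Q'.deg j, pair q q' ∈ 𝒜 (i + j)
  pair'_mem : ∀ i j, ∀ q' ∈ Q'.deg i, ∀ q ∈ Q.deg j, pair' q' q ∈ ℬ (i + j)
  smul_pair : ∀ (a : A) (q : Q) (q' : Q'), pair (a • q) q' = a * pair q q'
  pair_smul : ∀ (a : A) (q : Q) (q' : Q'), pair q (op a • q') = pair q q' * a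
  pair_balanced : ∀ (b : B) (q : Q) (q' : Q'), pair (op b • q) q' = pair q (b • q')
  smul_pair' : ∀ (b : B) (q' : Q') (q : Q), pair' (b • q') q = b * pair' q' q
  pair'_smul : ∀ (b : B) (q' : Q') (q : Q), pair' q' (op b • q) = pair' q' q * b
  pair'_balanced : ∀ (a : A) (q' : Q') (q : Q), pair' (op a • q') q = pair' q' (a • q)
  assoc : ∀ (q : Q) (q' : Q') (q₁ : Q), pair q q' • q₁ = op (pair' q' q₁) • q
  assoc' : ∀ (q' : Q') (q : Q) (q₁ : Q'), pair' q' q • q₁ = op (pair q q₁) • q'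
  one_mem : (1 : A) ∈ AddSubgroup.closure {z | ∃ q q', z = pair q q'}
  one_mem' : (1 : B) ∈ AddSubgroup.closure {z | ∃ q' q, z = pair' q' q}

namespace MoritaContext

variable {𝒜 : Γ → AddSubgroup A} {ℬ : Γ → AddSubgroup B}

/-- The Morita context with the roles of the two rings exchanged. -/
def symm (C : MoritaContext 𝒜 ℬ) : MoritaContext ℬ 𝒜 where
  Q := C.Q'
  Q' := C.Q
  pair := C.pair'
  pair' := C.pair
  pair_mem := C.pair'_mem
  pair'_mem := C.pair_mem
  smul_pair := C.smul_pair'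
  pair_smul := C.pair'_smul
  pair_balanced := C.pair'_balanced
  smul_pair' := C.smul_pair
  pair'_smul := C.pair_smul
  pair'_balanced := C.pair_balanced
  assoc := C.assoc'
  assoc' := C.assoc
  one_mem := C.one_mem'
  one_mem' := C.one_mem

theorem exists_sum (C : MoritaContext 𝒜 ℬ) [GradedRing 𝒜] :
    ∃ n : ℕ, 0 < n ∧ ∃ (d : Fin n → Γ) (x : Fin n → C.Q) (y : Fin n → C.Q'),
      (∀ i, x i ∈ C.Q.deg (d i)) ∧ (∀ i, y i ∈ C.Q'.deg (0 - d i)) ∧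
        ∑ i, C.pair (x i) (y i) = 1 :=
  exists_sum_of_proj C.Q.isInternal C.Q'.isInternal (ring_isInternal 𝒜) C.pair C.pair_mem
    one_mem_deg C.one_mem

section Contract

variable (C : MoritaContext 𝒜 ℬ) (M : Type*) [AddCommGroup M] [Module Aᵐᵒᵖ M]

/-- The contraction `m ⊗ q ↦ (q' ↦ m (q, q'))`. -/
noncomputable def contract : Tens A B M C.Q →+ C.Q' →ₗ[Aᵐᵒᵖ] M :=
  Tens.lift (AddMonoidHom.mk' (fun m => AddMonoidHom.mk' (fun q =>
    { toFun := fun q' => op (C.pair q q') • m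
      map_add' := fun x y => by rw [map_add, MulOpposite.op_add, add_smul]
      map_smul' := fun a q' => by
        obtain ⟨a, rfl⟩ := op_surjective a
        rw [C.pair_smul, op_mul, mul_smul]; rfl })
    (fun x y => LinearMap.ext fun q' => by
      change op (C.pair (x + y) q') • m = op (C.pair x q') • m + op (C.pair y q') • m
      rw [map_add, AddMonoidHom.add_apply, MulOpposite.op_add, add_smul]))
    (fun x y => AddMonoidHom.ext fun q => LinearMap.ext fun q' => smul_add _ x y))
    (fun m a q => LinearMap.ext fun q' => by
      change op (C.pair q q') • op a • m = op (C.pair (a • q) q') • m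
      rw [C.smul_pair, op_mul, mul_smul])

@[simp] theorem contract_tmul (m : M) (q : C.Q) (q' : C.Q') :
    C.contract M (Tens.tmul A B m q) q' = op (C.pair q q') • m := by
  rw [contract, Tens.lift_tmul]; rfl

theorem contract_smul (b : B) (t : Tens A B M C.Q) (q' : C.Q') :
    C.contract M (op b • t) q' = C.contract M t (b • q') := by
  refine Tens.induction (p := fun t => C.contract M (op b • t) q' = C.contract M t (b • q'))
    (by simp) (fun m q => ?_) (fun x y hx hy => ?_) t
  · rw [Tens.op_smul_tmul, contract_tmul, contract_tmul, C.pair_balanced]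
  · rw [smul_add, map_add, map_add, LinearMap.add_apply, LinearMap.add_apply, hx, hy]

/-- On a pure tensor this is the associativity `(q₁, q') q = q₁ (q', q)` moved across the tensor
sign. It drives the inverse of evaluation and `mk_bijective`. -/
theorem tmul_contract (t : Tens A B M C.Q) (q' : C.Q') (q : C.Q) :
    Tens.tmul A B (C.contract M t q') q = op (C.pair' q' q) • t := by
  refine Tens.induction (p := fun t => Tens.tmul A B (C.contract M t q') q
    = op (C.pair' q' q) • t) ?_ (fun m q₁ => ?_) (fun x y hx hy => ?_) t
  · rw [map_zero, smul_zero]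
    exact LinearMap.congr_fun (map_zero (Tens.mk A B M C.Q)) q
  · rw [contract_tmul, Tens.smul_tmul, C.assoc, Tens.op_smul_tmul]
  · rw [map_add, LinearMap.add_apply, Tens.add_tmul, hx, hy, smul_add]

/-- Evaluation `(M ⊗ Q) ⊗ Q' → M`. -/
noncomputable def eval : Tens B A (Tens A B M C.Q) C.Q' →ₗ[Aᵐᵒᵖ] M :=
  Tens.liftLin (C.contract M) fun t b q' => C.contract_smul M b t q'

@[simp] theorem eval_tmul (t : Tens A B M C.Q) (q' : C.Q') :
    C.eval M (Tens.tmul B A t q') = C.contract M t q' :=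
  Tens.liftLin_tmul _ _ t q'

theorem exists_sum_pair :
    ∃ (n : ℕ) (x : Fin n → C.Q) (y : Fin n → C.Q'), ∑ i, C.pair (x i) (y i) = 1 := by
  obtain ⟨n, -, t, ht, hsum⟩ := exists_sum_of_mem_closure (S := {z | ∃ q q', z = C.pair q q'})
    ⟨0, 0, by simp⟩ (by rintro _ ⟨q, q', rfl⟩; exact ⟨-q, q', by simp⟩) C.one_mem
  choose x y h using ht
  exact ⟨n, x, y, by rw [← hsum]; exact Finset.sum_congr rfl fun i _ => (h i).symm⟩

/-- The inverse is `m ↦ ∑ (m ⊗ x_i) ⊗ y_i`. On `t ⊗ q'` the round trip gives `∑ t (q', x_i) ⊗ y_i =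
∑ t ⊗ q' (x_i, y_i) = t ⊗ q'`. -/
theorem eval_bijective : Function.Bijective (C.eval M) := by
  obtain ⟨n, x, y, hxy⟩ := C.exists_sum_pair
  have hinv : ∀ z, ∑ i, Tens.tmul B A (Tens.tmul A B (C.eval M z) (x i)) (y i) = z := by
    intro z
    refine Tens.induction (p := fun z => ∑ i, Tens.tmul B A (Tens.tmul A B (C.eval M z) (x i)) (y i)
      = z) (by simp) (fun t q' => ?_) (fun z z' h h' => ?_) z
    · simp only [eval_tmul, tmul_contract, Tens.smul_tmul, C.assoc']
      rw [← Tens.tmul_sum, ← Finset.sum_smul, ← Finset.op_sum, hxy, op_one, one_smul]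
    · conv_rhs => rw [← h, ← h']
      simp only [map_add, Tens.add_tmul, Finset.sum_add_distrib]
  refine ⟨fun z z' h => by rw [← hinv z, h, hinv z'], fun m => ?_⟩
  refine ⟨∑ i, Tens.tmul B A (Tens.tmul A B m (x i)) (y i), ?_⟩
  simp only [map_sum, eval_tmul, contract_tmul]
  rw [← Finset.sum_smul, ← Finset.op_sum, hxy, op_one, one_smul]

theorem eval_natural {N : Type*} [AddCommGroup N] [Module Aᵐᵒᵖ N] (f : M →ₗ[Aᵐᵒᵖ] N)
    (z : Tens B A (Tens A B M C.Q) C.Q') :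
    C.eval N (Tens.map A C.Q' (Tens.map B C.Q f) z) = f (C.eval M z) := by
  refine Tens.induction (p := fun z => C.eval N (Tens.map A C.Q' (Tens.map B C.Q f) z)
    = f (C.eval M z)) (by simp) (fun t q' => ?_) (fun z z' h h' => ?_) z
  · refine Tens.induction (p := fun t => C.eval N (Tens.map A C.Q' (Tens.map B C.Q f)
      (Tens.tmul B A t q')) = f (C.eval M (Tens.tmul B A t q'))) (by simp) (fun m q => ?_)
      (fun x y hx hy => ?_) t
    · rw [Tens.map_tmul, Tens.map_tmul, eval_tmul, eval_tmul, contract_tmul, contract_tmul,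
        map_smul]
    · rw [Tens.add_tmul, map_add, map_add, hx, hy, map_add, map_add]
  · rw [map_add, map_add, map_add, h, h', map_add]

end Contract

/-- The isomorphism `(M ⊗ Q) ⊗ Q' ≅ M` in `Mod-A`. -/
noncomputable def tensorIso (C : MoritaContext 𝒜 ℬ) :
    C.Q.tensor ⋙ C.Q'.tensor ≅ 𝟭 (ModuleCat.{u} Aᵐᵒᵖ) :=
  NatIso.ofComponents
    (fun M => (LinearEquiv.ofBijective (C.eval M) (C.eval_bijective M)).toModuleIso)
    fun f => ModuleCat.hom_ext (LinearMap.ext fun z => C.eval_natural _ f.hom z)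

theorem isEquivalence_tensor (C : MoritaContext 𝒜 ℬ) : C.Q.tensor.IsEquivalence :=
  (CategoryTheory.Equivalence.mk C.Q.tensor C.Q'.tensor C.tensorIso.symm
    C.symm.tensorIso).isEquivalence_functor

/-- Every `B`-linear map `Q → M ⊗ Q` is of the form `q ↦ m ⊗ q`, for a unique `m`. -/
theorem mk_bijective (C : MoritaContext 𝒜 ℬ) (M : Type*) [AddCommGroup M] [Module Aᵐᵒᵖ M] :
    Function.Bijective (Tens.mk A B M C.Q) := by
  obtain ⟨n, x, y, hxy⟩ := C.exists_sum_pair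
  constructor
  · rw [injective_iff_map_eq_zero]
    intro m hm
    have : ∑ i, C.contract M (Tens.mk A B M C.Q m (x i)) (y i) = m := by
      simp only [Tens.mk_apply, contract_tmul]
      rw [← Finset.sum_smul, ← Finset.op_sum, hxy, op_one, one_smul]
    rw [← this, hm]
    simp
  · intro g
    -- With this `m`, `m ⊗ q = ∑ g(x_i) (y_i, q) = g(∑ (x_i, y_i) q) = g(q)`.
    refine ⟨∑ i, C.contract M (g (x i)) (y i), LinearMap.ext fun q => ?_⟩
    rw [Tens.mk_apply, Tens.sum_tmul]
    simp only [tmul_contract, ← map_smul, ← C.assoc]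
    rw [← map_sum, ← Finset.sum_smul, hxy, one_smul]

theorem eval_mem (C : MoritaContext 𝒜 ℬ) (M : GrMod 𝒜) {γ : Γ}
    {z : Tens B A (Tens A B M C.Q) C.Q'}
    (hz : z ∈ tensGrading (A := B) (B := A) (tensGrading (A := A) (B := B) M.deg C.Q.deg)
      C.Q'.deg γ) : C.eval M z ∈ M.deg γ := by
  refine AddSubgroup.closure_induction (p := fun z _ => C.eval M z ∈ M.deg γ) ?_
    (by simp) (fun x y _ _ hx hy => by rw [map_add]; exact add_mem hx hy)
    (fun x _ hx => by rw [map_neg]; exact neg_mem hx) hz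
  rintro _ ⟨i, j, rfl, t, ht, q', hq', rfl⟩
  rw [eval_tmul]
  refine AddSubgroup.closure_induction (p := fun t _ => C.contract M t q' ∈ M.deg (i + j)) ?_
    (by simp) (fun x y _ _ hx hy => by rw [map_add]; exact add_mem hx hy)
    (fun x _ hx => by rw [map_neg]; exact neg_mem hx) ht
  rintro _ ⟨k, l, rfl, m, hm, q, hq, rfl⟩
  rw [contract_tmul, add_assoc]
  exact M.smul_mem (C.pair_mem l j q hq q' hq') hm

variable [GradedRing 𝒜]

theorem isGradedModEquivalence (C : MoritaContext 𝒜 ℬ) :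
    IsGradedModEquivalence 𝒜 ℬ C.Q.tensor :=
  ⟨C.Q.tensor_additive, C.isEquivalence_tensor, _, C.Q.isAssociated⟩

variable [GradedRing ℬ]

/-- Evaluation `(M ⊗ Q) ⊗ Q' ⟶ M` in `Gr-A`. -/
noncomputable def grEval (C : MoritaContext 𝒜 ℬ) (M : GrMod 𝒜) :
    (C.Q.grTensor ⋙ C.Q'.grTensor).obj M ⟶ M :=
  GrMod.ofLin (M := C.Q'.tensorObj (C.Q.tensorObj M)) (C.eval M) fun _ _ hz => C.eval_mem M hz

/-- The isomorphism `(M ⊗ Q) ⊗ Q' ≅ M` in `Gr-A`. -/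
noncomputable def grTensorIso (C : MoritaContext 𝒜 ℬ) :
    C.Q.grTensor ⋙ C.Q'.grTensor ≅ 𝟭 (GrMod 𝒜) :=
  have (M : GrMod 𝒜) : IsIso (C.grEval M) :=
    GrMod.isIso_of_bijective (C.grEval M) (C.eval_bijective M)
  NatIso.ofComponents (fun M => @asIso _ _ _ _ (C.grEval M) (this M))
    fun f => GrMod.hom_ext (LinearMap.ext fun z => C.eval_natural _ (GrMod.toLin f) z)

theorem isGradedEquivalence (C : MoritaContext 𝒜 ℬ) : IsGradedEquivalence C.Q.grTensor :=
  ⟨C.Q.isGradedFunctor, C.Q'.grTensor, C.Q'.isGradedFunctor, ⟨C.grTensorIso⟩,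
    ⟨C.symm.grTensorIso⟩⟩

end MoritaContext

end Context

/-! ### From a Morita context to a graded progenerator -/

section Progenerators

variable {Γ : Type w} [AddCommGroup Γ] [DecidableEq Γ] {A B : Type u} [Ring A] [Ring B]
  {𝒜 : Γ → AddSubgroup A} {ℬ : Γ → AddSubgroup B}

/-- The graded right module underlying a graded bimodule. -/
def GrBimod.toGrMod (Q : GrBimod 𝒜 ℬ) : GrMod ℬ where
  carrier := Q
  deg := Q.deg
  isInternal := Q.isInternal
  smul_mem := Q.right_smul_mem

theorem GrMod.exists_homogeneous_lift {M N : GrMod 𝒜} (e : M ⟶ N) [Epi e] {γ : Γ} {x : N}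
    (hx : x ∈ N.deg γ) : ∃ m ∈ M.deg γ, toLin e m = x := by
  obtain ⟨m, rfl⟩ := GrMod.surjective_of_epi e x
  refine ⟨proj M.isInternal γ m, proj_mem _ _ _, ?_⟩
  have := map_proj M.isInternal N.isInternal 0 (toLin e).toAddMonoidHom
    (fun γ x hx => by rw [add_zero]; exact toLin_mem e hx) γ m
  simp only [LinearMap.toAddMonoidHom_coe, add_zero] at this
  rw [this, proj_same _ hx]

/-- A graded module with a homogeneous dual basis is projective. -/
theorem GrMod.projective_of_dualBasis [GradedRing 𝒜] (P : GrMod 𝒜) {n : ℕ} (d : Fin n → Γ)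
    (y : Fin n → P) (hy : ∀ i, y i ∈ P.deg (d i)) (f : Fin n → P →ₗ[Aᵐᵒᵖ] A)
    (hf : ∀ i, f i ∈ homDeg P (regular 𝒜) (0 - d i))
    (hsum : ∀ x, ∑ i, op (f i x) • y i = x) : Projective P where
  factors {M N} (g : P ⟶ N) (e : M ⟶ N) _ := by
    choose m hm hme using fun i => GrMod.exists_homogeneous_lift e (GrMod.toLin_mem g (hy i))
    refine ⟨GrMod.ofLin (∑ i, (eltLin (m i)).comp (f i)) fun γ x hx => ?_,
      GrMod.hom_ext (LinearMap.ext fun x => ?_)⟩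
    · rw [LinearMap.sum_apply]
      refine sum_mem fun i _ => ?_
      have := M.smul_mem (hf i γ x hx) (hm i)
      rwa [show d i + (γ + (0 - d i)) = γ by abel] at this
    · rw [GrMod.toLin_comp, GrMod.toLin_ofLin]
      simp only [LinearMap.comp_apply, LinearMap.sum_apply, map_sum, eltLin_apply, map_smul, hme]
      conv_rhs => rw [← hsum x]
      simp only [map_sum, map_smul]

namespace MoritaContext

/-- The linear map `q' ↦ (q, q')`. -/
def pairLin (C : MoritaContext 𝒜 ℬ) (q : C.Q) : C.Q' →ₗ[Aᵐᵒᵖ] A where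
  toFun := C.pair q
  map_add' := map_add _
  map_smul' a q' := by
    obtain ⟨a, rfl⟩ := op_surjective a
    exact C.pair_smul a q q'

/-- Associativity turns `y_i (x_i, q')` into `(y_i, x_i) q'`. So the `y_i` and the functionals
`(x_i, -)` are a dual basis of `Q'` over `A`. -/
theorem sum_smul_eq (C : MoritaContext 𝒜 ℬ) {n : ℕ} {y : Fin n → C.Q'} {x : Fin n → C.Q}
    (h : ∑ i, C.pair' (y i) (x i) = 1) (q' : C.Q') :
    ∑ i, op (C.pair (x i) q') • y i = q' := by
  simp only [← C.assoc']
  rw [← Finset.sum_smul, h, one_smul]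

variable [GradedRing ℬ]

theorem exists_sum' (C : MoritaContext 𝒜 ℬ) :
    ∃ n : ℕ, 0 < n ∧ ∃ (d : Fin n → Γ) (y : Fin n → C.Q') (x : Fin n → C.Q),
      (∀ i, y i ∈ C.Q'.deg (d i)) ∧ (∀ i, x i ∈ C.Q.deg (0 - d i)) ∧
        ∑ i, C.pair' (y i) (x i) = 1 :=
  C.symm.exists_sum

/-- `B` acts on `Q'` by all its `A`-linear endomorphisms. -/
theorem gradedIso_end (C : MoritaContext 𝒜 ℬ) : GradedIso ℬ (endGrading C.Q'.toGrMod) := by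
  obtain ⟨n, -, d, y, x, hy, hx, hsum⟩ := C.exists_sum'
  have hdual := C.sum_smul_eq hsum
  let T : B →+* Module.End Aᵐᵒᵖ C.Q' := Module.toModuleEnd Aᵐᵒᵖ C.Q'
  -- An endomorphism is determined by its values on the dual basis: `(∑ (f y_i, x_i)) q' = ∑ f(y_i)
  -- (x_i, q') = f(q')`.
  let S : Module.End Aᵐᵒᵖ C.Q' → B := fun f => ∑ i, C.pair' (f (y i)) (x i)
  have hST : ∀ b, S (T b) = b := by
    intro b
    change ∑ i, C.pair' (b • y i) (x i) = b
    simp only [C.smul_pair']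
    rw [← Finset.mul_sum, hsum, mul_one]
  have hTS : ∀ f, T (S f) = f := by
    intro f
    refine LinearMap.ext fun q' => ?_
    change (∑ i, C.pair' (f (y i)) (x i)) • q' = f q'
    conv_rhs => rw [← hdual q', map_sum]
    rw [Finset.sum_smul]
    exact Finset.sum_congr rfl fun i _ => (C.assoc' _ _ _).trans (map_smul f _ _).symm
  refine ⟨RingEquiv.ofBijective T ⟨Function.LeftInverse.injective hST,
    Function.RightInverse.surjective hTS⟩, fun γ b => ⟨fun hb β q' hq' => ?_, fun hb => ?_⟩⟩
  · rw [add_comm]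
    exact C.Q'.left_smul_mem hb hq'
  · rw [← hST b]
    refine sum_mem fun i _ => ?_
    have h1 : T b (y i) ∈ C.Q'.deg (d i + γ) := hb (d i) (y i) (hy i)
    have := C.pair'_mem _ _ _ h1 _ (hx i)
    rwa [show d i + γ + (0 - d i) = γ by abel] at this

variable [GradedRing 𝒜]

/-- Finite generation and projectivity come from the homogeneous dual basis. Generation comes from
the other pairing: each `m` is a sum of elements `m (q, q')`, which are values of maps from `Q'`. -/
theorem isGradedProgenerator (C : MoritaContext 𝒜 ℬ) : IsGradedProgenerator C.Q'.toGrMod := by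
  obtain ⟨n, -, d, y, x, hy, hx, hsum⟩ := C.exists_sum'
  have hdual := C.sum_smul_eq hsum
  refine ⟨⟨⟨@Finset.image _ _ (Classical.decEq _) y Finset.univ, ?_⟩⟩, ?_, ?_⟩
  · rw [eq_top_iff]
    intro q' _
    have hq : ∑ i, op (C.pair (x i) q') • y i = q' := hdual q'
    rw [← hq]
    exact sum_mem fun i _ => Submodule.smul_mem _ _ (Submodule.subset_span
      (by classical exact Finset.mem_coe.2 (Finset.mem_image.2 ⟨i, Finset.mem_univ i, rfl⟩)))
  · refine GrMod.projective_of_dualBasis C.Q'.toGrMod d y hy (fun i => C.pairLin (x i))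
      (fun i γ q' hq' => ?_) hdual
    rw [add_comm]
    exact C.pair_mem _ _ _ (hx i) _ hq'
  · intro M N f hf
    by_contra! hno
    refine hf (GrMod.hom_ext (linearMap_ext_homogeneous fun γ m hm => ?_))
    have key : ∀ z ∈ AddSubgroup.closure {z | ∃ q q', z = C.pair q q'},
        GrMod.toLin f (op z • m) = 0 := by
      intro z hz
      induction hz using AddSubgroup.closure_induction with
      | zero => simp
      | add y z _ _ hy hz => rw [MulOpposite.op_add, add_smul, map_add, hy, hz, add_zero]
      | neg z _ hz => rw [MulOpposite.op_neg, neg_smul, map_neg, hz, neg_zero]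
      | mem z hz =>
        obtain ⟨q, q', rfl⟩ := hz
        refine isInternal_induction C.Q.isInternal
          (p := fun q => GrMod.toLin f (op (C.pair q q') • m) = 0) (by simp) ?_
          (fun x y hx hy => by
            rw [map_add, AddMonoidHom.add_apply, MulOpposite.op_add, add_smul, map_add, hx, hy,
              add_zero]) q
        intro i q hq
        -- The map `q' ↦ m (q, q')` raises degrees by `γ + i`, so it preserves degrees once `Q'` is
        -- shifted by `-(γ + i)`.
        let g : C.Q'.toGrMod.shift (-(γ + i)) ⟶ M :=
          GrMod.ofLin (M := C.Q'.toGrMod.shift (-(γ + i))) ((eltLin m).comp (C.pairLin q)) (by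
            intro j q₁ hq₁
            have := M.smul_mem (C.pair_mem i _ q hq q₁ hq₁) hm
            rwa [show γ + (i + (j + -(γ + i))) = j by abel] at this)
        exact LinearMap.congr_fun (congrArg GrMod.toLin (hno _ g)) q'
    have := key 1 C.one_mem
    rwa [op_one, one_smul] at this

end MoritaContext

end Progenerators

/-! ### From a Morita context to a full idempotent matrix -/

section MatrixOfContext

variable {Γ : Type w} [AddCommGroup Γ] [DecidableEq Γ] {A B : Type u} [Ring A] [Ring B]
  {𝒜 : Γ → AddSubgroup A} {ℬ : Γ → AddSubgroup B}

/-- The subgroup generated by the products `x e y` absorbs multiplication on the right, so it is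
everything once it contains 1. -/
theorem isFull_of_one_mem {R : Type*} [Ring R] {e : R}
    (h : (1 : R) ∈ AddSubgroup.closure {z : R | ∃ x y : R, z = x * e * y}) : IsFull e := by
  rw [IsFull, eq_top_iff]
  intro r _
  have key : ∀ z ∈ AddSubgroup.closure {z : R | ∃ x y : R, z = x * e * y},
      z * r ∈ AddSubgroup.closure {z : R | ∃ x y : R, z = x * e * y} := by
    intro z hz
    induction hz using AddSubgroup.closure_induction with
    | zero => simp
    | add y z _ _ hy hz => rw [add_mul]; exact add_mem hy hz
    | neg z _ hz => rw [neg_mul]; exact neg_mem hz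
    | mem z hz =>
      obtain ⟨x, y, rfl⟩ := hz
      exact AddSubgroup.subset_closure ⟨x, y * r, by simp only [mul_assoc]⟩
  simpa using key 1 h

/-- Expressing `B ≅ End_A(Q')` in the dual basis `y_i`, `(x_i, -)` gives the matrices `((x_i, b
y_j))`; the image of 1 is the idempotent that presents `Q'` as a direct summand of a free module.
The weights `δ` are the degrees of the `y_i`. -/
theorem MoritaContext.exists_matrix (C : MoritaContext 𝒜 ℬ) [GradedRing 𝒜] [GradedRing ℬ] :
    ∃ (n : ℕ) (_ : 0 < n) (δ : Fin n → Γ) (e : Matrix (Fin n) (Fin n) A)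
      (he : IsIdempotentElem e), IsFull e ∧ (∃ γ : Γ, e ∈ matrixGrading 𝒜 δ γ) ∧
        GradedIso ℬ (cornerGrading (matrixGrading 𝒜 δ) he) := by
  obtain ⟨n, hn, d, y, x, hy, hx, hsum⟩ := C.exists_sum'
  let F : B → Matrix (Fin n) (Fin n) A := fun b => Matrix.of fun i j => C.pair (x i) (b • y j)
  have hF : ∀ b i j, F b i j = C.pair (x i) (b • y j) := fun _ _ _ => rfl
  -- Inserting the dual basis between two pairings collapses a matrix product; both the
  -- multiplicativity of `F` and the fullness of `F 1` rest on this.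
  have hmid : ∀ (q : C.Q) (q' : C.Q'), ∑ k, C.pair q (y k) * C.pair (x k) q' = C.pair q q' := by
    intro q q'
    simp only [← C.pair_smul]
    rw [← map_sum, C.sum_smul_eq hsum]
  have hmul : ∀ b b', F (b * b') = F b * F b' := by
    intro b b'
    ext i j
    rw [Matrix.mul_apply, hF, mul_smul, ← C.pair_balanced, ← hmid]
    exact Finset.sum_congr rfl fun k _ => by rw [C.pair_balanced]; rfl
  have hadd : ∀ b b', F (b + b') = F b + F b' := by
    intro b b'
    ext i j
    rw [Matrix.add_apply, hF, hF, hF, add_smul, map_add]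
  have he : IsIdempotentElem (F 1) := by rw [IsIdempotentElem, ← hmul, one_mul]
  let T : B →+* he.Corner :=
    { toFun := fun b => ⟨F b, F b, by
        change F 1 * F b * F 1 = F b
        rw [← hmul, ← hmul, one_mul, mul_one]⟩
      map_one' := rfl
      map_mul' := fun b b' => Subtype.ext (hmul b b')
      map_zero' := Subtype.ext (by
        change F 0 = 0
        ext i j
        rw [hF, zero_smul, map_zero]; rfl)
      map_add' := fun b b' => Subtype.ext (hadd b b') }
  -- `S` inverts `F` on the corner; on an arbitrary matrix the composite is compression by `F 1`.
  let S : Matrix (Fin n) (Fin n) A → B := fun X => ∑ i, ∑ j, C.pair' (op (X i j) • y i) (x j)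
  have hST : ∀ b, S (F b) = b := by
    intro b
    change ∑ i, ∑ j, C.pair' (op (C.pair (x i) (b • y j)) • y i) (x j) = b
    rw [Finset.sum_comm]
    simp only [← AddMonoidHom.finsetSum_apply, ← map_sum, C.sum_smul_eq hsum, C.smul_pair']
    rw [← Finset.mul_sum, hsum, mul_one]
  have hTS : ∀ X, F (S X) = F 1 * X * F 1 := by
    intro X
    ext i j
    rw [hF, Matrix.mul_apply]
    simp only [S, Matrix.mul_apply, Finset.sum_mul, Finset.sum_smul, map_sum, hF, one_smul]
    rw [Finset.sum_comm]
    refine Finset.sum_congr rfl fun l _ => Finset.sum_congr rfl fun k _ => ?_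
    rw [C.assoc', C.pair_smul, C.pair_smul]
  refine ⟨n, hn, d, F 1, he, isFull_of_one_mem ?_, ⟨0, fun i j => ?_⟩,
    RingEquiv.ofBijective T ⟨fun b b' h => ?_, fun X => ⟨S X.1, ?_⟩⟩, fun γ b => ?_⟩
  -- For `z = (q, q')`, take the matrix with row `i` equal to `((q, y_k))` and the one with column
  -- `i` equal to `((x_l, q'))`. Multiplying them around `F 1` leaves `(q, q')` at place `(i, i)`.
  · have key : ∀ (i : Fin n), ∀ z ∈ AddSubgroup.closure {z | ∃ q q', z = C.pair q q'},
        Matrix.single i i z ∈ AddSubgroup.closure {z : Matrix (Fin n) (Fin n) A |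
          ∃ x y, z = x * F 1 * y} := by
      intro i z hz
      induction hz using AddSubgroup.closure_induction with
      | zero => simp
      | add y z _ _ hy hz => rw [Matrix.single_add]; exact add_mem hy hz
      | neg z _ hz =>
        rw [show Matrix.single i i (-z) = -Matrix.single i i z from
          map_neg (Matrix.singleAddMonoidHom i i) z]
        exact neg_mem hz
      | mem z hz =>
        obtain ⟨q, q', rfl⟩ := hz
        refine AddSubgroup.subset_closure
          ⟨Matrix.of fun a k => if a = i then C.pair q (y k) else 0,
            Matrix.of fun l b => if b = i then C.pair (x l) q' else 0, ?_⟩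
        ext a b
        rw [Matrix.mul_apply]
        by_cases ha : a = i
        · subst ha
          by_cases hb : b = a
          · subst hb
            simp [Matrix.mul_apply, hF, hmid]
          · simp [hb, Matrix.single, Ne.symm hb]
        · simp [Matrix.mul_apply, ha, Matrix.single, Ne.symm ha]
    have h1 : (1 : Matrix (Fin n) (Fin n) A) = ∑ i, Matrix.single i i 1 := by
      rw [← Matrix.diagonal_one, ← Matrix.sum_single_eq_diagonal]
    rw [h1]
    exact sum_mem fun i _ => key i 1 C.one_mem
  · rw [hF, one_smul, show 0 + d j - d i = 0 - d i + d j by abel]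
    exact C.pair_mem _ _ _ (hx i) _ (hy j)
  · have h : F b = F b' := congrArg Subtype.val h
    rw [← hST b, h, hST]
  · obtain ⟨X, r, rfl⟩ := X
    refine Subtype.ext ((hTS _).trans ?_)
    change F 1 * (F 1 * r * F 1) * F 1 = F 1 * r * F 1
    rw [← mul_assoc, ← mul_assoc, he.eq, mul_assoc, he.eq]
  · constructor
    · intro hb i j
      change F b i j ∈ _
      rw [hF, show γ + d j - d i = 0 - d i + (γ + d j) by abel]
      exact C.pair_mem _ _ _ (hx i) _ (C.Q'.left_smul_mem hb (hy j))
    · intro hb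
      have hb : ∀ i j, F b i j ∈ 𝒜 (γ + d j - d i) := hb
      rw [← hST b]
      refine sum_mem fun i _ => sum_mem fun j _ => ?_
      have := C.pair'_mem _ _ _ (C.Q'.right_smul_mem (hb i j) (hy i)) _ (hx j)
      rwa [show d i + (γ + d j - d i) + (0 - d j) = γ by abel] at this

end MatrixOfContext

/-! ### From a full idempotent matrix to a Morita context -/

section ContextOfMatrix

open Matrix

variable {Γ : Type w} [AddCommGroup Γ] {A B : Type u} [Ring A] [Ring B]
  {𝒜 : Γ → AddSubgroup A} {ℬ : Γ → AddSubgroup B}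

/-- The left `A`-module of rows `v` with `v e = v`. -/
def rows {n : ℕ} (e : Matrix (Fin n) (Fin n) A) : Submodule A (Fin n → A) where
  carrier := {v | v ᵥ* e = v}
  zero_mem' := zero_vecMul e
  add_mem' := fun {v v'} hv hv' => by
    rw [Set.mem_ofPred_eq] at *
    rw [add_vecMul, hv, hv']
  smul_mem' := fun a v hv => by
    rw [Set.mem_ofPred_eq] at *
    rw [smul_vecMul, hv]

/-- The right `A`-module of columns `v` with `e v = v`. -/
def columns {n : ℕ} (e : Matrix (Fin n) (Fin n) A) : Submodule Aᵐᵒᵖ (Fin n → A) where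
  carrier := {v | e *ᵥ v = v}
  zero_mem' := mulVec_zero e
  add_mem' := fun {v v'} hv hv' => by
    rw [Set.mem_ofPred_eq] at *
    rw [mulVec_add, hv, hv']
  smul_mem' := fun a v hv => by
    rw [Set.mem_ofPred_eq] at *
    rw [mulVec_smul, hv]

/-- A ring isomorphism from `B` onto the corner `e M_n(A) e`, as a map into the matrices. -/
structure CornerIso {n : ℕ} (e : Matrix (Fin n) (Fin n) A) (δ : Fin n → Γ)
    (𝒜 : Γ → AddSubgroup A) (ℬ : Γ → AddSubgroup B) where
  toFun : B → Matrix (Fin n) (Fin n) A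
  inv : Matrix (Fin n) (Fin n) A →+ B
  add : ∀ b b', toFun (b + b') = toFun b + toFun b'
  mul : ∀ b b', toFun (b * b') = toFun b * toFun b'
  one : toFun 1 = e
  inv_toFun : ∀ b, inv (toFun b) = b
  toFun_inv : ∀ X, toFun (inv X) = e * X * e
  mem_iff : ∀ γ b, b ∈ ℬ γ ↔ toFun b ∈ matrixGrading 𝒜 δ γ

/-- Extending the inverse by the compression `X ↦ e X e` makes it an additive map on all matrices,
so later computations avoid the corner subtype. -/
theorem exists_cornerIso {n : ℕ} {e : Matrix (Fin n) (Fin n) A} (he : IsIdempotentElem e)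
    {δ : Fin n → Γ} (h : GradedIso ℬ (cornerGrading (matrixGrading 𝒜 δ) he)) :
    Nonempty (CornerIso e δ 𝒜 ℬ) := by
  obtain ⟨f, hf⟩ := h
  let c : Matrix (Fin n) (Fin n) A → he.Corner := fun X => ⟨e * X * e, X, rfl⟩
  have hadd : ∀ X Y, c (X + Y) = c X + c Y := fun X Y => Subtype.ext (by
    change e * (X + Y) * e = e * X * e + e * Y * e
    rw [mul_add, add_mul])
  refine ⟨⟨fun b => (f b).1, AddMonoidHom.mk' (fun X => f.symm (c X)) fun X Y => ?_,
    fun b b' => by rw [map_add]; rfl, fun b b' => by rw [map_mul]; rfl, by rw [map_one]; rfl,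
    fun b => ?_, fun X => ?_, hf⟩⟩
  · rw [hadd, map_add]
  · refine (f.symm_apply_eq).2 (Subtype.ext ?_)
    obtain ⟨h1, h2⟩ := (Subsemigroup.mem_corner_iff he).1 (f b).2
    change e * (f b).1 * e = (f b).1
    rw [h1, h2]
  · exact congrArg Subtype.val (f.apply_symm_apply (c X))

theorem e_vecMulVec_e {n : ℕ} {e : Matrix (Fin n) (Fin n) A} {w v : Fin n → A} (hw : e *ᵥ w = w)
    (hv : v ᵥ* e = v) : e * vecMulVec w v * e = vecMulVec w v := by
  rw [mul_vecMulVec, vecMulVec_mul, hw, hv]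

/-- The product of a row and a column. -/
def rowPair {n : ℕ} (e : Matrix (Fin n) (Fin n) A) : rows e →+ columns e →+ A :=
  AddMonoidHom.mk' (fun v => AddMonoidHom.mk' (fun w => v.1 ⬝ᵥ w.1) fun _ _ => dotProduct_add _ _ _)
    fun v v' => AddMonoidHom.ext fun w => add_dotProduct v.1 v'.1 w.1

namespace CornerIso

variable {n : ℕ} {e : Matrix (Fin n) (Fin n) A} {δ : Fin n → Γ}

theorem zero (ρ : CornerIso e δ 𝒜 ℬ) : ρ.toFun 0 = 0 := by
  have := ρ.add 0 0
  simpa using this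

theorem map_one_mul_map_one (ρ : CornerIso e δ 𝒜 ℬ) (b : B) :
    ρ.toFun b * ρ.toFun 1 = ρ.toFun b ∧ ρ.toFun 1 * ρ.toFun b = ρ.toFun b := by
  rw [← ρ.mul, ← ρ.mul, mul_one, one_mul]
  exact ⟨rfl, rfl⟩

theorem mul_e (ρ : CornerIso e δ 𝒜 ℬ) (b : B) : ρ.toFun b * e = ρ.toFun b := by
  have := (ρ.map_one_mul_map_one b).1
  rwa [ρ.one] at this

theorem e_mul (ρ : CornerIso e δ 𝒜 ℬ) (b : B) : e * ρ.toFun b = ρ.toFun b := by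
  have := (ρ.map_one_mul_map_one b).2
  rwa [ρ.one] at this

theorem inv_mul (ρ : CornerIso e δ 𝒜 ℬ) (b : B) (X : Matrix (Fin n) (Fin n) A)
    (hX : e * X * e = X) : ρ.inv (ρ.toFun b * X) = b * ρ.inv X := by
  rw [← ρ.inv_toFun (b * ρ.inv X), ρ.mul, ρ.toFun_inv, hX]

theorem inv_mul' (ρ : CornerIso e δ 𝒜 ℬ) (b : B) (X : Matrix (Fin n) (Fin n) A)
    (hX : e * X * e = X) : ρ.inv (X * ρ.toFun b) = ρ.inv X * b := by
  rw [← ρ.inv_toFun (ρ.inv X * b), ρ.mul, ρ.toFun_inv, hX]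

end CornerIso

variable [DecidableEq Γ] [GradedRing 𝒜] {n : ℕ} {δ : Fin n → Γ} {e : Matrix (Fin n) (Fin n) A}

/-- From `e = e²`, the entries of `e` lie in the components for degree `γ` and for degree `2γ`. If
`γ ≠ 0` these are different, so `e = 0`, which has every degree. -/
theorem idempotent_mem_zero (he : IsIdempotentElem e) {γ : Γ}
    (h : e ∈ matrixGrading 𝒜 δ γ) : e ∈ matrixGrading 𝒜 δ 0 := by
  by_cases hγ : γ = 0
  · rwa [hγ] at h
  have h2 : ∀ i j, e i j ∈ 𝒜 (γ + γ + δ j - δ i) := by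
    intro i j
    rw [← he.eq, mul_apply]
    refine sum_mem fun k _ => ?_
    have := SetLike.mul_mem_graded (h i k) (h k j)
    rwa [show γ + δ k - δ i + (γ + δ j - δ k) = γ + γ + δ j - δ i by abel] at this
  intro i j
  have : e i j = 0 := by
    rw [← proj_same (ring_isInternal 𝒜) (h i j)]
    refine proj_ne _ (h2 i j) fun h => hγ ?_
    have := sub_left_injective h
    have := add_right_cancel this
    simpa using this
  rw [this]
  exact zero_mem _

theorem vecMul_mem {X : Matrix (Fin n) (Fin n) A}
    {v : Fin n → A} {γ β : Γ} (hv : ∀ i, v i ∈ 𝒜 (γ - -δ i)) (hX : X ∈ matrixGrading 𝒜 δ β)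
    (j : Fin n) : (v ᵥ* X) j ∈ 𝒜 (γ + β - -δ j) := by
  change ∑ i, v i * X i j ∈ _
  refine sum_mem fun i _ => ?_
  have := SetLike.mul_mem_graded (hv i) (hX i j)
  rwa [show γ - -δ i + (β + δ j - δ i) = γ + β - -δ j by abel] at this

theorem mulVec_mem {X : Matrix (Fin n) (Fin n) A}
    {v : Fin n → A} {γ β : Γ} (hX : X ∈ matrixGrading 𝒜 δ β) (hv : ∀ i, v i ∈ 𝒜 (γ - δ i))
    (j : Fin n) : (X *ᵥ v) j ∈ 𝒜 (β + γ - δ j) := by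
  change ∑ i, X j i * v i ∈ _
  refine sum_mem fun i _ => ?_
  have := SetLike.mul_mem_graded (hX j i) (hv i)
  rwa [show β + δ i - δ j + (γ - δ i) = β + γ - δ j by abel] at this

namespace CornerIso

/-- The rows `v` with `v e = v` form a graded `A`-`B`-bimodule. -/
def rowBimod (ρ : CornerIso e δ 𝒜 ℬ) (he : e ∈ matrixGrading 𝒜 δ 0)
    (hid : IsIdempotentElem e) : GrBimod 𝒜 ℬ :=
  letI : Module Bᵐᵒᵖ (rows e) :=
    { smul := fun b v => ⟨v.1 ᵥ* ρ.toFun b.unop, by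
        change _ ᵥ* _ = _
        rw [vecMul_vecMul, ρ.mul_e]⟩
      one_smul := fun v => Subtype.ext (by
        change v.1 ᵥ* ρ.toFun 1 = v.1
        rw [ρ.one]
        exact v.2)
      mul_smul := fun b b' v => Subtype.ext (by
        change v.1 ᵥ* ρ.toFun (b'.unop * b.unop) = (v.1 ᵥ* ρ.toFun b'.unop) ᵥ* ρ.toFun b.unop
        rw [ρ.mul, vecMul_vecMul])
      smul_zero := fun b => Subtype.ext (zero_vecMul (ρ.toFun b.unop))
      smul_add := fun b v v' => Subtype.ext (add_vecMul (ρ.toFun b.unop) v.1 v'.1)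
      add_smul := fun b b' v => Subtype.ext (by
        change v.1 ᵥ* ρ.toFun (b.unop + b'.unop) = v.1 ᵥ* ρ.toFun b.unop + v.1 ᵥ* ρ.toFun b'.unop
        rw [ρ.add, vecMul_add])
      zero_smul := fun v => Subtype.ext (by
        change v.1 ᵥ* ρ.toFun 0 = 0
        rw [ρ.zero, vecMul_zero]) }
  { carrier := rows e
    smulCommClass := ⟨fun a b v => Subtype.ext (smul_vecMul a v.1 _).symm⟩
    -- Rows carry the weights opposite to those of columns, so that their dot product respects
    -- degrees. The form `γ - -δ i` is that of `isInternal_pi` for the weights `-δ`.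
    deg := fun γ => (AddSubgroup.pi Set.univ fun i => 𝒜 (γ - -δ i)).comap
      (rows e).subtype.toAddMonoidHom
    isInternal := isInternal_of_retract (isInternal_pi (ring_isInternal 𝒜) fun i => -δ i)
      (rows e).subtype.toAddMonoidHom
      (AddMonoidHom.mk' (fun v => ⟨v ᵥ* e, by
        change _ ᵥ* _ = _
        rw [vecMul_vecMul, hid.eq]⟩) fun v v' => Subtype.ext (add_vecMul e v v'))
      (fun v => Subtype.ext v.2) (fun γ v hv => hv) (fun γ v hv j _ => by
        have := vecMul_mem (fun i => hv i trivial) he j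
        rwa [add_zero] at this)
    left_smul_mem := fun {α γ a v} ha hv i _ => by
      have := SetLike.mul_mem_graded ha (hv i trivial)
      rwa [← add_sub_assoc] at this
    right_smul_mem := fun {β γ b v} hb hv j _ =>
      vecMul_mem (fun i => hv i trivial) ((ρ.mem_iff β b).1 hb) j }

/-- The columns `v` with `e v = v` form a graded `B`-`A`-bimodule. -/
def columnBimod (ρ : CornerIso e δ 𝒜 ℬ) (he : e ∈ matrixGrading 𝒜 δ 0)
    (hid : IsIdempotentElem e) : GrBimod ℬ 𝒜 :=
  letI : Module B (columns e) :=
    { smul := fun b v => ⟨ρ.toFun b *ᵥ v.1, by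
        change _ *ᵥ _ = _
        rw [mulVec_mulVec, ρ.e_mul]⟩
      one_smul := fun v => Subtype.ext (by
        change ρ.toFun 1 *ᵥ v.1 = v.1
        rw [ρ.one]
        exact v.2)
      mul_smul := fun b b' v => Subtype.ext (by
        change ρ.toFun (b * b') *ᵥ v.1 = ρ.toFun b *ᵥ (ρ.toFun b' *ᵥ v.1)
        rw [ρ.mul, mulVec_mulVec])
      smul_zero := fun b => Subtype.ext (mulVec_zero (ρ.toFun b))
      smul_add := fun b v v' => Subtype.ext (mulVec_add (ρ.toFun b) v.1 v'.1)
      add_smul := fun b b' v => Subtype.ext (by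
        change ρ.toFun (b + b') *ᵥ v.1 = ρ.toFun b *ᵥ v.1 + ρ.toFun b' *ᵥ v.1
        rw [ρ.add, add_mulVec])
      zero_smul := fun v => Subtype.ext (by
        change ρ.toFun 0 *ᵥ v.1 = 0
        rw [ρ.zero, zero_mulVec]) }
  { carrier := columns e
    smulCommClass := ⟨fun b a v => Subtype.ext (mulVec_smul _ a v.1)⟩
    deg := fun γ => (AddSubgroup.pi Set.univ fun i => 𝒜 (γ - δ i)).comap
      (columns e).subtype.toAddMonoidHom
    isInternal := isInternal_of_retract (isInternal_pi (ring_isInternal 𝒜) δ)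
      (columns e).subtype.toAddMonoidHom
      (AddMonoidHom.mk' (fun v => ⟨e *ᵥ v, by
        change _ *ᵥ _ = _
        rw [mulVec_mulVec, hid.eq]⟩) fun v v' => Subtype.ext (mulVec_add e v v'))
      (fun v => Subtype.ext v.2) (fun γ v hv => hv) (fun γ v hv j _ => by
        have := mulVec_mem he (fun i => hv i trivial) j
        rwa [zero_add] at this)
    left_smul_mem := fun {β γ b v} hb hv j _ =>
      mulVec_mem ((ρ.mem_iff β b).1 hb) (fun i => hv i trivial) j
    right_smul_mem := fun {α γ a v} ha hv i _ => by
      have := SetLike.mul_mem_graded (hv i trivial) ha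
      rwa [sub_add_eq_add_sub] at this }

/-- The element of the corner ring given by a column and a row. -/
def columnPair (ρ : CornerIso e δ 𝒜 ℬ) : columns e →+ rows e →+ B :=
  AddMonoidHom.mk' (fun w => AddMonoidHom.mk' (fun v => ρ.inv (vecMulVec w.1 v.1)) fun v v' => by
      rw [← map_add, ← vecMulVec_add]; rfl)
    fun w w' => AddMonoidHom.ext fun v => by
      change ρ.inv (vecMulVec (w.1 + w'.1) v.1) = ρ.inv _ + ρ.inv _
      rw [← map_add, ← add_vecMulVec]

/-- The Morita context of a full idempotent matrix: rows and columns. -/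
def context (ρ : CornerIso e δ 𝒜 ℬ) (he : e ∈ matrixGrading 𝒜 δ 0)
    (hid : IsIdempotentElem e) (hn : 0 < n) (hfull : IsFull e) : MoritaContext 𝒜 ℬ where
  Q := ρ.rowBimod he hid
  Q' := ρ.columnBimod he hid
  pair := rowPair e
  pair' := ρ.columnPair
  pair_mem := fun i j (v : rows e) hv (w : columns e) hw => by
    change ∑ k, v.1 k * w.1 k ∈ _
    refine sum_mem fun k _ => ?_
    have hk : v.1 k ∈ 𝒜 (i - -δ k) := hv k trivial
    have := SetLike.mul_mem_graded hk (hw k trivial)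
    rwa [show i - -δ k + (j - δ k) = i + j by abel] at this
  pair'_mem := fun i j (w : columns e) hw (v : rows e) hv => by
    rw [ρ.mem_iff]
    change ρ.toFun (ρ.inv (vecMulVec w.1 v.1)) ∈ _
    rw [ρ.toFun_inv, e_vecMulVec_e w.2 v.2]
    intro k l
    have hk : w.1 k ∈ 𝒜 (i - δ k) := hw k trivial
    have hl : v.1 l ∈ 𝒜 (j - -δ l) := hv l trivial
    have := SetLike.mul_mem_graded hk hl
    rwa [show i - δ k + (j - -δ l) = i + j + δ l - δ k by abel] at this
  smul_pair := fun a (v : rows e) (w : columns e) => smul_dotProduct a v.1 w.1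
  pair_smul := fun a (v : rows e) (w : columns e) => dotProduct_smul (op a) v.1 w.1
  pair_balanced := fun b (v : rows e) (w : columns e) =>
    (dotProduct_mulVec v.1 (ρ.toFun b) w.1).symm
  smul_pair' := fun b (w : columns e) (v : rows e) => by
    change ρ.inv (vecMulVec (ρ.toFun b *ᵥ w.1) v.1) = b * ρ.inv (vecMulVec w.1 v.1)
    rw [← ρ.inv_mul b _ (e_vecMulVec_e w.2 v.2), mul_vecMulVec]
  pair'_smul := fun b (w : columns e) (v : rows e) => by
    change ρ.inv (vecMulVec w.1 (v.1 ᵥ* ρ.toFun b)) = ρ.inv (vecMulVec w.1 v.1) * b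
    rw [← ρ.inv_mul' b _ (e_vecMulVec_e w.2 v.2), vecMulVec_mul]
  pair'_balanced := fun a (w : columns e) (v : rows e) => by
    change ρ.inv (vecMulVec (op a • w.1) v.1) = ρ.inv (vecMulVec w.1 (a • v.1))
    congr 1
    ext i j
    exact mul_assoc _ _ _
  assoc := fun (v : rows e) (w : columns e) (v₁ : rows e) => Subtype.ext (by
    change (v.1 ⬝ᵥ w.1) • v₁.1 = v.1 ᵥ* ρ.toFun (ρ.inv (vecMulVec w.1 v₁.1))
    rw [ρ.toFun_inv, e_vecMulVec_e w.2 v₁.2, vecMul_vecMulVec])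
  assoc' := fun (w : columns e) (v : rows e) (w₁ : columns e) => Subtype.ext (by
    change ρ.toFun (ρ.inv (vecMulVec w.1 v.1)) *ᵥ w₁.1 = op (v.1 ⬝ᵥ w₁.1) • w.1
    rw [ρ.toFun_inv, e_vecMulVec_e w.2 v.2, vecMulVec_mulVec])
  one_mem := by
    -- The first diagonal entry of `x e y = (x e)(e y)` is the product of a row fixed by `e` and a
    -- column fixed by `e`. Applying this to the identity matrix, which needs `0 < n`, writes 1 as a
    -- sum of such products.
    have key : ∀ z ∈ AddSubgroup.closure {z : Matrix (Fin n) (Fin n) A | ∃ x y, z = x * e * y},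
        z ⟨0, hn⟩ ⟨0, hn⟩ ∈ AddSubgroup.closure
          {z | ∃ (v : rows e) (w : columns e), z = v.1 ⬝ᵥ w.1} := by
      intro z hz
      induction hz using AddSubgroup.closure_induction with
      | zero => exact zero_mem _
      | add y z _ _ hy hz => exact add_mem hy hz
      | neg z _ hz => exact neg_mem hz
      | mem z hz =>
        obtain ⟨x, y, rfl⟩ := hz
        refine AddSubgroup.subset_closure ⟨⟨(x * e) ⟨0, hn⟩, ?_⟩,
          ⟨fun i => (e * y) i ⟨0, hn⟩, ?_⟩, ?_⟩
        · change (x * e) ⟨0, hn⟩ ᵥ* e = _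
          rw [← mul_apply_eq_vecMul, mul_assoc, hid.eq]
        · have h : e * (e * y) = e * y := by rw [← mul_assoc, hid.eq]
          exact funext fun k => congrFun (congrFun h k) ⟨0, hn⟩
        · have h : x * e * y = x * e * (e * y) := by
            rw [← mul_assoc, mul_assoc x e e, hid.eq]
          exact congrFun (congrFun h ⟨0, hn⟩) ⟨0, hn⟩
    have := key 1 (hfull ▸ AddSubgroup.mem_top _)
    rw [one_apply_eq] at this
    exact this
  one_mem' := by
    let r : Fin n → rows e := fun i => ⟨e i, by
      change e i ᵥ* e = _
      rw [← mul_apply_eq_vecMul, hid.eq]⟩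
    let c : Fin n → columns e := fun i => ⟨fun k => e k i,
      funext fun k => congrFun (congrFun hid.eq k) i⟩
    -- The identity `e = e e` expands into the sum of (column `i` of `e`) times (row `i` of `e`).
    have h : (1 : B) = ∑ i, ρ.columnPair (c i) (r i) := by
      change 1 = ∑ i, ρ.inv (vecMulVec (fun k => e k i) (e i))
      rw [← map_sum, ← ρ.inv_toFun 1, ρ.one]
      congr 1
      ext k l
      rw [Matrix.sum_apply]
      exact (congrFun (congrFun hid.eq k) l).symm
    rw [h]
    exact sum_mem fun i _ => AddSubgroup.subset_closure ⟨c i, r i, rfl⟩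

end CornerIso

end ContextOfMatrix

/-! ### From a bimodule with a dual basis and full trace to a Morita context -/

section ContextOfBimodule

variable {Γ : Type w} [AddCommGroup Γ] [DecidableEq Γ] {A B : Type u} [Ring A] [Ring B]
  {𝒜 : Γ → AddSubgroup A} {ℬ : Γ → AddSubgroup B}

/-- The identity of `Q` is a sum of maps that factor through `B`. -/
def HasDualBasis (B : Type*) [Ring B] (Q : Type*) [AddCommGroup Q] [Module Bᵐᵒᵖ Q] : Prop :=
  (LinearMap.id : Q →ₗ[Bᵐᵒᵖ] Q) ∈
    AddSubgroup.closure {g | ∃ (p : Q) (f : Q →ₗ[Bᵐᵒᵖ] B), g = (eltLin p).comp f}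

/-- The identity of `B` is a sum of values of linear maps from `Q` to `B`. -/
def HasFullTrace (B : Type*) [Ring B] (Q : Type*) [AddCommGroup Q] [Module Bᵐᵒᵖ Q] : Prop :=
  (1 : B) ∈ AddSubgroup.closure {b | ∃ (f : Q →ₗ[Bᵐᵒᵖ] B) (q : Q), b = f q}

theorem HasDualBasis.finite {Q : Type*} [AddCommGroup Q] [Module Bᵐᵒᵖ Q] (h : HasDualBasis B Q) :
    Module.Finite Bᵐᵒᵖ Q := by
  classical
  obtain ⟨n, -, g, hg, hsum⟩ := exists_sum_of_mem_closure
    (S := {g | ∃ (p : Q) (f : Q →ₗ[Bᵐᵒᵖ] B), g = (eltLin p).comp f})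
    ⟨0, 0, by simp⟩ (by
      rintro _ ⟨p, f, rfl⟩
      exact ⟨p, -f, by simp⟩) h
  choose p f hpf using hg
  refine ⟨⟨Finset.univ.image p, ?_⟩⟩
  rw [eq_top_iff]
  intro q _
  rw [← LinearMap.id_apply (R := Bᵐᵒᵖ) q, ← hsum, LinearMap.sum_apply]
  refine sum_mem fun i _ => ?_
  rw [hpf i]
  exact Submodule.smul_mem _ _ (Submodule.subset_span (by simp))

/-- On a homogeneous `q` of degree `β`, both `a q` and its component of degree `β + δ` agree, and
the latter is `a_δ q`. Hence `a - a_δ` kills `Q`, and faithfulness gives `a = a_δ`. -/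
theorem GrBimod.mem_of_smul_mem [GradedRing 𝒜] (Q : GrBimod 𝒜 ℬ)
    (hinj : ∀ a : A, (∀ q : Q, a • q = 0) → a = 0) {δ : Γ} {a : A}
    (ha : ∀ γ, ∀ q ∈ Q.deg γ, a • q ∈ Q.deg (γ + δ)) : a ∈ 𝒜 δ := by
  have : a - proj (ring_isInternal 𝒜) δ a = 0 := hinj _ fun q => by
    refine isInternal_induction Q.isInternal
      (p := fun q => (a - proj (ring_isInternal 𝒜) δ a) • q = 0) (smul_zero _) ?_
      (fun x y hx hy => by rw [smul_add, hx, hy, add_zero]) q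
    intro β q hq
    have h := map_proj (ring_isInternal 𝒜) Q.isInternal β (AddMonoidHom.flip (smulAddHom A Q) q)
      (fun γ a ha => Q.left_smul_mem ha hq) δ a
    simp only [AddMonoidHom.flip_apply, smulAddHom_apply] at h
    rw [sub_smul, h, add_comm δ β, proj_same _ (ha β q hq), sub_self]
  rw [sub_eq_zero.1 this]
  exact proj_mem _ _ _

variable [GradedRing ℬ]

/-- The dual `Hom_B(Q, B)` of a graded bimodule that is finitely generated over `B`. -/
def GrBimod.dual (Q : GrBimod 𝒜 ℬ) (hQ : Module.Finite Bᵐᵒᵖ Q) : GrBimod ℬ 𝒜 :=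
  letI : Module Aᵐᵒᵖ (Q →ₗ[Bᵐᵒᵖ] B) :=
    { smul := fun a f => f.comp (Module.toModuleEnd Bᵐᵒᵖ Q a.unop)
      one_smul := fun f => LinearMap.ext fun q => congrArg f (one_smul A q)
      mul_smul := fun a a' f => LinearMap.ext fun q => congrArg f (mul_smul a'.unop a.unop q)
      smul_zero := fun a => rfl
      smul_add := fun a f g => rfl
      add_smul := fun a a' f => LinearMap.ext fun q =>
        (congrArg f (add_smul a.unop a'.unop q)).trans (map_add f _ _)
      zero_smul := fun f => LinearMap.ext fun q =>
        (congrArg f (zero_smul A q)).trans (map_zero f) }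
  { carrier := Q →ₗ[Bᵐᵒᵖ] B
    smulCommClass := ⟨fun b a f => rfl⟩
    deg := homDeg Q.toGrMod (regular ℬ)
    isInternal :=
      have : Module.Finite Bᵐᵒᵖ Q.toGrMod := hQ
      homDeg_isInternal Q.toGrMod (regular ℬ)
    left_smul_mem := fun {β γ b f} hb hf i q hq => by
      have := SetLike.mul_mem_graded hb (hf i q hq)
      rwa [add_left_comm] at this
    right_smul_mem := fun {α γ a f} ha hf i q hq => by
      have := hf _ _ (Q.left_smul_mem ha hq)
      rwa [show α + i + γ = i + (γ + α) by abel] at this }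

/-- A graded bimodule `Q` with `A = End_B(Q)` that is a progenerator over `B` is part of a
Morita context. -/
theorem exists_context [GradedRing 𝒜] (Q : GrBimod 𝒜 ℬ)
    (hEnd : Function.Bijective (Module.toModuleEnd Bᵐᵒᵖ Q : A →+* Module.End Bᵐᵒᵖ Q))
    (hdual : HasDualBasis B Q) (htr : HasFullTrace B Q) : ∃ C : MoritaContext 𝒜 ℬ, C.Q = Q := by
  let E : A ≃+* Module.End Bᵐᵒᵖ Q := RingEquiv.ofBijective _ hEnd
  have hE : ∀ a q, E a q = a • q := fun _ _ => rfl
  have hext : ∀ a a' : A, (∀ q : Q, a • q = a' • q) → a = a' := fun a a' h =>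
    E.injective (LinearMap.ext h)
  -- The pairing `(q, f)` is the element of `A` that acts on `Q` as `x ↦ q f(x)`. It exists because
  -- `A` is all of `End_B(Q)`, and every identity below is checked on its action.
  let P : Q →+ (Q →ₗ[Bᵐᵒᵖ] B) →+ A := AddMonoidHom.mk'
    (fun q => AddMonoidHom.mk' (fun f => E.symm ((eltLin q).comp f)) fun f g => by
      rw [LinearMap.comp_add, map_add])
    fun q q' => AddMonoidHom.ext fun f => by
      change E.symm ((eltLin (q + q')).comp f)
        = E.symm ((eltLin q).comp f) + E.symm ((eltLin q').comp f)
      rw [← map_add]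
      congr 1
      exact LinearMap.ext fun x => smul_add _ _ _
  have hP : ∀ (q : Q) (f : Q →ₗ[Bᵐᵒᵖ] B) (x : Q), P q f • x = op (f x) • q := by
    intro q f x
    change E.symm ((eltLin q).comp f) • x = op (f x) • q
    rw [← hE, E.apply_symm_apply]
    rfl
  have hP_mem : ∀ i j, ∀ q ∈ Q.deg i, ∀ f ∈ homDeg Q.toGrMod (regular ℬ) j,
      P q f ∈ 𝒜 (i + j) := by
    intro i j q hq f hf
    refine Q.mem_of_smul_mem (fun a ha => hext a 0 fun q => by rw [ha, zero_smul])
      fun γ x hx => ?_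
    refine (show P q f • x = _ from hP q f x) ▸ ?_
    rw [show γ + (i + j) = i + (γ + j) by abel]
    exact Q.right_smul_mem (hf γ x hx) hq
  have hP_smul : ∀ (a : A) (q : Q) (f : Q →ₗ[Bᵐᵒᵖ] B), P (a • q) f = a * P q f :=
    fun a q f => hext _ _ fun x => by rw [hP, mul_smul, hP, smul_comm a]
  have hP_comp : ∀ (a : A) (q : Q) (f : Q →ₗ[Bᵐᵒᵖ] B),
      P q (f.comp (Module.toModuleEnd Bᵐᵒᵖ Q a)) = P q f * a :=
    fun a q f => hext _ _ fun x => by rw [hP, mul_smul, hP]; rfl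
  have hP_balanced : ∀ (b : B) (q : Q) (f : Q →ₗ[Bᵐᵒᵖ] B), P (op b • q) f = P q (b • f) :=
    fun b q f => hext _ _ fun x => by rw [hP, hP, ← mul_smul, ← op_mul]; rfl
  refine ⟨{
    Q := Q
    Q' := Q.dual hdual.finite
    pair := P
    pair' := AddMonoidHom.mk' (fun (f : Q →ₗ[Bᵐᵒᵖ] B) => f.toAddMonoidHom) fun f g => rfl
    pair_mem := hP_mem
    pair'_mem := fun i j (f : Q →ₗ[Bᵐᵒᵖ] B) hf q hq => by
      rw [add_comm]
      exact hf j q hq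
    smul_pair := hP_smul
    pair_smul := hP_comp
    pair_balanced := hP_balanced
    smul_pair' := fun b f q => rfl
    pair'_smul := fun b (f : Q →ₗ[Bᵐᵒᵖ] B) q => map_smul f (op b) q
    pair'_balanced := fun a f q => rfl
    assoc := fun q f x => hP q f x
    assoc' := fun (f : Q →ₗ[Bᵐᵒᵖ] B) q (g : Q →ₗ[Bᵐᵒᵖ] B) => LinearMap.ext fun x => by
      change f q * g x = f (P q g • x)
      rw [hP, map_smul]
      rfl
    one_mem := ?_
    one_mem' := htr }, rfl⟩
  -- Under `A = End_B(Q)`, a dual basis is exactly an expression of 1 as a sum of values of the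
  -- pairing to `A`.
  have key : ∀ g ∈ AddSubgroup.closure
      {g | ∃ (p : Q) (f : Q →ₗ[Bᵐᵒᵖ] B), g = (eltLin p).comp f},
      E.symm g ∈ AddSubgroup.closure {z | ∃ q f, z = P q f} := by
    intro g hg
    induction hg using AddSubgroup.closure_induction with
    | zero => rw [map_zero]; exact zero_mem _
    | add y z _ _ hy hz => rw [map_add]; exact add_mem hy hz
    | neg z _ hz => rw [map_neg]; exact neg_mem hz
    | mem z hz =>
      obtain ⟨p, f, rfl⟩ := hz
      exact AddSubgroup.subset_closure ⟨p, f, rfl⟩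
  have := key _ hdual
  rwa [show E.symm LinearMap.id = 1 from E.symm.map_one] at this

end ContextOfBimodule

/-! ### From a graded progenerator to a Morita context -/

section ContextOfProgenerator

variable {Γ : Type w} [AddCommGroup Γ] [DecidableEq Γ] {A B : Type u} [Ring A] [Ring B]
  {𝒜 : Γ → AddSubgroup A} {ℬ : Γ → AddSubgroup B} [GradedRing 𝒜]

/-- The graded free module `⨁ A(-d_i)`. -/
def freeModule (𝒜 : Γ → AddSubgroup A) [GradedRing 𝒜] {n : ℕ} (d : Fin n → Γ) : GrMod 𝒜 where
  carrier := Fin n → A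
  deg γ := AddSubgroup.pi Set.univ fun i => 𝒜 (γ - d i)
  isInternal := isInternal_pi (ring_isInternal 𝒜) d
  smul_mem := fun {α γ a v} ha hv i _ => by
    have := SetLike.mul_mem_graded (hv i trivial) ha
    rwa [sub_add_eq_add_sub] at this

/-- Homogeneous generators give a surjection in `Gr-A` from a graded free module. Projectivity in
`Gr-A` splits it, and the coordinates of the splitting are the functionals. -/
theorem hasDualBasis_of_projective (P : GrMod 𝒜) [Module.Finite Aᵐᵒᵖ P] [Projective P] :
    HasDualBasis A P := by
  obtain ⟨n, d, x, hx, hspan⟩ := P.exists_homogeneous_generators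
  let c : (Fin n → A) →ₗ[Aᵐᵒᵖ] P := ∑ i, (eltLin (x i)).comp (LinearMap.proj i)
  have hc : ∀ v, c v = ∑ i, op (v i) • x i := fun v => by simp [c]
  have hmem : ∀ γ (v : Fin n → A), (∀ i, v i ∈ 𝒜 (γ - d i)) → c v ∈ P.deg γ := by
    intro γ v hv
    rw [hc]
    refine sum_mem fun i _ => ?_
    have := P.smul_mem (hv i) (hx i)
    rwa [add_sub_cancel] at this
  let π : freeModule 𝒜 d ⟶ P := GrMod.ofLin (M := freeModule 𝒜 d) c fun γ v hv =>
    hmem γ v fun i => hv i trivial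
  have : Epi π := GrMod.epi_of_surjective π (by
    rw [← LinearMap.range_eq_top, eq_top_iff, ← hspan, Submodule.span_le]
    rintro _ ⟨i, rfl⟩
    refine ⟨(Pi.single i 1 : Fin n → A), (hc _).trans ?_⟩
    rw [Finset.sum_eq_single i (fun j _ hj => by rw [Pi.single_eq_of_ne hj, op_zero, zero_smul])
      (by simp), Pi.single_eq_same, op_one, one_smul])
  obtain ⟨s, hs⟩ := Projective.factors (𝟙 P) π
  let s' : P →ₗ[Aᵐᵒᵖ] (Fin n → A) := GrMod.toLin s
  have hid : (LinearMap.id : P →ₗ[Aᵐᵒᵖ] P)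
      = ∑ i, (eltLin (x i)).comp ((LinearMap.proj i).comp s') :=
    LinearMap.ext fun p => by
      have : c (s' p) = p := LinearMap.congr_fun (congrArg GrMod.toLin hs) p
      rw [LinearMap.id_apply]
      conv_lhs => rw [← this, hc]
      simp
  rw [HasDualBasis, hid]
  exact sum_mem fun i _ => AddSubgroup.subset_closure ⟨_, _, rfl⟩

/-- The images of all morphisms from shifts of `P` to `A` add up to `A`, since otherwise the
quotient would be undetected. In particular 1 is a sum of values of such maps. -/
theorem hasFullTrace_of_generator (P : GrMod 𝒜) (hP : IsGradedGenerator P) :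
    HasFullTrace A P := by
  have h := GrMod.iSup_range_eq_top (M := regular 𝒜)
    (ι := Σ α : Γ, P.shift α ⟶ regular 𝒜) (Y := fun i => P.shift i.1) (fun i => i.2)
    fun N f hf => by
      by_contra hne
      obtain ⟨α, g, hg⟩ := hP f hne
      exact hg (hf ⟨α, g⟩)
  have h1 : (1 : A) ∈ (⊤ : Submodule Aᵐᵒᵖ (regular 𝒜)) := trivial
  rw [← h] at h1
  refine Submodule.iSup_induction _ (motive := fun a : A => a ∈ AddSubgroup.closure
    {b : A | ∃ (f : P →ₗ[Aᵐᵒᵖ] A) (q : P), b = f q}) h1 ?_ (zero_mem _) fun _ _ => add_mem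
  rintro ⟨α, g⟩ _ ⟨q, rfl⟩
  exact AddSubgroup.subset_closure ⟨GrMod.toLin g, q, rfl⟩

/-- A graded progenerator with endomorphism ring `B` gives a Morita context. -/
theorem exists_context_of_progenerator [GradedRing ℬ] (P : GrMod 𝒜) (hP : IsGradedProgenerator P)
    (h : GradedIso ℬ (endGrading P)) : Nonempty (MoritaContext 𝒜 ℬ) := by
  obtain ⟨f, hf⟩ := h
  obtain ⟨hfin, hproj, hgen⟩ := hP
  let m : Module B P := Module.compHom P f.toRingHom
  let Q : GrBimod ℬ 𝒜 :=
    { carrier := P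
      leftModule := m
      smulCommClass := ⟨fun b a p => map_smul (f b) a p⟩
      deg := P.deg
      isInternal := P.isInternal
      left_smul_mem := fun {β γ b p} hb hp => by
        rw [add_comm]
        exact (hf β b).1 hb γ p hp
      right_smul_mem := P.smul_mem }
  obtain ⟨C, -⟩ := exists_context Q f.bijective (hasDualBasis_of_projective P)
    (hasFullTrace_of_generator P hgen)
  exact ⟨C.symm⟩

end ContextOfProgenerator

/-! ### The bimodule of a graded functor -/

section GradedFunctor

variable {Γ : Type w} [AddCommGroup Γ] [DecidableEq Γ] {A B : Type u} [Ring A] [Ring B]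
  {𝒜 : Γ → AddSubgroup A} {ℬ : Γ → AddSubgroup B} {φ : GrMod 𝒜 ⥤ GrMod ℬ}

/-- The shift of a morphism. -/
def GrMod.shiftMap (γ : Γ) {M N : GrMod 𝒜} (f : M ⟶ N) : M.shift γ ⟶ N.shift γ :=
  (suspension 𝒜 γ).map f

/-- The linear map underlying a morphism to a shift. -/
def GrMod.toDeg {M N : GrMod 𝒜} {γ : Γ} (f : M ⟶ N.shift γ) : M →ₗ[Aᵐᵒᵖ] N :=
  GrMod.toLin (N := N.shift γ) f

theorem GrMod.toDeg_mem {M N : GrMod 𝒜} {γ : Γ} (f : M ⟶ N.shift γ) :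
    GrMod.toDeg f ∈ homDeg M N γ :=
  fun _ _ hm => GrMod.toLin_mem (N := N.shift γ) f hm

theorem GrMod.toDeg_injective {M N : GrMod 𝒜} {γ : Γ} {f g : M ⟶ N.shift γ}
    (h : GrMod.toDeg f = GrMod.toDeg g) : f = g :=
  GrMod.hom_ext h

theorem GrMod.shiftMap_comp {L M N : GrMod 𝒜} (γ : Γ) (f : L ⟶ M) (g : M ⟶ N) :
    GrMod.shiftMap γ (f ≫ g) = GrMod.shiftMap γ f ≫ GrMod.shiftMap γ g := rfl

theorem GrMod.shiftMap_eqToHom {M N : GrMod 𝒜} (γ : Γ) (h : M = N) (h' : M.shift γ = N.shift γ) :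
    GrMod.shiftMap γ (eqToHom h) = eqToHom h' := by
  subst h; rfl

theorem GrMod.toDeg_comp_shift_shift {M N : GrMod 𝒜} {γ δ : Γ} (f : M ⟶ (N.shift γ).shift δ) :
    GrMod.toDeg (f ≫ eqToHom (N.shift_shift γ δ)) = GrMod.toDeg f := by
  have := N.toLin_eqToHom_shift_shift γ δ (N.shift_shift γ δ)
  exact congrArg (fun k : N →ₗ[Aᵐᵒᵖ] N => k.comp (GrMod.toLin (N := (N.shift γ).shift δ) f)) this

theorem GrMod.toLin_comp_shift_zero {M N : GrMod 𝒜} (f : M ⟶ N.shift 0) :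
    GrMod.toLin (f ≫ eqToHom N.shift_zero) = GrMod.toDeg f := by
  have := N.toLin_eqToHom_shift_zero N.shift_zero
  exact congrArg (fun k : N →ₗ[Aᵐᵒᵖ] N => k.comp (GrMod.toLin (N := N.shift 0) f)) this

namespace IsGradedFunctor

theorem obj_shift (hφ : IsGradedFunctor φ) (M : GrMod 𝒜) (γ : Γ) :
    φ.obj (M.shift γ) = (φ.obj M).shift γ :=
  Functor.congr_obj (hφ.2 γ) M

theorem map_shiftMap (hφ : IsGradedFunctor φ) {M N : GrMod 𝒜} (f : M ⟶ N) (γ : Γ) :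
    φ.map (GrMod.shiftMap γ f) = eqToHom (hφ.obj_shift M γ) ≫ GrMod.shiftMap γ (φ.map f)
      ≫ eqToHom (hφ.obj_shift N γ).symm :=
  Functor.congr_hom (hφ.2 γ) f

/-- The action of a graded functor on morphisms to a shift. -/
def mapShift (hφ : IsGradedFunctor φ) {M N : GrMod 𝒜} {γ : Γ} (f : M ⟶ N.shift γ) :
    φ.obj M ⟶ (φ.obj N).shift γ :=
  φ.map f ≫ eqToHom (hφ.obj_shift N γ)

theorem mapShift_comp_shiftMap (hφ : IsGradedFunctor φ) {L M N : GrMod 𝒜} {γ : Γ}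
    (g : L ⟶ M.shift γ) (f : M ⟶ N) :
    hφ.mapShift (g ≫ GrMod.shiftMap γ f) = hφ.mapShift g ≫ GrMod.shiftMap γ (φ.map f) := by
  simp only [mapShift, Functor.map_comp, hφ.map_shiftMap, Category.assoc, eqToHom_trans,
    eqToHom_refl, Category.comp_id]

/-- Every comparison between iterated shifts is transport along an equality of objects, so any two
agree and no coherence condition on `φ` is needed beyond the strict equality with shifts. -/
theorem mapShift_comp (hφ : IsGradedFunctor φ) {L M N : GrMod 𝒜} {γ δ : Γ}
    (f : L ⟶ M.shift δ) (g : M ⟶ N.shift γ) :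
    hφ.mapShift (f ≫ GrMod.shiftMap δ g ≫ eqToHom (N.shift_shift γ δ))
      = hφ.mapShift f ≫ GrMod.shiftMap δ (hφ.mapShift g)
        ≫ eqToHom ((φ.obj N).shift_shift γ δ) := by
  simp only [mapShift, Functor.map_comp, hφ.map_shiftMap, Category.assoc, eqToHom_trans,
    eqToHom_map, GrMod.shiftMap_comp]
  rw [GrMod.shiftMap_eqToHom δ (hφ.obj_shift N γ) (congrArg (GrMod.shift δ) (hφ.obj_shift N γ)),
    eqToHom_trans]

theorem mapShift_id (hφ : IsGradedFunctor φ) {M : GrMod 𝒜} (f : M ⟶ M.shift 0)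
    (hf : f ≫ eqToHom M.shift_zero = 𝟙 M) :
    hφ.mapShift f ≫ eqToHom (φ.obj M).shift_zero = 𝟙 (φ.obj M) := by
  rw [← φ.map_id, ← hf, Functor.map_comp, eqToHom_map, mapShift, Category.assoc, eqToHom_trans]

/-- The action of a graded functor on linear maps of degree `γ`. -/
def mapDeg (hφ : IsGradedFunctor φ) (M N : GrMod 𝒜) (γ : Γ) :
    homDeg M N γ →+ (φ.obj M →ₗ[Bᵐᵒᵖ] φ.obj N) :=
  AddMonoidHom.mk' (fun f => GrMod.toDeg (hφ.mapShift (GrMod.ofDeg f.1 f.2))) fun f g => by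
    have := hφ.1
    rw [show GrMod.ofDeg (f + g).1 (f + g).2 = GrMod.ofDeg f.1 f.2 + GrMod.ofDeg g.1 g.2 from rfl,
      mapShift, Functor.map_add, Preadditive.add_comp]
    rfl

theorem mapDeg_apply (hφ : IsGradedFunctor φ) {M N : GrMod 𝒜} {γ : Γ} (f : homDeg M N γ) :
    hφ.mapDeg M N γ f = GrMod.toDeg (hφ.mapShift (GrMod.ofDeg f.1 f.2)) := rfl

theorem mapDeg_mem (hφ : IsGradedFunctor φ) {M N : GrMod 𝒜} {γ : Γ} (f : homDeg M N γ) :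
    hφ.mapDeg M N γ f ∈ homDeg (φ.obj M) (φ.obj N) γ :=
  GrMod.toDeg_mem _

theorem mapDeg_hom_comp (hφ : IsGradedFunctor φ) {L M N : GrMod 𝒜} {γ : Γ} (f : M ⟶ N)
    (g : homDeg L M γ) (h : homDeg L N γ) (hfg : h.1 = (GrMod.toLin f).comp g.1) :
    hφ.mapDeg L N γ h = (GrMod.toLin (φ.map f)).comp (hφ.mapDeg L M γ g) := by
  have e : GrMod.ofDeg h.1 h.2 = GrMod.ofDeg g.1 g.2 ≫ GrMod.shiftMap γ f :=
    GrMod.hom_ext hfg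
  rw [mapDeg_apply, e, mapShift_comp_shiftMap]
  rfl

/-- This multiplicativity across degrees is what later makes `φ(A)` a left `A`-module and the
comparison map balanced. -/
theorem mapDeg_comp (hφ : IsGradedFunctor φ) {L M N : GrMod 𝒜} {γ δ : Γ} (g : homDeg M N γ)
    (f : homDeg L M δ) (h : homDeg L N (γ + δ)) (hfg : h.1 = g.1.comp f.1) :
    hφ.mapDeg L N (γ + δ) h = (hφ.mapDeg M N γ g).comp (hφ.mapDeg L M δ f) := by
  have e : GrMod.ofDeg h.1 h.2 = GrMod.ofDeg f.1 f.2 ≫ GrMod.shiftMap δ (GrMod.ofDeg g.1 g.2)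
      ≫ eqToHom (N.shift_shift γ δ) := by
    refine GrMod.toDeg_injective ?_
    rw [← Category.assoc, GrMod.toDeg_comp_shift_shift]
    exact hfg
  rw [mapDeg_apply, e, mapShift_comp, ← Category.assoc, GrMod.toDeg_comp_shift_shift]
  rfl

theorem mapDeg_id (hφ : IsGradedFunctor φ) {M : GrMod 𝒜} (h : homDeg M M 0)
    (hid : h.1 = LinearMap.id) : hφ.mapDeg M M 0 h = LinearMap.id := by
  have e : GrMod.ofDeg h.1 h.2 ≫ eqToHom M.shift_zero = 𝟙 M := by
    refine GrMod.hom_ext ?_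
    rw [GrMod.toLin_comp_shift_zero]
    exact hid
  rw [mapDeg_apply, ← GrMod.toLin_comp_shift_zero, hφ.mapShift_id _ e, GrMod.toLin_id]

theorem mapDeg_injective (hφ : IsGradedFunctor φ) [φ.Faithful] {M N : GrMod 𝒜} {γ : Γ}
    (f : homDeg M N γ) (hf : hφ.mapDeg M N γ f = 0) : f = 0 := by
  have h1 : hφ.mapShift (GrMod.ofDeg f.1 f.2) = 0 := GrMod.toDeg_injective hf
  have := hφ.1
  have h2 : GrMod.ofDeg f.1 f.2 = 0 := by
    apply φ.map_injective
    rw [Functor.map_zero, ← cancel_mono (eqToHom (hφ.obj_shift N γ)), Limits.zero_comp]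
    exact h1
  exact Subtype.ext (congrArg GrMod.toLin h2)

theorem mapDeg_surjective (hφ : IsGradedFunctor φ) [φ.Full] {M N : GrMod 𝒜} {γ : Γ}
    (g : φ.obj M →ₗ[Bᵐᵒᵖ] φ.obj N) (hg : g ∈ homDeg (φ.obj M) (φ.obj N) γ) :
    ∃ f, hφ.mapDeg M N γ f = g := by
  obtain ⟨f, hf⟩ := φ.map_surjective (GrMod.ofDeg g hg ≫ eqToHom (hφ.obj_shift N γ).symm)
  refine ⟨⟨GrMod.toDeg f, GrMod.toDeg_mem f⟩, ?_⟩
  have : hφ.mapShift f = GrMod.ofDeg g hg := by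
    rw [mapShift, hf, Category.assoc, eqToHom_trans, eqToHom_refl, Category.comp_id]
  exact congrArg GrMod.toDeg this

variable [GradedRing 𝒜]

/-- The map `M → Hom_B(φ(A), φ(M))` given by the action of `φ` on the maps `a ↦ m a`. -/
noncomputable def eltMap (hφ : IsGradedFunctor φ) (M : GrMod 𝒜) :
    M →+ (φ.obj (regular 𝒜) →ₗ[Bᵐᵒᵖ] φ.obj M) :=
  internalLift M.isInternal fun γ => (hφ.mapDeg (regular 𝒜) M γ).comp
    (AddMonoidHom.mk' (fun m => ⟨eltLin m.1, eltLin_mem m.2⟩) fun m m' =>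
      Subtype.ext (LinearMap.ext fun (a : A) => smul_add (op a) m.1 m'.1))

theorem eltMap_of_mem (hφ : IsGradedFunctor φ) {M : GrMod 𝒜} {γ : Γ} {m : M} (hm : m ∈ M.deg γ) :
    hφ.eltMap M m = hφ.mapDeg (regular 𝒜) M γ ⟨eltLin m, eltLin_mem hm⟩ :=
  internalLift_of_mem M.isInternal _ hm

theorem eltMap_mem (hφ : IsGradedFunctor φ) {M : GrMod 𝒜} {γ : Γ} {m : M} (hm : m ∈ M.deg γ) :
    hφ.eltMap M m ∈ homDeg (φ.obj (regular 𝒜)) (φ.obj M) γ := by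
  rw [hφ.eltMap_of_mem hm]
  exact hφ.mapDeg_mem _

theorem eltMap_natural (hφ : IsGradedFunctor φ) {M N : GrMod 𝒜} (f : M ⟶ N) (m : M) :
    hφ.eltMap N (GrMod.toLin f m) = (GrMod.toLin (φ.map f)).comp (hφ.eltMap M m) := by
  refine M.isInternal_homogeneous (p := fun m => hφ.eltMap N (GrMod.toLin f m)
    = (GrMod.toLin (φ.map f)).comp (hφ.eltMap M m)) (by simp) ?_ (fun x y hx hy => by
      rw [map_add, map_add, hx, hy, map_add, LinearMap.comp_add]) m
  intro γ m hm
  rw [hφ.eltMap_of_mem hm, hφ.eltMap_of_mem (GrMod.toLin_mem f hm)]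
  exact hφ.mapDeg_hom_comp f _ _ (LinearMap.ext fun (a : A) =>
    (map_smul (GrMod.toLin f) (op a) m).symm)

/-- For homogeneous arguments, `x ↦ (m a) x` is the composite of `x ↦ a x` and `x ↦ m x`, and
`mapDeg` preserves composites. With `M = A` it is multiplicativity of the left action on `φ(A)`; in
general it is the balancing relation. -/
theorem eltMap_smul (hφ : IsGradedFunctor φ) {M : GrMod 𝒜} (m : M) (a : A) :
    hφ.eltMap M (op a • m) = (hφ.eltMap M m).comp (hφ.eltMap (regular 𝒜) a) := by
  refine M.isInternal_homogeneous (p := fun m => hφ.eltMap M (op a • m) =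
    (hφ.eltMap M m).comp (hφ.eltMap (regular 𝒜) a)) (by simp) ?_ (fun x y hx hy => by
      rw [smul_add, map_add, map_add, hx, hy, LinearMap.add_comp]) m
  intro γ m hm
  refine isInternal_induction (ring_isInternal 𝒜) (p := fun a => hφ.eltMap M (op a • m) =
    (hφ.eltMap M m).comp (hφ.eltMap (regular 𝒜) a)) ?_ ?_ (fun x y hx hy => ?_) a
  · rw [op_zero, zero_smul, map_zero]
    exact ((congrArg _ (map_zero (hφ.eltMap (regular 𝒜)))).trans (LinearMap.comp_zero _)).symm
  · intro α a ha
    rw [hφ.eltMap_of_mem hm, hφ.eltMap_of_mem (M.smul_mem ha hm),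
      hφ.eltMap_of_mem (M := regular 𝒜) ha]
    exact hφ.mapDeg_comp _ _ _ (LinearMap.ext fun (x : A) => by
      change op x • op a • m = op (a * x) • m
      rw [op_mul, mul_smul])
  · rw [MulOpposite.op_add, add_smul, map_add, hx, hy]
    exact ((congrArg _ (map_add (hφ.eltMap (regular 𝒜)) x y)).trans (LinearMap.comp_add _ _ _)).symm

theorem eltMap_one (hφ : IsGradedFunctor φ) : hφ.eltMap (regular 𝒜) (1 : A) = LinearMap.id := by
  refine (hφ.eltMap_of_mem (M := regular 𝒜) (one_mem_deg (𝒜 := 𝒜))).trans ?_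
  exact hφ.mapDeg_id _ (LinearMap.ext fun (a : A) => show (1 : A) * a = a from one_mul a)

/-- In degree `γ` this is the chain `M_γ ≅ Hom(A, M(γ)) ≅ Hom(φ(A), φ(M)(γ))`, by full faithfulness.
Finite generation of `φ(A)` ensures that such components exhaust `Hom_B(φ(A), φ(M))`. -/
theorem eltMap_bijective (hφ : IsGradedFunctor φ) [GradedRing ℬ] [φ.Full] [φ.Faithful]
    (hfin : Module.Finite Bᵐᵒᵖ (φ.obj (regular 𝒜))) (M : GrMod 𝒜) :
    Function.Bijective (hφ.eltMap M) := by
  refine bijective_of_components M.isInternal (homDeg_isInternal _ (φ.obj M)) _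
    (fun γ m hm => hφ.eltMap_mem hm) (fun γ m hm h => ?_) fun γ g hg => ?_
  · rw [hφ.eltMap_of_mem hm] at h
    have h1 := LinearMap.congr_fun (congrArg Subtype.val (hφ.mapDeg_injective _ h)) (1 : A)
    have h2 : op (1 : A) • m = 0 := h1
    rwa [op_one, one_smul] at h2
  · obtain ⟨f, rfl⟩ := hφ.mapDeg_surjective g hg
    have hm : f.1 (1 : A) ∈ M.deg γ := by
      have := f.2 0 (1 : A) (one_mem_deg (𝒜 := 𝒜))
      rwa [zero_add] at this
    refine ⟨f.1 (1 : A), ?_⟩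
    rw [hφ.eltMap_of_mem hm]
    exact congrArg _ (Subtype.ext (eltLin_eq f.1))

/-- The `A`-`B`-bimodule `φ(A)`. -/
noncomputable def bimod (hφ : IsGradedFunctor φ) : GrBimod 𝒜 ℬ :=
  let T : A →+* Module.End Bᵐᵒᵖ (φ.obj (regular 𝒜)) :=
    { toFun := fun a : A => hφ.eltMap (regular 𝒜) a
      map_zero' := map_zero (hφ.eltMap (regular 𝒜))
      map_add' := map_add (hφ.eltMap (regular 𝒜))
      map_one' := hφ.eltMap_one
      map_mul' := fun (a b : A) => hφ.eltMap_smul (M := regular 𝒜) a b }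
  letI : Module A (φ.obj (regular 𝒜)) := Module.compHom _ T
  { carrier := φ.obj (regular 𝒜)
    smulCommClass := ⟨fun a b q => map_smul (T a) b q⟩
    deg := (φ.obj (regular 𝒜)).deg
    isInternal := (φ.obj (regular 𝒜)).isInternal
    left_smul_mem := fun {α γ a q} ha hq => by
      rw [add_comm]
      exact hφ.eltMap_mem (M := regular 𝒜) ha γ q hq
    right_smul_mem := (φ.obj (regular 𝒜)).smul_mem }

/-- The comparison map `M ⊗ φ(A) → φ(M)`. -/
noncomputable def comparison (hφ : IsGradedFunctor φ) (M : GrMod 𝒜) :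
    Tens A B M hφ.bimod →ₗ[Bᵐᵒᵖ] φ.obj M :=
  Tens.liftLin (A := A) (B := B) (Q := hφ.bimod)
    (show M →+ hφ.bimod →ₗ[Bᵐᵒᵖ] φ.obj M from hφ.eltMap M) fun m a q =>
    LinearMap.congr_fun (hφ.eltMap_smul m a) q

theorem comparison_tmul (hφ : IsGradedFunctor φ) (M : GrMod 𝒜) (m : M) (q : hφ.bimod) :
    hφ.comparison M (Tens.tmul A B m q) = hφ.eltMap M m q :=
  Tens.liftLin_tmul (A := A) (B := B) (Q := hφ.bimod)
    (show M →+ hφ.bimod →ₗ[Bᵐᵒᵖ] φ.obj M from hφ.eltMap M) _ m q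

theorem comparison_mem (hφ : IsGradedFunctor φ) (M : GrMod 𝒜) {γ : Γ} {x : Tens A B M hφ.bimod}
    (hx : x ∈ tensGrading (A := A) (B := B) M.deg hφ.bimod.deg γ) :
    hφ.comparison M x ∈ (φ.obj M).deg γ := by
  refine AddSubgroup.closure_induction (p := fun z _ => hφ.comparison M z ∈ (φ.obj M).deg γ) ?_
    (by simp) (fun x y _ _ hx hy => by rw [map_add]; exact add_mem hx hy)
    (fun x _ hx => by rw [map_neg]; exact neg_mem hx) hx
  rintro _ ⟨i, j, rfl, m, hm, q, hq, rfl⟩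
  rw [comparison_tmul, add_comm]
  exact hφ.eltMap_mem hm j q hq

theorem comparison_natural (hφ : IsGradedFunctor φ) {M N : GrMod 𝒜} (f : M ⟶ N)
    (x : Tens A B M hφ.bimod) :
    hφ.comparison N (Tens.map B hφ.bimod (GrMod.toLin f) x)
      = GrMod.toLin (φ.map f) (hφ.comparison M x) := by
  refine Tens.induction (p := fun x => hφ.comparison N (Tens.map B hφ.bimod (GrMod.toLin f) x)
      = GrMod.toLin (φ.map f) (hφ.comparison M x)) (by simp) (fun m q => ?_)
      (fun x y hx hy => by rw [map_add, map_add, map_add, hx, hy, map_add]) x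
  rw [Tens.map_tmul, comparison_tmul, comparison_tmul, hφ.eltMap_natural]
  rfl

end IsGradedFunctor

end GradedFunctor

/-! ### Generators and finitely generated objects under equivalences -/

section JointlyEpi

variable {C D : Type*} [Category* C] [Category* D] [Preadditive C] [Preadditive D]

/-- A family of morphisms to `X` detects the nonzero morphisms from `X`. -/
def JointlyEpi {ι : Type*} {Y : ι → C} {X : C} (f : ∀ i, Y i ⟶ X) : Prop :=
  ∀ (N : C) (h : X ⟶ N), (∀ i, f i ≫ h = 0) → h = 0

theorem JointlyEpi.comp_iso {ι : Type*} {Y : ι → C} {X X' : C} {f : ∀ i, Y i ⟶ X}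
    (hf : JointlyEpi f) (e : X ≅ X') : JointlyEpi fun i => f i ≫ e.hom := fun N h hh => by
  have := hf N (e.hom ≫ h) fun i => by rw [← Category.assoc]; exact hh i
  rwa [← cancel_epi e.hom, Limits.comp_zero]

/-- By essential surjectivity and fullness, a morphism out of `F X` is, up to an isomorphism of its
target, the image of a morphism out of `X`. -/
theorem JointlyEpi.map {ι : Type*} {Y : ι → C} {X : C} {f : ∀ i, Y i ⟶ X} (hf : JointlyEpi f)
    (F : C ⥤ D) [F.Additive] [F.IsEquivalence] : JointlyEpi fun i => F.map (f i) := by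
  intro N h hh
  obtain ⟨k, hk⟩ := F.map_surjective (h ≫ (F.objObjPreimageIso N).inv)
  have hk0 : k = 0 := hf _ k fun i => F.map_injective <| by
    rw [F.map_comp, hk, ← Category.assoc, hh, Limits.zero_comp, F.map_zero]
  rw [hk0, F.map_zero] at hk
  rw [← cancel_mono (F.objObjPreimageIso N).inv, ← hk, Limits.zero_comp]

theorem JointlyEpi.of_map {ι : Type*} {Y : ι → C} {X : C} {f : ∀ i, Y i ⟶ X}
    (F : C ⥤ D) [F.Additive] [F.Faithful] (hf : JointlyEpi fun i => F.map (f i)) :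
    JointlyEpi f := fun N h hh => F.map_injective <| by
  rw [F.map_zero]
  exact hf _ _ fun i => by rw [← F.map_comp, hh, F.map_zero]

/-- Every jointly epimorphic family of morphisms to `X` has a finite jointly epimorphic
subfamily. -/
def IsFinGen.{v, v₁, u₁} {C : Type u₁} [Category.{v₁} C] [Preadditive C] (X : C) : Prop :=
  ∀ (ι : Type v) (Y : ι → C) (f : ∀ i, Y i ⟶ X), JointlyEpi f →
    ∃ s : Finset ι, JointlyEpi fun i : s => f i

/-- A cover of `F X` is carried by the inverse equivalence to a cover of `X`; a finite subcover
found there is reflected back by faithfulness. Finite generation is thereby a categorical property,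
which lets it pass along equivalences. -/
theorem IsFinGen.map {X : C} (hX : IsFinGen.{w} X) (F : C ⥤ D) [F.Additive]
    [F.IsEquivalence] : IsFinGen.{w} (F.obj X) := by
  intro ι Y f hf
  have : F.asEquivalence.functor.Additive := inferInstanceAs F.Additive
  have : F.inv.Additive := F.asEquivalence.inverse_additive
  let e : F.inv.obj (F.obj X) ≅ X := (F.asEquivalence.unitIso.app X).symm
  obtain ⟨s, hs⟩ := hX ι _ _ ((hf.map F.inv).comp_iso e)
  refine ⟨s, JointlyEpi.of_map F.inv ?_⟩
  have := hs.comp_iso e.symm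
  simpa using this

end JointlyEpi

/-! ### Covers, generators and finite generation in `Gr-A` -/

section GradedCovers

variable {Γ : Type w} [AddCommGroup Γ] [DecidableEq Γ] {A : Type u} [Ring A]
  {𝒜 : Γ → AddSubgroup A}

theorem GrMod.jointlyEpi_iff {M : GrMod 𝒜} {ι : Type*} {Y : ι → GrMod 𝒜} (f : ∀ i, Y i ⟶ M) :
    JointlyEpi f ↔ ⨆ i, LinearMap.range (toLin (f i)) = ⊤ := by
  refine ⟨fun hf => iSup_range_eq_top f hf, fun hf N h hh => hom_ext ?_⟩
  change toLin h = 0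
  rw [← LinearMap.ker_eq_top, eq_top_iff, ← hf]
  refine iSup_le fun i => LinearMap.range_le_ker_iff.2 ?_
  exact congrArg toLin (hh i)

theorem IsGradedGenerator.jointlyEpi {P : GrMod 𝒜} (hP : IsGradedGenerator P) (M : GrMod 𝒜) :
    JointlyEpi fun i : Σ γ : Γ, P.shift γ ⟶ M => i.2 := fun N f hf => by
  by_contra hne
  obtain ⟨γ, g, hg⟩ := hP f hne
  exact hg (hf ⟨γ, g⟩)

/-- The shifts of `P` cover a preimage of `M`. Their images under `φ` are shifts of `φ(P)`, by the
strict equality with shifts, and they cover `M`. -/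
theorem IsGradedGenerator.map {B : Type u} [Ring B] {ℬ : Γ → AddSubgroup B}
    {φ : GrMod 𝒜 ⥤ GrMod ℬ} {P : GrMod 𝒜} (hP : IsGradedGenerator P) (hφ : IsGradedFunctor φ)
    [φ.IsEquivalence] : IsGradedGenerator (φ.obj P) := by
  have := hφ.1
  intro M N f hf
  by_contra! hzero
  refine hf (((hP.jointlyEpi _).map φ).comp_iso (φ.objObjPreimageIso M) N f ?_)
  rintro ⟨γ, g⟩
  have := hzero γ (eqToHom (hφ.obj_shift P γ).symm ≫ φ.map g ≫ (φ.objObjPreimageIso M).hom)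
  rw [Category.assoc, ← cancel_epi (eqToHom (hφ.obj_shift P γ))] at this
  simpa using this

theorem IsGradedEquivalence.isEquivalence {B : Type u} [Ring B] {ℬ : Γ → AddSubgroup B}
    {φ : GrMod 𝒜 ⥤ GrMod ℬ} (h : IsGradedEquivalence φ) : φ.IsEquivalence := by
  obtain ⟨-, ψ, -, ⟨e⟩, ⟨e'⟩⟩ := h
  exact (CategoryTheory.Equivalence.mk φ ψ e.symm e').isEquivalence_functor

variable [GradedRing 𝒜]

theorem isGradedGenerator_regular : IsGradedGenerator (regular 𝒜) := by
  intro M N f hf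
  by_contra! hzero
  refine hf (GrMod.hom_ext (LinearMap.ext fun m => ?_))
  change GrMod.toLin f m = 0
  refine M.isInternal_homogeneous (p := fun m => GrMod.toLin f m = 0) (map_zero _) ?_
    (fun x y hx hy => by rw [map_add, hx, hy, add_zero]) m
  intro γ m hm
  have key : ∀ (a : A), op a • m ∈ LinearMap.ker (GrMod.toLin f) := by
    intro a
    have hdeg : ∀ δ, ∀ a ∈ 𝒜 (δ + -γ), (eltLin m : A →ₗ[Aᵐᵒᵖ] M) a ∈ M.deg δ := by
      intro δ a ha
      have := M.smul_mem ha hm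
      rwa [show γ + (δ + -γ) = δ by abel] at this
    have := hzero (-γ) (GrMod.ofLin (M := (regular 𝒜).shift (-γ)) (eltLin m) hdeg)
    exact LinearMap.congr_fun (congrArg GrMod.toLin this) a
  simpa using key 1

theorem projective_regular : Projective (regular 𝒜) :=
  GrMod.projective_of_dualBasis (regular 𝒜) (n := 1) (fun _ => 0) (fun _ => (1 : A))
    (fun _ => one_mem_deg (𝒜 := 𝒜)) (fun _ => LinearMap.id)
    (fun _ γ m hm => by rw [sub_zero, add_zero]; exact hm)
    fun (x : A) => (Fin.sum_univ_one _).trans (show (1 : A) * x = x from one_mul x)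

/-- The element 1 lies in the sum of finitely many of the images, and it generates `A`. The universe
of indices is large enough for the cover of a module by all maps from shifts of `A`. -/
theorem isFinGen_regular : IsFinGen.{max u w} (regular 𝒜) := by
  intro ι Y f hf
  rw [GrMod.jointlyEpi_iff] at hf
  let e : regular 𝒜 := (1 : A)
  have h1 : e ∈ ⨆ i, LinearMap.range (GrMod.toLin (f i)) := by rw [hf]; trivial
  obtain ⟨s, hs⟩ := Submodule.mem_iSup_iff_exists_finset.1 h1
  refine ⟨s, (GrMod.jointlyEpi_iff _).2 ?_⟩
  rw [iSup_subtype'] at hs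
  rw [eq_top_iff]
  intro (a : A) _
  have := Submodule.smul_mem _ (op a) hs
  rwa [show op a • e = a from one_mul (M := A) a] at this

theorem range_eq_span_one {M : Type*} [AddCommGroup M] [Module Aᵐᵒᵖ M] (f : A →ₗ[Aᵐᵒᵖ] M) :
    LinearMap.range f = Submodule.span Aᵐᵒᵖ {f 1} := by
  refine le_antisymm ?_ ((Submodule.span_singleton_le_iff_mem _ _).2 ⟨1, rfl⟩)
  rintro _ ⟨a, rfl⟩
  refine Submodule.mem_span_singleton.2 ⟨op a, ?_⟩
  rw [← map_smul, op_smul_eq_mul, one_mul]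

/-- Apply the hypothesis to the cover by all morphisms from shifts of `A`: finitely many of them
suffice, and each has a cyclic image. -/
theorem IsFinGen.finite {M : GrMod 𝒜} (hM : IsFinGen.{max u w} M) : Module.Finite Aᵐᵒᵖ M := by
  obtain ⟨s, hs⟩ := hM _ _ _ (isGradedGenerator_regular.jointlyEpi M)
  rw [GrMod.jointlyEpi_iff] at hs
  rw [Module.finite_def, ← hs]
  refine Submodule.fg_iSup _ fun i => ?_
  exact range_eq_span_one (GrMod.toLin i.1.2) ▸ Submodule.fg_span_singleton _

end GradedCovers

/-! ### Graded equivalences as tensor products -/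

section Comparison

variable {Γ : Type w} [AddCommGroup Γ] [DecidableEq Γ] {A B : Type u} [Ring A] [Ring B]
  {𝒜 : Γ → AddSubgroup A} {ℬ : Γ → AddSubgroup B} [GradedRing 𝒜] [GradedRing ℬ]
  {φ : GrMod 𝒜 ⥤ GrMod ℬ}

/-- For `x` in the kernel and `f : Q → B`, the map `q ↦ x f(q)` is killed by `η`, hence zero, so `x`
is annihilated by the trace. For `y` in the target, the maps `q ↦ y f(q)` lift, so `y` times the
trace lies in the image. The trace contains 1. -/
theorem HasFullTrace.bijective {Q X Y : Type*} [AddCommGroup Q] [Module Bᵐᵒᵖ Q] [AddCommGroup X]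
    [Module Bᵐᵒᵖ X] [AddCommGroup Y] [Module Bᵐᵒᵖ Y] (h : HasFullTrace B Q) (η : X →ₗ[Bᵐᵒᵖ] Y)
    (hη : Function.Bijective fun f : Q →ₗ[Bᵐᵒᵖ] X => η.comp f) : Function.Bijective η := by
  constructor
  · rw [injective_iff_map_eq_zero]
    intro x hx
    have key : ∀ b ∈ AddSubgroup.closure {b | ∃ (f : Q →ₗ[Bᵐᵒᵖ] B) (q : Q), b = f q},
        (eltLin x : B →ₗ[Bᵐᵒᵖ] X) b = 0 := by
      intro b hb
      induction hb using AddSubgroup.closure_induction with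
      | zero => exact map_zero _
      | add y z _ _ hy hz => rw [map_add, hy, hz, add_zero]
      | neg z _ hz => rw [map_neg, hz, neg_zero]
      | mem z hz =>
        obtain ⟨f, q, rfl⟩ := hz
        have h0 : (eltLin x : B →ₗ[Bᵐᵒᵖ] X).comp f = 0 := hη.1 (LinearMap.ext fun q => by
          change η (op (f q) • x) = η 0
          rw [map_smul, hx, smul_zero, map_zero])
        exact LinearMap.congr_fun h0 q
    simpa [eltLin_apply] using key 1 h
  · intro y
    have key : ∀ b ∈ AddSubgroup.closure {b | ∃ (f : Q →ₗ[Bᵐᵒᵖ] B) (q : Q), b = f q},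
        (eltLin y : B →ₗ[Bᵐᵒᵖ] Y) b ∈ LinearMap.range η := by
      intro b hb
      induction hb using AddSubgroup.closure_induction with
      | zero => rw [map_zero]; exact zero_mem _
      | add y z _ _ hy hz => rw [map_add]; exact add_mem hy hz
      | neg z _ hz => rw [map_neg]; exact neg_mem hz
      | mem z hz =>
        obtain ⟨f, q, rfl⟩ := hz
        obtain ⟨g, hg⟩ := hη.2 ((eltLin y : B →ₗ[Bᵐᵒᵖ] Y).comp f)
        exact ⟨g q, LinearMap.congr_fun hg q⟩
    simpa [eltLin_apply] using key 1 h

/-- A graded functor that is an equivalence of categories is a tensor product functor. -/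
theorem IsGradedFunctor.exists_iso_grTensor (hφ : IsGradedFunctor φ) [φ.IsEquivalence] :
    ∃ C : MoritaContext 𝒜 ℬ, Nonempty (φ ≅ C.Q.grTensor) := by
  have := hφ.1
  have hfin : Module.Finite Bᵐᵒᵖ (φ.obj (regular 𝒜)) :=
    (IsFinGen.map isFinGen_regular φ).finite
  have : Projective (φ.obj (regular 𝒜)) :=
    (φ.asEquivalence.map_projective_iff (regular 𝒜)).2 projective_regular
  have htr : HasFullTrace B hφ.bimod :=
    hasFullTrace_of_generator _ (isGradedGenerator_regular.map hφ)
  obtain ⟨C, hC⟩ := exists_context hφ.bimod (hφ.eltMap_bijective hfin (regular 𝒜))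
    (hasDualBasis_of_projective (φ.obj (regular 𝒜))) htr
  have hη : ∀ M, Function.Bijective (hφ.comparison M) := by
    intro M
    -- Precomposed with the bijection `m ↦ (q ↦ m ⊗ q)`, composition with the comparison map becomes
    -- `eltMap`, also bijective; so the remaining factor is bijective.
    refine htr.bijective (hφ.comparison M) ?_
    have hmk := C.mk_bijective M
    rw [hC] at hmk
    refine (Function.Bijective.of_comp_iff _ hmk).1 ?_
    have : (fun f => (hφ.comparison M).comp f) ∘ Tens.mk A B M hφ.bimod = hφ.eltMap M :=
      funext fun m => LinearMap.ext fun q => hφ.comparison_tmul M m q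
    exact this ▸ hφ.eltMap_bijective hfin M
  refine ⟨C, ⟨Iso.symm ?_⟩⟩
  rw [hC]
  let η : ∀ M : GrMod 𝒜, hφ.bimod.grTensor.obj M ⟶ φ.obj M := fun M =>
    GrMod.ofLin (M := hφ.bimod.tensorObj M) (hφ.comparison M) fun _ _ hx => hφ.comparison_mem M hx
  have hiso : ∀ M, IsIso (η M) := fun M => GrMod.isIso_of_bijective (η M) (hη M)
  exact NatIso.ofComponents (fun M => asIso (η M)) fun {M N} f =>
    GrMod.hom_ext (LinearMap.ext fun x => hφ.comparison_natural f x)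

end Comparison

/-! ### Covers and progenerators in `Mod-A` -/

section ModuleCovers

variable {A : Type u} [Ring A]

theorem moduleCat_jointlyEpi_iff {M : ModuleCat.{u} Aᵐᵒᵖ} {ι : Type*} {Y : ι → ModuleCat.{u} Aᵐᵒᵖ}
    (f : ∀ i, Y i ⟶ M) : JointlyEpi f ↔ ⨆ i, LinearMap.range (f i).hom = ⊤ := by
  constructor
  · intro hf
    set S := ⨆ i, LinearMap.range (f i).hom with hS
    have hq : ModuleCat.ofHom S.mkQ = 0 := hf _ _ fun i => ModuleCat.hom_ext <| LinearMap.ext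
      fun y => (Submodule.Quotient.mk_eq_zero S).2 (Submodule.mem_iSup_of_mem i ⟨y, rfl⟩)
    rw [eq_top_iff]
    intro x _
    rw [← Submodule.Quotient.mk_eq_zero S]
    exact LinearMap.congr_fun (congrArg ModuleCat.Hom.hom hq) x
  · intro hf N h hh
    refine ModuleCat.hom_ext ?_
    rw [ModuleCat.hom_zero, ← LinearMap.ker_eq_top, eq_top_iff, ← hf]
    exact iSup_le fun i => LinearMap.range_le_ker_iff.2 (congrArg ModuleCat.Hom.hom (hh i))

variable (A) in
/-- The right module `A_A`. -/
abbrev regularModule : ModuleCat.{u} Aᵐᵒᵖ := ModuleCat.of Aᵐᵒᵖ A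

theorem jointlyEpi_regularModule (M : ModuleCat.{u} Aᵐᵒᵖ) :
    JointlyEpi fun g : regularModule A ⟶ M => g := by
  intro N f hf
  refine ModuleCat.hom_ext (LinearMap.ext fun m => ?_)
  have := LinearMap.congr_fun (congrArg ModuleCat.Hom.hom (hf (ModuleCat.ofHom (eltLin m)))) (1 : A)
  simpa [eltLin_apply] using this

theorem isFinGen_regularModule : IsFinGen.{u} (regularModule A) := by
  intro ι Y f hf
  rw [moduleCat_jointlyEpi_iff] at hf
  have h1 : (1 : A) ∈ ⨆ i, LinearMap.range (f i).hom := by rw [hf]; trivial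
  obtain ⟨s, hs⟩ := Submodule.mem_iSup_iff_exists_finset.1 h1
  refine ⟨s, (moduleCat_jointlyEpi_iff _).2 ?_⟩
  rw [iSup_subtype'] at hs
  rw [eq_top_iff]
  intro a _
  have := Submodule.smul_mem _ (op a) hs
  rwa [op_smul_eq_mul, one_mul] at this

theorem projective_regularModule : Projective (regularModule A) where
  factors {M N} g e _ := by
    obtain ⟨m, hm⟩ := (ModuleCat.epi_iff_surjective e).1 inferInstance (g.hom (1 : A))
    refine ⟨ModuleCat.ofHom (eltLin m), ModuleCat.hom_ext (LinearMap.ext fun (a : A) => ?_)⟩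
    change e.hom (op a • m) = g.hom a
    rw [map_smul]
    refine (congrArg (op a • ·) hm).trans ?_
    rw [← map_smul, op_smul_eq_mul, one_mul]

theorem IsFinGen.finite_moduleCat {M : ModuleCat.{u} Aᵐᵒᵖ} (hM : IsFinGen.{u} M) :
    Module.Finite Aᵐᵒᵖ M := by
  obtain ⟨s, hs⟩ := hM _ _ _ (jointlyEpi_regularModule M)
  rw [moduleCat_jointlyEpi_iff] at hs
  rw [Module.finite_def, ← hs]
  refine Submodule.fg_iSup _ fun i => ?_
  exact range_eq_span_one (ModuleCat.Hom.hom i.1) ▸ Submodule.fg_span_singleton _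

theorem hasDualBasis_of_moduleProjective (M : Type*) [AddCommGroup M] [Module Aᵐᵒᵖ M]
    [Module.Finite Aᵐᵒᵖ M] [Module.Projective Aᵐᵒᵖ M] : HasDualBasis A M := by
  obtain ⟨n, f, g, -, -, hfg⟩ := Module.Finite.exists_comp_eq_id_of_projective Aᵐᵒᵖ M
  let c : Fin n → M →ₗ[Aᵐᵒᵖ] A := fun i =>
    { toFun := fun m => (g m i).unop
      map_add' := fun m m' => by simp
      map_smul' := fun a m => by simp [MulOpposite.smul_eq_mul_unop] }
  have hid : (LinearMap.id : M →ₗ[Aᵐᵒᵖ] M)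
      = ∑ i, (eltLin (f (Pi.single i 1))).comp (c i) := by
    rw [← hfg]
    refine LinearMap.ext fun m => ?_
    rw [LinearMap.comp_apply, LinearMap.sum_apply, LinearMap.pi_apply_eq_sum_univ f]
    refine Finset.sum_congr rfl fun i _ => ?_
    rw [LinearMap.comp_apply, eltLin_apply]
    congr 2
    funext j
    simp [Pi.single_apply, eq_comm]
  rw [HasDualBasis, hid]
  exact sum_mem fun i _ => AddSubgroup.subset_closure ⟨_, _, rfl⟩

variable {B : Type u} [Ring B]

theorem hasDualBasis_of_isEquivalence (F : ModuleCat.{u} Aᵐᵒᵖ ⥤ ModuleCat.{u} Bᵐᵒᵖ) [F.Additive]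
    [F.IsEquivalence] : HasDualBasis B (F.obj (regularModule A)) := by
  have : Module.Finite Bᵐᵒᵖ (F.obj (regularModule A)) :=
    (isFinGen_regularModule.map F).finite_moduleCat
  have : Projective (F.obj (regularModule A)) :=
    (F.asEquivalence.map_projective_iff (regularModule A)).2 projective_regularModule
  have : Module.Projective Bᵐᵒᵖ (F.obj (regularModule A)) :=
    (IsProjective.iff_projective _).2 this
  exact hasDualBasis_of_moduleProjective _

/-- The maps from `A` cover a preimage of `B`, so the maps from `F(A)` cover `B`, and 1 is a sum of
their values. -/
theorem hasFullTrace_of_isEquivalence (F : ModuleCat.{u} Aᵐᵒᵖ ⥤ ModuleCat.{u} Bᵐᵒᵖ) [F.Additive]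
    [F.IsEquivalence] : HasFullTrace B (F.obj (regularModule A)) := by
  have h := ((jointlyEpi_regularModule _).map F).comp_iso (F.objObjPreimageIso (regularModule B))
  rw [moduleCat_jointlyEpi_iff] at h
  have h1 : (1 : B) ∈ (⊤ : Submodule Bᵐᵒᵖ (regularModule B)) := trivial
  rw [← h] at h1
  refine Submodule.iSup_induction _ (motive := fun b : B => b ∈ AddSubgroup.closure
    {b : B | ∃ (f : F.obj (regularModule A) →ₗ[Bᵐᵒᵖ] B) (q : F.obj (regularModule A)), b = f q})
    h1 ?_ (zero_mem _) fun _ _ => add_mem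
  rintro g _ ⟨q, rfl⟩
  exact AddSubgroup.subset_closure ⟨_, q, rfl⟩

end ModuleCovers

/-! ### From a graded equivalence of module categories to a Morita context -/

section ContextOfModEquivalence

variable {Γ : Type w} [AddCommGroup Γ] [DecidableEq Γ] {A B : Type u} [Ring A] [Ring B]
  {𝒜 : Γ → AddSubgroup A} {ℬ : Γ → AddSubgroup B} {φ : GrMod 𝒜 ⥤ GrMod ℬ}
  {φ' : ModuleCat.{u} Aᵐᵒᵖ ⥤ ModuleCat.{u} Bᵐᵒᵖ}

theorem IsAssociated.obj_eq (h : IsAssociated φ φ') (M : GrMod 𝒜) :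
    ModuleCat.of Bᵐᵒᵖ (φ.obj M) = φ'.obj (ModuleCat.of Aᵐᵒᵖ M) :=
  Functor.congr_obj h.2 M

/-- After the grading is forgotten, the shift disappears and the action of `φ` on maps of any degree
is that of `φ'`, up to transport along equalities of objects. -/
theorem IsAssociated.ofHom_mapDeg (h : IsAssociated φ φ') {M N : GrMod 𝒜} {γ : Γ}
    (f : homDeg M N γ) : ModuleCat.ofHom (h.1.mapDeg M N γ f)
      = eqToHom (h.obj_eq M) ≫ φ'.map (ModuleCat.ofHom f.1) ≫ eqToHom (h.obj_eq N).symm := by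
  have h1 : (forgetGrading ℬ).map (h.1.mapShift (GrMod.ofDeg f.1 f.2))
      = eqToHom (h.obj_eq M) ≫ φ'.map (ModuleCat.ofHom f.1) ≫
        eqToHom ((h.obj_eq (N.shift γ)).symm.trans
          (congrArg (forgetGrading ℬ).obj (h.1.obj_shift N γ))) := by
    rw [IsGradedFunctor.mapShift, Functor.map_comp, eqToHom_map, ← Functor.comp_map,
      Functor.congr_hom h.2, Category.assoc, Category.assoc, eqToHom_trans]
    rfl
  exact h1

variable [GradedRing 𝒜]

/-- The map `a ↦ m a` from `A` to `M`, as a morphism of right modules. -/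
def eltHom (M : GrMod 𝒜) (m : M) : ModuleCat.of Aᵐᵒᵖ (regular 𝒜) ⟶ ModuleCat.of Aᵐᵒᵖ M :=
  ModuleCat.ofHom (X := A) (eltLin m)

theorem eltHom_zero (M : GrMod 𝒜) : eltHom M 0 = 0 :=
  ModuleCat.hom_ext (LinearMap.ext fun _ => smul_zero _)

theorem eltHom_add (M : GrMod 𝒜) (m m' : M) : eltHom M (m + m') = eltHom M m + eltHom M m' :=
  ModuleCat.hom_ext (LinearMap.ext fun _ => smul_add _ _ _)

theorem IsAssociated.ofHom_eltMap (h : IsAssociated φ φ') [φ'.Additive] (M : GrMod 𝒜) (m : M) :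
    ModuleCat.ofHom (h.1.eltMap M m) = eqToHom (h.obj_eq (regular 𝒜)) ≫
      φ'.map (eltHom M m) ≫ eqToHom (h.obj_eq M).symm := by
  refine M.isInternal_homogeneous (p := fun m => ModuleCat.ofHom (h.1.eltMap M m) =
    eqToHom (h.obj_eq (regular 𝒜)) ≫ φ'.map (eltHom M m) ≫
      eqToHom (h.obj_eq M).symm) ?_ ?_ (fun x y hx hy => ?_) m
  · rw [map_zero, eltHom_zero, ModuleCat.ofHom_zero, Functor.map_zero, Limits.zero_comp,
      Limits.comp_zero]
  · intro γ m hm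
    rw [h.1.eltMap_of_mem hm]
    exact h.ofHom_mapDeg _
  · rw [map_add, eltHom_add, ModuleCat.ofHom_add, Functor.map_add, Preadditive.add_comp,
      Preadditive.comp_add, hx, hy]

/-- Here `φ` is not known to be full or faithful. Since `eltMap` is the action of `φ'` on all maps
`A → M`, full faithfulness of `φ'` suffices, without a decomposition into degrees. -/
theorem IsAssociated.eltMap_bijective (h : IsAssociated φ φ') [φ'.Additive] [φ'.Full]
    [φ'.Faithful] (M : GrMod 𝒜) : Function.Bijective (h.1.eltMap M) := by
  constructor
  · rw [injective_iff_map_eq_zero]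
    intro m hm
    have h1 := h.ofHom_eltMap M m
    rw [hm, ModuleCat.ofHom_zero, eq_comm, ← cancel_epi (eqToHom (h.obj_eq (regular 𝒜)).symm),
      ← cancel_mono (eqToHom (h.obj_eq M))] at h1
    simp only [Category.assoc, eqToHom_trans, eqToHom_trans_assoc, eqToHom_refl,
      Category.comp_id, Category.id_comp, Limits.zero_comp, Limits.comp_zero] at h1
    have h2 := φ'.map_injective (h1.trans (φ'.map_zero _ _).symm)
    have h3 := LinearMap.congr_fun (congrArg ModuleCat.Hom.hom h2) (1 : A)
    have h4 : op (1 : A) • m = 0 := h3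
    rwa [op_one, one_smul] at h4
  · intro g
    obtain ⟨k, hk⟩ := φ'.map_surjective (X := ModuleCat.of Aᵐᵒᵖ (regular 𝒜))
      (Y := ModuleCat.of Aᵐᵒᵖ M) (eqToHom (h.obj_eq (regular 𝒜)).symm ≫ ModuleCat.ofHom g ≫
        eqToHom (h.obj_eq M))
    let k' : A →ₗ[Aᵐᵒᵖ] M := k.hom
    refine ⟨k' 1, congrArg ModuleCat.Hom.hom (?_ : ModuleCat.ofHom _ = ModuleCat.ofHom g)⟩
    rw [h.ofHom_eltMap, show eltHom M (k' 1) = k from ModuleCat.hom_ext (eltLin_eq k'), hk]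
    simp

variable [GradedRing ℬ]

/-- A graded equivalence of module categories gives a Morita context. -/
theorem exists_context_of_modEquivalence (h : IsGradedModEquivalence 𝒜 ℬ φ') :
    Nonempty (MoritaContext 𝒜 ℬ) := by
  obtain ⟨hadd, heq, φ, h⟩ := h
  -- Both properties ignore the grading, so they are proved for `φ'(A)` and transported along the
  -- equality of modules `U φ(A) = φ' U(A)`; `φ` contributes only the grading of the bimodule.
  have hdual : HasDualBasis B (φ.obj (regular 𝒜)) :=
    (congrArg (fun X : ModuleCat.{u} Bᵐᵒᵖ => HasDualBasis B X) (h.obj_eq (regular 𝒜))).mpr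
      (hasDualBasis_of_isEquivalence φ')
  have htr : HasFullTrace B (φ.obj (regular 𝒜)) :=
    (congrArg (fun X : ModuleCat.{u} Bᵐᵒᵖ => HasFullTrace B X) (h.obj_eq (regular 𝒜))).mpr
      (hasFullTrace_of_isEquivalence φ')
  obtain ⟨C, -⟩ := exists_context h.1.bimod (h.eltMap_bijective (regular 𝒜)) hdual htr
  exact ⟨C⟩

end ContextOfModEquivalence

end GradedMorita

/-! ### The main theorem -/

open GradedMorita in
theorem mainTheorem6 {Γ : Type w} [AddCommGroup Γ] [DecidableEq Γ] {A B : Type u} [Ring A] [Ring B]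
    (𝒜 : Γ → AddSubgroup A) (ℬ : Γ → AddSubgroup B) [GradedRing 𝒜] [GradedRing ℬ] :
    [∃ φ' : ModuleCat.{u} Aᵐᵒᵖ ⥤ ModuleCat.{u} Bᵐᵒᵖ, IsGradedModEquivalence 𝒜 ℬ φ',
      ∃ φ : GrMod 𝒜 ⥤ GrMod ℬ, IsGradedEquivalence φ,
      ∃ P : GrMod 𝒜, IsGradedProgenerator P ∧ GradedIso ℬ (endGrading P),
      ∃ (n : ℕ) (_ : 0 < n) (δ : Fin n → Γ) (e : Matrix (Fin n) (Fin n) A)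
        (he : IsIdempotentElem e), IsFull e ∧ (∃ γ : Γ, e ∈ matrixGrading 𝒜 δ γ) ∧
          GradedIso ℬ (cornerGrading (matrixGrading 𝒜 δ) he)].TFAE ∧
    ∀ φ : GrMod 𝒜 ⥤ GrMod ℬ, IsGradedEquivalence φ →
      (∃ (φ' : ModuleCat.{u} Aᵐᵒᵖ ⥤ ModuleCat.{u} Bᵐᵒᵖ) (φ₁ : GrMod 𝒜 ⥤ GrMod ℬ),
        IsGradedModEquivalence 𝒜 ℬ φ' ∧ IsAssociated φ₁ φ' ∧ Nonempty (φ₁ ≅ φ)) ∧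
      ∃ Q : GrBimod 𝒜 ℬ, Nonempty (φ ≅ Q.grTensor) ∧ IsAssociated Q.grTensor Q.tensor ∧
        IsGradedModEquivalence 𝒜 ℬ Q.tensor := by
  constructor
  · tfae_have 1 ↔ 2 := by
      constructor
      · rintro ⟨φ', h⟩
        obtain ⟨C⟩ := exists_context_of_modEquivalence h
        exact ⟨C.Q.grTensor, C.isGradedEquivalence⟩
      · rintro ⟨φ, h⟩
        have := h.isEquivalence
        obtain ⟨C, -⟩ := h.1.exists_iso_grTensor
        exact ⟨C.Q.tensor, C.isGradedModEquivalence⟩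
    tfae_have 2 → 3 := by
      rintro ⟨φ, h⟩
      have := h.isEquivalence
      obtain ⟨C, -⟩ := h.1.exists_iso_grTensor
      exact ⟨C.Q'.toGrMod, C.isGradedProgenerator, C.gradedIso_end⟩
    tfae_have 3 → 4 := by
      rintro ⟨P, hP, h⟩
      obtain ⟨C⟩ := exists_context_of_progenerator P hP h
      exact C.exists_matrix
    tfae_have 4 → 2 := by
      rintro ⟨n, hn, δ, e, he, hfull, ⟨γ, hγ⟩, h⟩
      obtain ⟨ρ⟩ := exists_cornerIso he h
      let C := ρ.context (idempotent_mem_zero he hγ) he hn hfull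
      exact ⟨C.Q.grTensor, C.isGradedEquivalence⟩
    tfae_finish
  · intro φ h
    have := h.isEquivalence
    obtain ⟨C, ⟨e⟩⟩ := h.1.exists_iso_grTensor
    exact ⟨⟨C.Q.tensor, C.Q.grTensor, C.isGradedModEquivalence, C.Q.isAssociated, ⟨e.symm⟩⟩,
      C.Q, ⟨e⟩, C.Q.isAssociated, C.isGradedModEquivalence⟩
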